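/- Let $G$ be a compact Lie group, $H\subset G$ a closed subgroup, $M=G/H$, and let $b=\langle\cdot,\cdot\rangle$ be a fixed $\mathrm{Ad}_G$-invariant Euclidean metric on the Lie algebra $\mathfrak g$ of $G$. Let $\mathfrak h=\mathrm{Lie}(H)$, and let $\mathfrak g=\mathfrak h+\mathfrak m$ be the $b$-orthogonal (reductive) decomposition; $\mathfrak m$ is identified with the tangent space of $M$ at $o=eH$. An invariant Riemannian metric $g$ on $M$ is called a GO-metric if every geodesic is an orbit $t\mapsto\varphi(t)\gamma(0)$ of a one-parameter subgroup $\varphi$ of $G$. Its metric endomorphism $A$ of $\mathfrak m$ is defined by $g_o(X,Y)=\langle AX,Y\rangle$ for $X,Y\in\mathfrak m$. Let $\mathfrak k,\mathfrak k'$ be two proper subalgebras of $\mathfrak g$ that contain $\mathfrak h$ and together generate the Lie algebra $\mathfrak g$. Put $\mathfrak p=\mathfrak k\cap\mathfrak m$ and $\mathfrak p'=\mathfrak k'\cap\mathfrak m$ (so $\mathfrak k=\mathfrak h+\mathfrak p$, $\mathfrak k'=\mathfrak h+\mathfrak p'$), $\mathfrak q=\mathfrak p\cap\mathfrak p'$;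 let $\mathfrak p_1$, $\mathfrak p_2$ be the $b$-orthogonal complements of $\mathfrak q$ in $\mathfrak p$ and in $\mathfrak p'$, and $\mathfrak n$ the $b$-orthogonal complement of $\mathfrak p+\mathfrak p'$ in $\mathfrak m$. Assume that $\mathfrak p_1$ and $\mathfrak p_2$ are $b$-orthogonal, so that $$\mathfrak m=\mathfrak q+\mathfrak p_1+\mathfrak p_2+\mathfrak n$$ is a $b$-orthogonal decomposition, and that there are no non-zero $\mathrm{ad}_{\mathfrak h+\mathfrak q}$-submodules $V\subset\mathfrak p_1$ and $W\subset\mathfrak p_2$ with $[V,W]=0$. Then for every GO-metric on $M$ whose metric endomorphism $A$ preserves each of the subspaces $\mathfrak q,\mathfrak p_1,\mathfrak p_2,\mathfrak n$, the operator $A$ is scalar on $\mathfrak p_1+\mathfrak p_2+\mathfrak n$, i.e. there is $c\in\mathbb R$ with $AX=cX$ for all $X\in\mathfrak p_1+\mathfrak p_2+\mathfrak n$. In particular, suppose moreover that $\mathfrak q=0$, that $\mathfrak p_1,\mathfrak p_2,\mathfrak n$ are $\mathrm{Ad}_H$-submodules (this is automatic when $H$ is connected), and that they are pairwise strictly non-equivalent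 (no non-zero $\mathrm{Ad}_H$-submodule of one is equivalent to an $\mathrm{Ad}_H$-submodule of another). Then the only GO-metric on $M$ is, up to a positive constant factor, the normal metric: an invariant Riemannian metric $g$ on $M$ is a GO-metric if and only if $g_o|_{\mathfrak m}=c\,\langle\cdot,\cdot\rangle|_{\mathfrak m}$ for some $c>0$. -/

import Mathlib

open scoped Manifold ContDiff Topology

noncomputable section

namespace GOSpace

variable {E : Type*} [NormedAddCommGroup E] [NormedSpace ℝ E]
  {F : Type*} [NormedAddCommGroup F] [NormedSpace ℝ F]

/-! ### Lie groups, one-parameter subgroups and Lie algebras -/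

section LieGroups

variable {G : Type*} [TopologicalSpace G] [ChartedSpace E G] [Group G]

/-- A smooth real Lie group has the regularity under which Mathlib equips its tangent space at the
identity with the structure of a real Lie algebra. -/
instance instLieGroupMinSmoothness [LieGroup 𝓘(ℝ, E) ∞ G] :
    LieGroup 𝓘(ℝ, E) (minSmoothness ℝ 3) G := by
  rw [minSmoothness_of_isRCLikeNormedField]
  infer_instance

/-- The adjoint action `Ad a` of `a` on the Lie algebra: the differential at `1` of the conjugation
`x ↦ a * x * a⁻¹` (which fixes `1`). -/
def Ad (a : G) (X : GroupLieAlgebra 𝓘(ℝ, E) G) : GroupLieAlgebra 𝓘(ℝ, E) G :=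
  (mfderiv 𝓘(ℝ, E) 𝓘(ℝ, E) (fun x : G => a * x * a⁻¹) 1 X : E)

variable (E) in
/-- One-parameter subgroups: smooth homomorphisms from the additive group `ℝ` to `G`. -/
def IsOneParameterSubgroup (φ : ℝ → G) : Prop :=
  ContMDiff 𝓘(ℝ, ℝ) 𝓘(ℝ, E) ∞ φ ∧ ∀ s t : ℝ, φ (s + t) = φ s * φ t

/-- The velocity at time `0` of a one-parameter subgroup `φ` (note `φ 0 = 1`), as an element of the
Lie algebra. -/
def velocity (φ : ℝ → G) : GroupLieAlgebra 𝓘(ℝ, E) G :=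
  (mfderiv 𝓘(ℝ, ℝ) 𝓘(ℝ, E) φ 0 (1 : ℝ) : E)

variable (E) in
/-- The Lie algebra of a closed subgroup `H`: the velocities of the one-parameter subgroups of `G`
that stay in `H`. (For a closed subgroup this set is already a Lie subalgebra, so that taking the
Lie subalgebra it spans adds nothing.) -/
def lieAlgebraOf [CompleteSpace E] [LieGroup 𝓘(ℝ, E) ∞ G] (H : Subgroup G) :
    LieSubalgebra ℝ (GroupLieAlgebra 𝓘(ℝ, E) G) :=
  LieSubalgebra.lieSpan ℝ (GroupLieAlgebra 𝓘(ℝ, E) G)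
    {X | ∃ φ : ℝ → G, IsOneParameterSubgroup E φ ∧ (∀ t, φ t ∈ H) ∧ velocity φ = X}

/-- `b` is an `Ad_G`-invariant Euclidean metric on the Lie algebra of `G`. -/
structure IsInvariantEuclidean (b : LinearMap.BilinForm ℝ (GroupLieAlgebra 𝓘(ℝ, E) G)) :
    Prop where
  symm : ∀ X Y, b X Y = b Y X
  pos : ∀ X, X ≠ 0 → 0 < b X X
  ad_invariant : ∀ (a : G) (X Y), b (Ad a X) (Ad a Y) = b X Y

end LieGroups

/-! ### Geodesics of a Riemannian metric -/

section Geodesics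

variable {M : Type*} [TopologicalSpace M] [ChartedSpace F M] [IsManifold 𝓘(ℝ, F) ∞ M]

variable (F M) in
/-- Smooth Riemannian metrics on the manifold `M` (without boundary, modelled on `F`). -/
abbrev Metric : Type _ :=
  Bundle.ContMDiffRiemannianMetric 𝓘(ℝ, F) ∞ F (fun x : M => TangentSpace 𝓘(ℝ, F) x)

/-- The components `g_y(u, v)` of the metric `g` in the chart around `x₀`, at the point of `M` with
coordinates `y`; here `u` and `v` are constant coordinate vectors. -/
def chartMetric (g : Metric F M) (x₀ : M) (y u v : F) : ℝ :=
  g.inner ((chartAt F x₀).symm y)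
    (mfderiv 𝓘(ℝ, F) 𝓘(ℝ, F) (chartAt F x₀).symm y u)
    (mfderiv 𝓘(ℝ, F) 𝓘(ℝ, F) (chartAt F x₀).symm y v)

/-- The geodesic equation at time `t` for a curve `c` in the coordinates of the chart around `x₀`,
with the upper index lowered: for every coordinate vector `v`,
`g(c'', v) + (∂_{c'} g)(c', v) - (1/2) (∂_v g)(c', c') = 0`,
i.e. `g_{kl} (c^k)'' + Γ_{ij,l} (c^i)' (c^j)' = 0` with the Christoffel symbols of the first kind
`Γ_{ij,l} = (1/2) (∂_i g_{jl} + ∂_j g_{il} - ∂_l g_{ij})`. -/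
def GeodesicEquationAt (g : Metric F M) (x₀ : M) (c : ℝ → F) (t : ℝ) : Prop :=
  ∀ v : F,
    chartMetric g x₀ (c t) (deriv (deriv c) t) v
      + fderiv ℝ (fun y => chartMetric g x₀ y (deriv c t) v) (c t) (deriv c t)
      - (1 / 2) * fderiv ℝ (fun y => chartMetric g x₀ y (deriv c t) (deriv c t)) (c t) v = 0

/-- `γ` is a geodesic of `g` on the open set `J` of times: it is twice continuously differentiable
there and at each time solves the geodesic equation in local coordinates around the point.
(The left-hand side of the equation is the pairing of the covariant acceleration of the curve
with the vector of coordinates `v`, so whether it holds does not depend on the chart.) -/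
def IsGeodesicOn (g : Metric F M) (γ : ℝ → M) (J : Set ℝ) : Prop :=
  ContMDiffOn 𝓘(ℝ, ℝ) 𝓘(ℝ, F) 2 γ J ∧
    ∀ t ∈ J, ∃ x₀ : M, γ t ∈ (chartAt F x₀).source ∧
      GeodesicEquationAt g x₀ (fun s => chartAt F x₀ (γ s)) t

end Geodesics

/-! ### Homogeneous Riemannian spaces -/

section Homogeneous

variable {G : Type*} [TopologicalSpace G] [ChartedSpace E G] [Group G] {H : Subgroup G}

variable (E F H) in
/-- The manifold structure on `G ⧸ H` is the quotient one, that is, the projection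
`G → G ⧸ H` is a smooth submersion. -/
def IsQuotientManifold [ChartedSpace F (G ⧸ H)] : Prop :=
  Manifold.IsSubmersion 𝓘(ℝ, E) 𝓘(ℝ, F) ∞ (fun a : G => (a : G ⧸ H))

variable [ChartedSpace F (G ⧸ H)]

variable (F H) in
/-- The differential at the identity of the projection `G → G ⧸ H`. -/
def dproj (X : GroupLieAlgebra 𝓘(ℝ, E) G) : TangentSpace 𝓘(ℝ, F) ((1 : G) : G ⧸ H) :=
  mfderiv 𝓘(ℝ, E) 𝓘(ℝ, F) (fun a : G => (a : G ⧸ H)) 1 X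

variable [IsManifold 𝓘(ℝ, F) ∞ (G ⧸ H)]

/-- `g` is `G`-invariant: every translation `x ↦ a • x` of `G ⧸ H` is an isometry. -/
def IsInvariant (g : Metric F (G ⧸ H)) : Prop :=
  ∀ (a : G) (x : G ⧸ H) (u v : TangentSpace 𝓘(ℝ, F) x),
    g.inner (a • x) (mfderiv 𝓘(ℝ, F) 𝓘(ℝ, F) (fun y : G ⧸ H => a • y) x u)
      (mfderiv 𝓘(ℝ, F) 𝓘(ℝ, F) (fun y : G ⧸ H => a • y) x v) = g.inner x u v

variable (E) in
/-- `g` is a GO-metric: it is invariant, and every geodesic, on any open interval of times (which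
we take to contain `0`), is an orbit of a one-parameter subgroup of `G`. -/
def IsGOMetric (g : Metric F (G ⧸ H)) : Prop :=
  IsInvariant g ∧
    ∀ (γ : ℝ → G ⧸ H) (J : Set ℝ), IsOpen J → J.OrdConnected → (0 : ℝ) ∈ J → IsGeodesicOn g γ J →
      ∃ φ : ℝ → G, IsOneParameterSubgroup E φ ∧ ∀ t ∈ J, γ t = φ t • γ 0

end Homogeneous

/-! ### The reductive decomposition and the decomposition defined by two subalgebras -/

section Decomposition

variable {G : Type*} [TopologicalSpace G] [ChartedSpace E G] [Group G]
  [CompleteSpace E] [LieGroup 𝓘(ℝ, E) ∞ G]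
  (b : LinearMap.BilinForm ℝ (GroupLieAlgebra 𝓘(ℝ, E) G)) (H : Subgroup G)

/-- `𝔪`, the `b`-orthogonal complement of the Lie algebra `𝔥` of `H`. -/
def mSpace : Submodule ℝ (GroupLieAlgebra 𝓘(ℝ, E) G) :=
  b.orthogonal (lieAlgebraOf E H).toSubmodule

variable (k k' : LieSubalgebra ℝ (GroupLieAlgebra 𝓘(ℝ, E) G))

/-- `𝔭 = 𝔨 ∩ 𝔪`, so that `𝔨 = 𝔥 + 𝔭` whenever `𝔨` contains `𝔥`. -/
def pSpace : Submodule ℝ (GroupLieAlgebra 𝓘(ℝ, E) G) := k.toSubmodule ⊓ mSpace b H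

/-- `𝔮 = 𝔭 ∩ 𝔭'`. -/
def qSpace : Submodule ℝ (GroupLieAlgebra 𝓘(ℝ, E) G) := pSpace b H k ⊓ pSpace b H k'

/-- The `b`-orthogonal complement of `𝔮 = 𝔭 ∩ 𝔭'` in `𝔭`. This is `𝔭₁`; exchanging the roles of
the two subalgebras gives `𝔭₂`. -/
def p1Space : Submodule ℝ (GroupLieAlgebra 𝓘(ℝ, E) G) :=
  pSpace b H k ⊓ b.orthogonal (qSpace b H k k')

/-- `𝔭₂`, the `b`-orthogonal complement of `𝔮 = 𝔭 ∩ 𝔭'` in `𝔭'`. -/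
def p2Space : Submodule ℝ (GroupLieAlgebra 𝓘(ℝ, E) G) :=
  pSpace b H k' ⊓ b.orthogonal (qSpace b H k k')

/-- `𝔫`, the `b`-orthogonal complement of `𝔭 + 𝔭'` in `𝔪`. -/
def nSpace : Submodule ℝ (GroupLieAlgebra 𝓘(ℝ, E) G) :=
  mSpace b H ⊓ b.orthogonal (pSpace b H k ⊔ pSpace b H k')

/-- There are no non-zero commuting `ad_{𝔥 + 𝔮}`-submodules of `𝔭₁` and `𝔭₂`. -/
def NoCommutingSubmodules : Prop :=
  ∀ V W : Submodule ℝ (GroupLieAlgebra 𝓘(ℝ, E) G),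
    V ≤ p1Space b H k k' → W ≤ p2Space b H k k' → V ≠ ⊥ → W ≠ ⊥ →
    (∀ Z ∈ (lieAlgebraOf E H).toSubmodule ⊔ qSpace b H k k', ∀ X ∈ V, ⁅Z, X⁆ ∈ V) →
    (∀ Z ∈ (lieAlgebraOf E H).toSubmodule ⊔ qSpace b H k k', ∀ X ∈ W, ⁅Z, X⁆ ∈ W) →
    ¬ ∀ X ∈ V, ∀ Y ∈ W, ⁅X, Y⁆ = 0

/-- `V` is an `Ad_H`-submodule of the Lie algebra of `G`. -/
def IsAdSubmodule (V : Submodule ℝ (GroupLieAlgebra 𝓘(ℝ, E) G)) : Prop :=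
  ∀ h ∈ H, ∀ X ∈ V, Ad h X ∈ V

/-- The `Ad_H`-modules `P` and `Q` are strictly non-equivalent (disjoint): no non-zero submodule of
`P` is equivalent to a submodule of `Q`. -/
def AreDisjointModules (P Q : Submodule ℝ (GroupLieAlgebra 𝓘(ℝ, E) G)) : Prop :=
  ∀ V W : Submodule ℝ (GroupLieAlgebra 𝓘(ℝ, E) G), V ≤ P → W ≤ Q →
    IsAdSubmodule H V → IsAdSubmodule H W →
    ∀ e : V ≃ₗ[ℝ] W,
      (∀ h ∈ H, ∀ X X' : V, (X' : GroupLieAlgebra 𝓘(ℝ, E) G) = Ad h (X : GroupLieAlgebra 𝓘(ℝ, E) G) →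
        (e X' : GroupLieAlgebra 𝓘(ℝ, E) G) = Ad h (e X : GroupLieAlgebra 𝓘(ℝ, E) G)) →
      V = ⊥

variable {H} [ChartedSpace F (G ⧸ H)] [IsManifold 𝓘(ℝ, F) ∞ (G ⧸ H)]

/-- `A : 𝔪 → 𝔪` is the metric endomorphism `b_𝔪⁻¹ ∘ g` of the metric `g`: identifying `𝔪` with the
tangent space of `G ⧸ H` at the origin, `g(X, Y) = b(A X, Y)`. -/
def IsMetricEndomorphism (g : Metric F (G ⧸ H)) (A : Module.End ℝ (mSpace b H)) : Prop :=
  ∀ X Y : mSpace b H,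
    g.inner ((1 : G) : G ⧸ H) (dproj F H (X : GroupLieAlgebra 𝓘(ℝ, E) G))
      (dproj F H (Y : GroupLieAlgebra 𝓘(ℝ, E) G))
      = b (A X : GroupLieAlgebra 𝓘(ℝ, E) G) (Y : GroupLieAlgebra 𝓘(ℝ, E) G)

/-- The invariant metric `g` is normal (with respect to `b`): up to a positive constant, it is given
on `𝔪` by the restriction of `b`. -/
def IsNormalMetric (g : Metric F (G ⧸ H)) : Prop :=
  IsInvariant g ∧ ∃ c : ℝ, 0 < c ∧ ∀ X ∈ mSpace b H, ∀ Y ∈ mSpace b H,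
    g.inner ((1 : G) : G ⧸ H) (dproj F H X) (dproj F H Y) = c * b X Y

/-- The endomorphism `A` of `𝔪` maps the subspace `V` of `𝔪` into itself. -/
def Preserves {b : LinearMap.BilinForm ℝ (GroupLieAlgebra 𝓘(ℝ, E) G)}
    (A : Module.End ℝ (mSpace b H)) (V : Submodule ℝ (GroupLieAlgebra 𝓘(ℝ, E) G)) : Prop :=
  ∀ X : mSpace b H, (X : GroupLieAlgebra 𝓘(ℝ, E) G) ∈ V → (A X : GroupLieAlgebra 𝓘(ℝ, E) G) ∈ V

end Decomposition

end GOSpace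

end

/-! A GO-metric obeys the geodesic lemma: for every `X ∈ 𝔪` there is `Z ∈ 𝔥` with `[X + Z, A X] =
0`. Indeed, by Noether's theorem (`hasDerivAt_momentum`) a geodesic has constant scalar product with
each fundamental vector field. If the geodesic is also an orbit with generator `X'`, differentiating
this constant at time `0` gives `g(X, [X', Y]) = 0` for all `Y`, and skewness of `ad` for `b` turns
this into `[X', A X] = 0`. This is `IsGOMetric.exists_geodesic_vector`, packaged with the symmetry
and `ad 𝔥`-equivariance of `A` in `IsGOMetric.goData`.

The rest of the first claim is algebra (`GOData.exists_eq_smul`). For eigenvectors `X`, `Y` with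
eigenvalues `λ`, `μ`, the lemma applied to `X + Y` gives `(μ - λ)[X, Y] = -λ[Z, X] - μ[Z, Y]` for
some `Z ∈ 𝔥`. Put `𝔩 = 𝔥 + 𝔮 = 𝔨 ∩ 𝔨'`; eigenspaces of `A` in `𝔭₁`, `𝔭₂`, `𝔫` are `ad 𝔩`-modules.
Since `[𝔭₁, 𝔭₂] ⊆ 𝔫`, eigenspaces of `𝔭₁` and `𝔭₂` with different eigenvalues commute, which is
excluded; so a single eigenvalue `c` occurs on `𝔭₁ + 𝔭₂`. An eigenspace `N ⊆ 𝔫` with eigenvalue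
other than `c` is stable under `𝔨` and `𝔨'`. The elements that preserve `N` and are orthogonal to it
form a subalgebra containing both, hence all of `𝔤`, so `N` is orthogonal to itself and vanishes.

For the second claim, Schur's lemma (`AreDisjointModules.bilinForm_eq_zero`) makes the three
summands orthogonal for every invariant metric, so `A` preserves them and the first claim applies.
Conversely, for a normal metric the velocity of a geodesic is the value of a fundamental field whose
generator is determined by the conserved momenta; the generator is therefore constant and the
geodesic is an orbit. -/

noncomputable section

namespace GOSpace

/-! ### First-order expansion of a local flow -/

section Flow

variable {F : Type*} [NormedAddCommGroup F] [NormedSpace ℝ F]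

/-- The spatial derivative of a local flow `Θ`, as a function of time and position, has at time `0`
the derivative `(σ, η) ↦ σ • DK` where `K` is the generating vector field of the flow. -/
theorem hasFDerivAt_spatial_fderiv_flow {Θ : ℝ × F → F} {y₀ : F} (hΘ : ContDiffAt ℝ 2 Θ (0, y₀))
    (h0 : ∀ᶠ y in 𝓝 y₀, Θ (0, y) = y) :
    DifferentiableAt ℝ (fun y => fderiv ℝ Θ (0, y) (1, 0)) y₀ ∧
    HasFDerivAt (fun p => (fderiv ℝ Θ p).comp (ContinuousLinearMap.inr ℝ ℝ F))
      ((ContinuousLinearMap.fst ℝ ℝ F).smulRight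
        (fderiv ℝ (fun y => fderiv ℝ Θ (0, y) (1, 0)) y₀)) (0, y₀) := by
  have hD : HasFDerivAt (fderiv ℝ Θ) (fderiv ℝ (fderiv ℝ Θ) (0, y₀)) (0, y₀) :=
    ((hΘ.fderiv_right (m := 1) (by norm_num)).differentiableAt (by norm_num)).hasFDerivAt
  set D2 := fderiv ℝ (fderiv ℝ Θ) (0, y₀) with hD2
  have hsymm : ∀ u w, D2 u w = D2 w u := fun u w =>
    (hΘ.isSymmSndFDerivAt (by simp)).eq u w
  have hincl : HasFDerivAt (fun y : F => ((0 : ℝ), y)) (ContinuousLinearMap.inr ℝ ℝ F) y₀ :=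
    hasFDerivAt_prodMk_right 0 y₀
  have hDy : HasFDerivAt (fun y : F => fderiv ℝ Θ (0, y))
      (D2.comp (ContinuousLinearMap.inr ℝ ℝ F)) y₀ := hD.comp y₀ hincl
  have happ : ∀ q : ℝ × F, HasFDerivAt (fun y : F => fderiv ℝ Θ (0, y) q)
      ((ContinuousLinearMap.apply ℝ F q).comp (D2.comp (ContinuousLinearMap.inr ℝ ℝ F))) y₀ :=
    fun q => (ContinuousLinearMap.apply ℝ F q).hasFDerivAt.comp y₀ hDy
  refine ⟨(happ (1, 0)).differentiableAt, ?_⟩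
  have hK := (happ (1, 0)).fderiv
  have hC : HasFDerivAt (fun p => (fderiv ℝ Θ p).comp (ContinuousLinearMap.inr ℝ ℝ F))
      (((ContinuousLinearMap.compL ℝ F (ℝ × F) F).flip (ContinuousLinearMap.inr ℝ ℝ F)).comp D2)
      (0, y₀) :=
    ((ContinuousLinearMap.compL ℝ F (ℝ × F) F).flip
      (ContinuousLinearMap.inr ℝ ℝ F)).hasFDerivAt.comp (0, y₀) hD
  refine hC.congr_fderiv ?_
  -- At time `0` the flow is the identity near `y₀`, so its spatial derivative is constant there and
  -- the purely spatial second derivative vanishes.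
  have hconst : ∀ η w : F, D2 (0, w) (0, η) = 0 := by
    intro η w
    have hΘd : ∀ᶠ y in 𝓝 y₀, DifferentiableAt ℝ Θ (0, y) := by
      have : ∀ᶠ p in 𝓝 ((0 : ℝ), y₀), DifferentiableAt ℝ Θ p := by
        filter_upwards [hΘ.eventually (by simp)] with p hp
        exact hp.differentiableAt (by norm_num)
      exact (Continuous.tendsto (by fun_prop : Continuous fun y : F => ((0 : ℝ), y)) y₀).eventually
        this
    have hev : (fun y : F => fderiv ℝ Θ (0, y) (0, η)) =ᶠ[𝓝 y₀] fun _ => η := by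
      filter_upwards [hΘd, h0.eventually_nhds] with y hy hy0
      have h1 : HasFDerivAt (fun y : F => Θ (0, y))
          ((fderiv ℝ Θ (0, y)).comp (ContinuousLinearMap.inr ℝ ℝ F)) y :=
        hy.hasFDerivAt.comp y (hasFDerivAt_prodMk_right 0 y)
      have h2 : HasFDerivAt (fun y : F => Θ (0, y)) (ContinuousLinearMap.id ℝ F) y :=
        (hasFDerivAt_id y).congr_of_eventuallyEq hy0
      have := DFunLike.congr_fun (h1.unique h2) η
      simpa using this
    have h3 := (happ (0, η)).unique ((hasFDerivAt_const η y₀).congr_of_eventuallyEq hev)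
    simpa using DFunLike.congr_fun h3 w
  apply ContinuousLinearMap.ext
  intro p
  apply ContinuousLinearMap.ext
  intro w
  rw [hK]
  obtain ⟨σ, η⟩ := p
  have hsplit : ((σ, η) : ℝ × F) = σ • ((1 : ℝ), (0 : F)) + ((0 : ℝ), η) := by simp
  simp only [ContinuousLinearMap.comp_apply, ContinuousLinearMap.flip_apply,
    ContinuousLinearMap.compL_apply, ContinuousLinearMap.smulRight_apply,
    ContinuousLinearMap.coe_fst', smul_apply, ContinuousLinearMap.inr_apply,
    ContinuousLinearMap.apply_apply]
  -- By symmetry of the second derivative only the mixed term `σ • D2 (0, w) (1, 0)` survives, and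
  -- this is `σ • DK w`.
  rw [hsymm (σ, η) (0, w), hsplit, map_add, map_smul, hconst, add_zero]

end Flow

/-! ### Differentials and velocities as maps and vectors of the model spaces -/

section ModelDerivative

variable {E E' E'' : Type*} [NormedAddCommGroup E] [NormedSpace ℝ E]
  [NormedAddCommGroup E'] [NormedSpace ℝ E'] [NormedAddCommGroup E''] [NormedSpace ℝ E'']
  {M M' M'' : Type*} [TopologicalSpace M] [ChartedSpace E M] [TopologicalSpace M']
  [ChartedSpace E' M'] [TopologicalSpace M''] [ChartedSpace E'' M'']

variable (E E') in
/-- The differential of a map between manifolds without boundary, as a map of the model spaces. -/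
def dAt (f : M → M') (x : M) : E →L[ℝ] E' := mfderiv 𝓘(ℝ, E) 𝓘(ℝ, E') f x

variable (E E') in
/-- Differentiability of a map between manifolds without boundary. -/
abbrev DiffAt (f : M → M') (x : M) : Prop := MDifferentiableAt 𝓘(ℝ, E) 𝓘(ℝ, E') f x

theorem dAt_comp {g : M' → M''} {f : M → M'} {x : M} (hg : DiffAt E' E'' g (f x))
    (hf : DiffAt E E' f x) :
    dAt E E'' (fun z => g (f z)) x = (dAt E' E'' g (f x)).comp (dAt E E' f x) :=
  mfderiv_comp x hg hf

/-- For base points that agree only propositionally, such as `a * 1` and `a`. -/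
theorem dAt_comp_of_eq {g : M' → M''} {f : M → M'} {x : M} {y : M'} (hy : f x = y)
    (hg : DiffAt E' E'' g y) (hf : DiffAt E E' f x) :
    dAt E E'' (fun z => g (f z)) x = (dAt E' E'' g y).comp (dAt E E' f x) := by
  subst hy; exact dAt_comp hg hf

theorem dAt_comp_apply {g : M' → M''} {f : M → M'} {x : M} (hg : DiffAt E' E'' g (f x))
    (hf : DiffAt E E' f x) (v : E) :
    dAt E E'' (fun z => g (f z)) x v = dAt E' E'' g (f x) (dAt E E' f x v) := by
  rw [dAt_comp hg hf]; rfl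

theorem dAt_const (c : M') (x : M) : dAt E E' (fun _ : M => c) x = 0 :=
  mfderiv_const

theorem dAt_id (x : M) : dAt E E (fun z : M => z) x = ContinuousLinearMap.id ℝ E :=
  mfderiv_id

theorem dAt_congr {f g : M → M'} {x : M} (h : f =ᶠ[𝓝 x] g) : dAt E E' f x = dAt E E' g x :=
  h.mfderiv_eq

theorem dAt_eq_fderiv (f : E → E') (x : E) : dAt E E' f x = fderiv ℝ f x :=
  mfderiv_eq_fderiv

theorem diffAt_iff {f : E → E'} {x : E} : DiffAt E E' f x ↔ DifferentiableAt ℝ f x :=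
  mdifferentiableAt_iff_differentiableAt

variable (E) in
/-- The velocity of a curve in a manifold, as a vector of the model space. -/
def vel (γ : ℝ → M) (t : ℝ) : E := dAt ℝ E γ t (1 : ℝ)

theorem vel_comp {f : M → M'} {γ : ℝ → M} {t : ℝ} (hf : DiffAt E E' f (γ t))
    (hγ : DiffAt ℝ E γ t) :
    vel E' (fun s => f (γ s)) t = dAt E E' f (γ t) (vel E γ t) := by
  rw [vel, dAt_comp_apply hf hγ]; rfl

theorem vel_eq_deriv (c : ℝ → E) (t : ℝ) : vel E c t = deriv c t := by
  rw [vel, dAt_eq_fderiv, fderiv_apply_one_eq_deriv]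

theorem vel_congr {γ δ : ℝ → M} {t : ℝ} (h : γ =ᶠ[𝓝 t] δ) : vel E γ t = vel E δ t := by
  rw [vel, dAt_congr h]; rfl

theorem vel_const (c : M) (t : ℝ) : vel E (fun _ => c) t = 0 := by
  rw [vel, dAt_const]; rfl

theorem vel_reparam {γ : ℝ → M} {r : ℝ → ℝ} {r' t : ℝ} (hγ : DiffAt ℝ E γ (r t))
    (hr : HasDerivAt r r' t) : vel E (fun s => γ (r s)) t = r' • vel E γ (r t) := by
  rw [vel, dAt_comp_apply (E' := ℝ) hγ (diffAt_iff.2 hr.differentiableAt), dAt_eq_fderiv,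
    fderiv_apply_one_eq_deriv, hr.deriv, vel, ← map_smul]
  simp

theorem vel_eq_of_hasMFDerivAt {γ : ℝ → M} {t : ℝ} {v : E}
    (h : HasMFDerivAt 𝓘(ℝ, ℝ) 𝓘(ℝ, E) γ t ((1 : ℝ →L[ℝ] ℝ).smulRight v)) : vel E γ t = v := by
  have h1 : dAt ℝ E γ t = ((1 : ℝ →L[ℝ] ℝ).smulRight v) := h.mfderiv
  rw [vel, h1]; simp

/-- The Leibniz rule for a two-variable map along a pair of curves, needed to differentiate `φ (-t)
• γ t`. -/
theorem dAt_prod {α : M × M' → M''} {f : ℝ → M} {g : ℝ → M'} {t : ℝ}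
    (hα : MDifferentiableAt (𝓘(ℝ, E).prod 𝓘(ℝ, E')) 𝓘(ℝ, E'') α (f t, g t))
    (hf : DiffAt ℝ E f t) (hg : DiffAt ℝ E' g t) :
    DiffAt ℝ E'' (fun s => α (f s, g s)) t ∧
    vel E'' (fun s => α (f s, g s)) t = dAt E E'' (fun x => α (x, g t)) (f t) (vel E f t) +
      dAt E' E'' (fun y => α (f t, y)) (g t) (vel E' g t) := by
  have hfg := hf.prodMk hg
  have hα' : MDifferentiableAt (𝓘(ℝ, E).prod 𝓘(ℝ, E')) 𝓘(ℝ, E'') α ((fun s => (f s, g s)) t) := hα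
  refine ⟨hα'.comp t hfg, ?_⟩
  have h1 : mfderiv 𝓘(ℝ, ℝ) 𝓘(ℝ, E'') (α ∘ fun s => (f s, g s)) t (1 : ℝ)
      = mfderiv (𝓘(ℝ, E).prod 𝓘(ℝ, E')) 𝓘(ℝ, E'') α (f t, g t)
        (mfderiv 𝓘(ℝ, ℝ) (𝓘(ℝ, E).prod 𝓘(ℝ, E')) (fun s => (f s, g s)) t (1 : ℝ)) := by
    rw [mfderiv_comp t hα' hfg]; rfl
  have h2 := mfderiv_prod_eq_add_apply
    (v := mfderiv 𝓘(ℝ, ℝ) (𝓘(ℝ, E).prod 𝓘(ℝ, E')) (fun s => (f s, g s)) t (1 : ℝ)) hα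
  refine (h1.trans h2).trans ?_
  have h3 := mfderiv_prodMk hf hg
  rw [h3]
  rfl

end ModelDerivative

/-! ### Curves and vector fields in charts -/

section Charts

variable {E : Type*} [NormedAddCommGroup E] [NormedSpace ℝ E]
  {M : Type*} [TopologicalSpace M] [ChartedSpace E M] [IsManifold 𝓘(ℝ, E) ∞ M]

theorem diffAt_chart (x₀ : M) {x : M} (hx : x ∈ (chartAt E x₀).source) :
    DiffAt E E (chartAt E x₀) x :=
  have : IsManifold 𝓘(ℝ, E) 1 M := .of_le (n := ∞) (by simp)
  mdifferentiableAt_atlas (chart_mem_atlas E x₀) hx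

theorem diffAt_chart_symm (x₀ : M) {y : E} (hy : y ∈ (chartAt E x₀).target) :
    DiffAt E E (chartAt E x₀).symm y :=
  have : IsManifold 𝓘(ℝ, E) 1 M := .of_le (n := ∞) (by simp)
  mdifferentiableAt_atlas_symm (chart_mem_atlas E x₀) hy

theorem dAt_chart_symm_dAt_chart (x₀ : M) {x : M} (hx : x ∈ (chartAt E x₀).source) (v : E) :
    dAt E E (chartAt E x₀).symm (chartAt E x₀ x) (dAt E E (chartAt E x₀) x v) = v := by
  rw [← dAt_comp_apply (diffAt_chart_symm x₀ ((chartAt E x₀).map_source hx)) (diffAt_chart x₀ hx)]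
  have h : (fun z => (chartAt E x₀).symm (chartAt E x₀ z)) =ᶠ[𝓝 x] fun z => z :=
    (chartAt E x₀).eventually_left_inverse hx
  rw [dAt_congr h, dAt_id]; rfl

theorem dAt_chart_dAt_chart_symm (x₀ : M) {y : E} (hy : y ∈ (chartAt E x₀).target) (v : E) :
    dAt E E (chartAt E x₀) ((chartAt E x₀).symm y) (dAt E E (chartAt E x₀).symm y v) = v := by
  rw [← dAt_comp_apply (diffAt_chart x₀ ((chartAt E x₀).map_target hy)) (diffAt_chart_symm x₀ hy)]
  have h : (fun z => (chartAt E x₀) ((chartAt E x₀).symm z)) =ᶠ[𝓝 y] fun z => z :=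
    (chartAt E x₀).eventually_right_inverse hy
  rw [dAt_congr h, dAt_id]; rfl

/-- The velocity of a curve in terms of the velocity of its coordinate expression. -/
theorem vel_eq_dAt_chart_symm (x₀ : M) {γ : ℝ → M} {t : ℝ} (hγ : DiffAt ℝ E γ t)
    (ht : γ t ∈ (chartAt E x₀).source) :
    vel E γ t = dAt E E (chartAt E x₀).symm (chartAt E x₀ (γ t))
      (deriv (fun s => chartAt E x₀ (γ s)) t) := by
  rw [← vel_eq_deriv, vel_comp (diffAt_chart x₀ ht) hγ, dAt_chart_symm_dAt_chart x₀ ht]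

theorem differentiableAt_chart_comp (x₀ : M) {γ : ℝ → M} {t : ℝ} (hγ : DiffAt ℝ E γ t)
    (ht : γ t ∈ (chartAt E x₀).source) :
    DifferentiableAt ℝ (fun s => chartAt E x₀ (γ s)) t :=
  diffAt_iff.1 ((diffAt_chart x₀ ht).comp t hγ)

/-- A curve with vanishing velocity on an open interval is constant there. -/
theorem eq_of_vel_eq_zero {γ : ℝ → M} {J : Set ℝ} (hJ : IsOpen J) (hJc : J.OrdConnected)
    (hγ : ∀ t ∈ J, DiffAt ℝ E γ t ∧ vel E γ t = 0) {s t : ℝ} (hs : s ∈ J) (ht : t ∈ J) :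
    γ s = γ t := by
  -- On a connected set it suffices that `γ` is locally constant, and this is checked in one chart.
  refine hJc.isPreconnected.induction₂ (fun s t => γ s = γ t) ?_ (fun _ _ _ _ _ _ => Eq.trans)
    (fun _ _ _ _ => Eq.symm) hs ht
  intro t ht
  refine Filter.Eventually.filter_mono nhdsWithin_le_nhds ?_
  have hc : ContinuousAt γ t := (hγ t ht).1.continuousAt
  have h1 : ∀ᶠ s in 𝓝 t, s ∈ J ∧ γ s ∈ (chartAt E (γ t)).source :=
    Filter.Eventually.and (hJ.mem_nhds ht) (hc ((chartAt E (γ t)).open_source.mem_nhds (mem_chart_source E (γ t))))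
  obtain ⟨ε, hε, hball⟩ := Metric.eventually_nhds_iff_ball.1 h1
  have hconst : ∀ s ∈ Metric.ball t ε, chartAt E (γ t) (γ s) = chartAt E (γ t) (γ t) := by
    intro s hs
    refine Metric.isOpen_ball.is_const_of_deriv_eq_zero (convex_ball t ε).isPreconnected
      (f := fun s => chartAt E (γ t) (γ s)) ?_ ?_ hs (Metric.mem_ball_self hε)
    · intro r hr
      exact (differentiableAt_chart_comp _ (hγ r (hball r hr).1).1
        (hball r hr).2).differentiableWithinAt
    · intro r hr
      rw [← vel_eq_deriv, vel_comp (diffAt_chart _ (hball r hr).2) (hγ r (hball r hr).1).1,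
        (hγ r (hball r hr).1).2, map_zero]
      rfl
  filter_upwards [Metric.ball_mem_nhds t hε] with s hs
  exact ((chartAt E (γ t)).injOn (hball s hs).2 (mem_chart_source E (γ t)) (hconst s hs)).symm

/-- The coordinate expression of a smooth vector field is smooth. -/
theorem contDiffAt_coordinate_vectorField {v : (x : M) → TangentSpace 𝓘(ℝ, E) x}
    (hv : ContMDiff 𝓘(ℝ, E) 𝓘(ℝ, E).tangent ∞
      (fun x => (⟨x, v x⟩ : TangentBundle 𝓘(ℝ, E) M))) (x₀ : M) :
    ContDiffAt ℝ ∞ (fun y => dAt E E (chartAt E x₀) ((chartAt E x₀).symm y)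
      (v ((chartAt E x₀).symm y))) (chartAt E x₀ x₀) := by
  have h1 := (Bundle.contMDiffAt_section (s := v) x₀).1 (hv x₀)
  have hs : ContMDiffAt 𝓘(ℝ, E) 𝓘(ℝ, E) ∞ (chartAt E x₀).symm (chartAt E x₀ x₀) :=
    contMDiffOn_chart_symm.contMDiffAt
      ((chartAt E x₀).open_target.mem_nhds (mem_chart_target E x₀))
  have hx : (chartAt E x₀).symm (chartAt E x₀ x₀) = x₀ :=
    (chartAt E x₀).left_inv (mem_chart_source E x₀)
  have h2 := ContMDiffAt.comp_of_eq h1 hs hx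
  rw [contMDiffAt_iff_contDiffAt] at h2
  refine h2.congr_of_eventuallyEq ?_
  filter_upwards [(chartAt E x₀).open_target.mem_nhds (mem_chart_target E x₀)] with y hy
  have : IsManifold 𝓘(ℝ, E) 1 M := .of_le (n := ∞) (by simp)
  -- The trivialization of the tangent bundle is the differential of the chart, so the fibre
  -- component of the section is the coordinate expression.
  have h3 := TangentBundle.continuousLinearMapAt_trivializationAt (I := 𝓘(ℝ, E)) (x₀ := x₀)
    ((chartAt E x₀).map_target hy)
  have h4 := DFunLike.congr_fun h3 (v ((chartAt E x₀).symm y))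
  have h5 : (trivializationAt E (TangentSpace 𝓘(ℝ, E)) x₀).continuousLinearMapAt ℝ
      ((chartAt E x₀).symm y) (v ((chartAt E x₀).symm y)) =
      (trivializationAt E (TangentSpace 𝓘(ℝ, E)) x₀
        ⟨(chartAt E x₀).symm y, v ((chartAt E x₀).symm y)⟩).2 := by
    rw [Bundle.Trivialization.continuousLinearMapAt_apply,
      Bundle.Trivialization.linearMapAt_apply, if_pos]
    exact (chartAt E x₀).map_target hy
  rw [Function.comp_apply, ← h5, h4]
  rfl

/-- Integral curves of smooth vector fields are smooth. -/
theorem contMDiff_of_isMIntegralCurve {v : (x : M) → TangentSpace 𝓘(ℝ, E) x}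
    (hv : ContMDiff 𝓘(ℝ, E) 𝓘(ℝ, E).tangent ∞
      (fun x => (⟨x, v x⟩ : TangentBundle 𝓘(ℝ, E) M)))
    {γ : ℝ → M} (hγ : IsMIntegralCurve γ v) : ContMDiff 𝓘(ℝ, ℝ) 𝓘(ℝ, E) ∞ γ := by
  intro t₀
  set x₀ := γ t₀ with hx₀
  set e := chartAt E x₀
  have hd : ∀ t, DiffAt ℝ E γ t := fun t => (hγ t).mdifferentiableAt
  have hvel : ∀ t, vel E γ t = v (γ t) := fun t => vel_eq_of_hasMFDerivAt (hγ t)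
  have hsrc : ∀ᶠ t in 𝓝 t₀, γ t ∈ e.source :=
    (hd t₀).continuousAt (e.open_source.mem_nhds (mem_chart_source E x₀))
  have hderiv : ∀ᶠ t in 𝓝 t₀, HasDerivAt (fun s => e (γ s))
      (dAt E E e (e.symm (e (γ t))) (v (e.symm (e (γ t))))) t := by
    filter_upwards [hsrc] with t ht
    have h1 := (differentiableAt_chart_comp x₀ (hd t) ht).hasDerivAt
    rw [← vel_eq_deriv, vel_comp (diffAt_chart x₀ ht) (hd t), hvel] at h1
    rw [e.left_inv ht]
    exact h1
  -- Bootstrapping: the derivative of the coordinate curve is a smooth function of the curve, so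
  -- class `C^n` improves to `C^(n+1)`.
  have hc : ∀ n : ℕ, ContDiffAt ℝ n (fun s => e (γ s)) t₀ := by
    intro n
    induction n with
    | zero =>
      refine contDiffAt_zero.2 ⟨{t | HasDerivAt (fun s => e (γ s))
        (dAt E E e (e.symm (e (γ t))) (v (e.symm (e (γ t))))) t}, hderiv, ?_⟩
      intro t ht
      exact (HasDerivAt.continuousAt ht).continuousWithinAt
    | succ n ih =>
      have h2 : ContDiffAt ℝ n (fun t => dAt E E e (e.symm (e (γ t))) (v (e.symm (e (γ t))))) t₀ :=
        ContDiffAt.comp t₀ (f := fun s => e (γ s))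
          ((contDiffAt_coordinate_vectorField hv x₀).of_le (by exact_mod_cast le_top)) ih
      have h3 : (n + 1 : ℕ) = ((n : WithTop ℕ∞) + 1) := by simp
      rw [h3, contDiffAt_succ_iff_hasFDerivAt]
      refine ⟨fun t => (1 : ℝ →L[ℝ] ℝ).smulRight (dAt E E e (e.symm (e (γ t)))
        (v (e.symm (e (γ t))))), ⟨_, hderiv, fun t ht => ?_⟩, contDiffAt_const.smulRight h2⟩
      exact HasDerivAt.hasFDerivAt ht
  have hc' : ContDiffAt ℝ ∞ (fun s => e (γ s)) t₀ := contDiffAt_infty.2 hc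
  have hsymm : ContMDiffAt 𝓘(ℝ, E) 𝓘(ℝ, E) ∞ e.symm (e (γ t₀)) :=
    contMDiffOn_chart_symm.contMDiffAt
      (e.open_target.mem_nhds (mem_chart_target E x₀))
  refine (ContMDiffAt.comp t₀ (f := fun s => e (γ s)) hsymm hc'.contMDiffAt).congr_of_eventuallyEq
    ?_
  filter_upwards [hsrc] with t ht
  exact (e.left_inv ht).symm

end Charts

/-! ### The Lie bracket of vector fields in coordinates -/

section LieBracket

variable {E : Type*} [NormedAddCommGroup E] [NormedSpace ℝ E]
  {M : Type*} [TopologicalSpace M] [ChartedSpace E M] [IsManifold 𝓘(ℝ, E) ∞ M]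

/-- The tangent space at `x` is identified with `E` by the preferred chart at `x` itself. -/
theorem dAt_chart_self (x : M) : dAt E E (chartAt E x) x = ContinuousLinearMap.id ℝ E := by
  have : IsManifold 𝓘(ℝ, E) 1 M := .of_le (n := ∞) (by simp)
  exact mfderiv_extChartAt_self (I := 𝓘(ℝ, E)) (x := x)

/-- The Lie bracket of vector fields is computed in coordinates. -/
theorem mlieBracket_eq_fderiv (V W : (x : M) → TangentSpace 𝓘(ℝ, E) x) (x₀ : M)
    {V' W' : E → E}
    (hV : ∀ᶠ y in 𝓝 (chartAt E x₀ x₀),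
      V' y = dAt E E (chartAt E x₀) ((chartAt E x₀).symm y) (V ((chartAt E x₀).symm y)))
    (hW : ∀ᶠ y in 𝓝 (chartAt E x₀ x₀),
      W' y = dAt E E (chartAt E x₀) ((chartAt E x₀).symm y) (W ((chartAt E x₀).symm y))) :
    (VectorField.mlieBracket 𝓘(ℝ, E) V W x₀ : E) =
      fderiv ℝ W' (chartAt E x₀ x₀) (V' (chartAt E x₀ x₀)) -
        fderiv ℝ V' (chartAt E x₀ x₀) (W' (chartAt E x₀ x₀)) := by
  have key : ∀ (U : (x : M) → TangentSpace 𝓘(ℝ, E) x) (y : E), y ∈ (chartAt E x₀).target →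
      VectorField.mpullbackWithin 𝓘(ℝ, E) 𝓘(ℝ, E) (extChartAt 𝓘(ℝ, E) x₀).symm U
        (Set.range 𝓘(ℝ, E)) y =
      dAt E E (chartAt E x₀) ((chartAt E x₀).symm y) (U ((chartAt E x₀).symm y)) := by
    intro U y hy
    rw [VectorField.mpullbackWithin_apply]
    have h1 : mfderivWithin 𝓘(ℝ, E) 𝓘(ℝ, E) (extChartAt 𝓘(ℝ, E) x₀).symm (Set.range 𝓘(ℝ, E)) y
        = dAt E E (chartAt E x₀).symm y := by
      rw [ModelWithCorners.Boundaryless.range_eq_univ, mfderivWithin_univ]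
      rfl
    rw [h1]
    have h2 : (dAt E E (chartAt E x₀).symm y).inverse
        = dAt E E (chartAt E x₀) ((chartAt E x₀).symm y) := by
      refine ContinuousLinearMap.inverse_eq ?_ ?_
      · apply ContinuousLinearMap.ext
        intro v
        have h3 := dAt_chart_symm_dAt_chart x₀ ((chartAt E x₀).map_target hy) v
        rw [(chartAt E x₀).right_inv hy] at h3
        exact h3
      · apply ContinuousLinearMap.ext
        intro v
        exact dAt_chart_dAt_chart_symm x₀ hy v
    exact DFunLike.congr_fun h2 _
  have htgt : ∀ᶠ y in 𝓝 (chartAt E x₀ x₀), y ∈ (chartAt E x₀).target :=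
    (chartAt E x₀).open_target.mem_nhds (mem_chart_target E x₀)
  have hV1 : VectorField.mpullbackWithin 𝓘(ℝ, E) 𝓘(ℝ, E) (extChartAt 𝓘(ℝ, E) x₀).symm V
      (Set.range 𝓘(ℝ, E)) =ᶠ[𝓝 (chartAt E x₀ x₀)] V' := by
    filter_upwards [hV, htgt] with y hy hyt
    rw [hy]; exact key V y hyt
  have hW1 : VectorField.mpullbackWithin 𝓘(ℝ, E) 𝓘(ℝ, E) (extChartAt 𝓘(ℝ, E) x₀).symm W
      (Set.range 𝓘(ℝ, E)) =ᶠ[𝓝 (chartAt E x₀ x₀)] W' := by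
    filter_upwards [hW, htgt] with y hy hyt
    rw [hy]; exact key W y hyt
  rw [← VectorField.mlieBracketWithin_univ, VectorField.mlieBracketWithin_apply]
  have hset : ((extChartAt 𝓘(ℝ, E) x₀).symm ⁻¹' Set.univ ∩ Set.range 𝓘(ℝ, E)) = Set.univ := by
    rw [ModelWithCorners.Boundaryless.range_eq_univ]; simp
  rw [hset]
  -- In the preferred chart at `x₀` the final pullback to the manifold is the identity, so the
  -- bracket is the bare coordinate expression.
  have hinv : (mfderiv 𝓘(ℝ, E) 𝓘(ℝ, E) (extChartAt 𝓘(ℝ, E) x₀) x₀).inverse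
      = ContinuousLinearMap.id ℝ E := by
    have : mfderiv 𝓘(ℝ, E) 𝓘(ℝ, E) (extChartAt 𝓘(ℝ, E) x₀) x₀ = ContinuousLinearMap.id ℝ E :=
      dAt_chart_self x₀
    rw [this]
    exact ContinuousLinearMap.inverse_id
  have hbr : ∀ P Q : E → E, P =ᶠ[𝓝 (chartAt E x₀ x₀)] V' → Q =ᶠ[𝓝 (chartAt E x₀ x₀)] W' →
      VectorField.lieBracketWithin ℝ P Q Set.univ (chartAt E x₀ x₀) =
      VectorField.lieBracket ℝ V' W' (chartAt E x₀ x₀) := by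
    intro P Q hP hQ
    rw [VectorField.lieBracketWithin_univ]
    exact Filter.EventuallyEq.lieBracket_vectorField_eq hP hQ
  exact (DFunLike.congr_fun hinv _).trans (hbr _ _ hV1 hW1)

end LieBracket

/-! ### Existence of one-parameter subgroups -/

section OneParameter

variable {E : Type*} [NormedAddCommGroup E] [NormedSpace ℝ E]
  {G : Type*} [TopologicalSpace G] [ChartedSpace E G] [Group G] [LieGroup 𝓘(ℝ, E) ∞ G]

theorem diffAt_mul_left (a x : G) : DiffAt E E (fun b : G => a * b) x :=
  (contMDiff_mul_left (n := ∞)).contMDiffAt.mdifferentiableAt (by simp)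

theorem diffAt_mul_right (a x : G) : DiffAt E E (fun b : G => b * a) x :=
  (contMDiff_mul_right (n := ∞)).contMDiffAt.mdifferentiableAt (by simp)

theorem diffAt_conj (a x : G) : DiffAt E E (fun b : G => a * b * a⁻¹) x :=
  (diffAt_mul_right a⁻¹ (a * x)).comp x (diffAt_mul_left a x)

omit [LieGroup 𝓘(ℝ, E) ∞ G] in
theorem Ad_apply (a : G) (X : GroupLieAlgebra 𝓘(ℝ, E) G) :
    Ad a X = dAt E E (fun x : G => a * x * a⁻¹) 1 X := rfl

/-- This is the left invariance of the field `c ↦ d(L_c) X`. -/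
theorem dAt_mul_left_mul (a c : G) (X : E) :
    dAt E E (fun b : G => a * c * b) 1 X = dAt E E (fun b : G => a * b) c
      (dAt E E (fun b : G => c * b) 1 X) := by
  have h : (fun b : G => a * c * b) = fun b => (fun d => a * d) (c * b) := by
    ext b; simp [mul_assoc]
  rw [h, dAt_comp_of_eq (mul_one c) (diffAt_mul_left a c) (diffAt_mul_left c 1)]
  rfl

/-- The invariant vector fields of a smooth Lie group are smooth. -/
theorem contMDiff_mulInvariantVectorField_infty (v : GroupLieAlgebra 𝓘(ℝ, E) G) :
    ContMDiff 𝓘(ℝ, E) 𝓘(ℝ, E).tangent ∞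
      (fun g : G => (⟨g, mulInvariantVectorField v g⟩ : TangentBundle 𝓘(ℝ, E) G)) := by
  -- The field is the differential of multiplication applied to `(0_g, v)`: a composite of the zero
  -- section, a constant section and a tangent map, all smooth.
  let fg : G → TangentBundle 𝓘(ℝ, E) G := fun g => Bundle.TotalSpace.mk' E g 0
  have sfg : ContMDiff 𝓘(ℝ, E) 𝓘(ℝ, E).tangent ∞ fg := Bundle.contMDiff_zeroSection _ _
  let fv : G → TangentBundle 𝓘(ℝ, E) G := fun _ => Bundle.TotalSpace.mk' E 1 v
  have sfv : ContMDiff 𝓘(ℝ, E) 𝓘(ℝ, E).tangent ∞ fv := contMDiff_const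
  let F₁ : G → (TangentBundle 𝓘(ℝ, E) G × TangentBundle 𝓘(ℝ, E) G) := fun g => (fg g, fv g)
  have S₁ : ContMDiff 𝓘(ℝ, E) (𝓘(ℝ, E).tangent.prod 𝓘(ℝ, E).tangent) ∞ F₁ := sfg.prodMk sfv
  let F₂ : (TangentBundle 𝓘(ℝ, E) G × TangentBundle 𝓘(ℝ, E) G) →
      TangentBundle (𝓘(ℝ, E).prod 𝓘(ℝ, E)) (G × G) :=
    (equivTangentBundleProd 𝓘(ℝ, E) G 𝓘(ℝ, E) G).symm
  have S₂ : ContMDiff (𝓘(ℝ, E).tangent.prod 𝓘(ℝ, E).tangent)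
      (𝓘(ℝ, E).prod 𝓘(ℝ, E)).tangent ∞ F₂ := contMDiff_equivTangentBundleProd_symm
  let F₃ : TangentBundle (𝓘(ℝ, E).prod 𝓘(ℝ, E)) (G × G) → TangentBundle 𝓘(ℝ, E) G :=
    tangentMap (𝓘(ℝ, E).prod 𝓘(ℝ, E)) 𝓘(ℝ, E) (fun p : G × G => p.1 * p.2)
  have S₃ : ContMDiff (𝓘(ℝ, E).prod 𝓘(ℝ, E)).tangent 𝓘(ℝ, E).tangent ∞ F₃ := by
    apply ContMDiff.contMDiff_tangentMap _ (m := ∞) (n := ∞) (by simp)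
    exact contMDiff_mul 𝓘(ℝ, E) ∞
  have S := (S₃.comp S₂).comp S₁
  convert! S with g
  · simp [F₁, F₂, F₃, fg, fv]
  · simp only [Function.comp_apply, tangentMap, F₃, F₂, F₁, fg, fv]
    rw [mfderiv_prod_eq_add_apply ((contMDiff_mul 𝓘(ℝ, E) ∞).mdifferentiableAt (by simp))]
    change dAt E E (fun b : G => g * b) 1 v =
      dAt E E (fun b : G => b * (1 : G)) g 0 + dAt E E (fun b : G => g * b) 1 v
    rw [map_zero, zero_add]

/-- Left translation moves one short integral curve to every starting point, which gives a uniform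
existence time and hence completeness. -/
theorem isMIntegralCurve_mul_left {X : GroupLieAlgebra 𝓘(ℝ, E) G} {γ : ℝ → G} {s : Set ℝ}
    (hγ : IsMIntegralCurveOn γ (mulInvariantVectorField X) s) (a : G) :
    IsMIntegralCurveOn (fun t => a * γ t) (mulInvariantVectorField X) s := by
  intro t ht
  have h1 := hγ t ht
  have h2 := (diffAt_mul_left (E := E) a (γ t)).hasMFDerivAt.comp_hasMFDerivWithinAt t h1
  have h3 : (mfderiv 𝓘(ℝ, E) 𝓘(ℝ, E) (fun b : G => a * b) (γ t)).comp
      ((1 : ℝ →L[ℝ] ℝ).smulRight (mulInvariantVectorField X (γ t))) =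
      ((1 : ℝ →L[ℝ] ℝ).smulRight (mulInvariantVectorField X (a * γ t))) := by
    have h4 := (dAt_mul_left_mul (E := E) a (γ t) X).symm
    apply ContinuousLinearMap.ext
    intro r
    change dAt E E (fun b : G => a * b) (γ t) (r • dAt E E (fun b : G => γ t * b) 1 X) = _
    rw [map_smul, h4]
    rfl
  exact h3 ▸ h2

variable [T2Space G] [CompleteSpace E]

/-- Every element of the Lie algebra is the velocity of a one-parameter subgroup. -/
theorem exists_oneParameterSubgroup (X : GroupLieAlgebra 𝓘(ℝ, E) G) :
    ∃ φ : ℝ → G, IsOneParameterSubgroup E φ ∧ velocity φ = X := by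
  have : IsManifold 𝓘(ℝ, E) 1 G := .of_le (n := ∞) (by simp)
  have hv := contMDiff_mulInvariantVectorField_infty X
  have hv1 := hv.of_le (m := 1) (by simp)
  obtain ⟨γ, hγ0, hγ⟩ := exists_isMIntegralCurveAt_of_contMDiffAt_boundaryless (t₀ := 0)
    (hv1.contMDiffAt (x := (1 : G)))
  obtain ⟨ε, hε, hγε⟩ := isMIntegralCurveAt_iff'.1 hγ
  -- The same `ε` serves at every `x`, so integral curves extend to all of `ℝ`.
  have hunif : ∀ x : G, ∃ δ : ℝ → G, δ 0 = x ∧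
      IsMIntegralCurveOn δ (mulInvariantVectorField X) (Set.Ioo (-ε) ε) := by
    intro x
    refine ⟨fun t => x * γ t, by simp [hγ0], isMIntegralCurve_mul_left ?_ x⟩
    have : Set.Ioo (-ε) ε = Metric.ball (0 : ℝ) ε := by rw [Real.ball_eq_Ioo]; simp
    rwa [this]
  obtain ⟨φ, hφ0, hφ⟩ := exists_isMIntegralCurve_of_isMIntegralCurveOn hv1 hε hunif 1
  refine ⟨φ, ⟨contMDiff_of_isMIntegralCurve hv hφ, fun s t => ?_⟩, ?_⟩
  -- Both `t ↦ φ (t + s)` and `t ↦ φ s * φ t` are integral curves through `φ s` at time `0`;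
  -- uniqueness gives the homomorphism property.
  · have h1 : IsMIntegralCurve (φ ∘ (· + s)) (mulInvariantVectorField X) := hφ.comp_add s
    have h2 : IsMIntegralCurve (fun t => φ s * φ t) (mulInvariantVectorField X) := by
      rw [isMIntegralCurve_iff_isMIntegralCurveOn] at hφ ⊢
      exact isMIntegralCurve_mul_left hφ (φ s)
    have h3 := isMIntegralCurve_Ioo_eq_of_contMDiff_boundaryless (t₀ := 0) hv1 h1 h2
      (by simp [hφ0])
    rw [add_comm s t]
    exact congrFun h3 t
  · have h1 : vel E φ 0 = mulInvariantVectorField X (φ 0) := vel_eq_of_hasMFDerivAt (hφ 0)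
    refine h1.trans ?_
    change dAt E E (fun b => φ 0 * b) 1 X = X
    rw [hφ0]
    simp only [one_mul, dAt_id]
    rfl

end OneParameter

/-! ### A global flow written in a chart -/

section CoordinateFlow

variable {E : Type*} [NormedAddCommGroup E] [NormedSpace ℝ E]
  {M : Type*} [TopologicalSpace M] [ChartedSpace E M] [IsManifold 𝓘(ℝ, E) ∞ M]

variable (E) in
/-- The coordinate expression, in the chart around `x₀`, of a flow `α` on a manifold. -/
def coordFlow (α : ℝ × M → M) (x₀ : M) (p : ℝ × E) : E :=
  chartAt E x₀ (α (p.1, (chartAt E x₀).symm p.2))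

variable {α : ℝ × M → M} (hα : ContMDiff (𝓘(ℝ, ℝ).prod 𝓘(ℝ, E)) 𝓘(ℝ, E) ∞ α) {x₀ : M}

include hα

theorem contDiffAt_coordFlow {s : ℝ} {y : E} (hy : y ∈ (chartAt E x₀).target)
    (hs : α (s, (chartAt E x₀).symm y) ∈ (chartAt E x₀).source) :
    ContDiffAt ℝ ∞ (coordFlow E α x₀) (s, y) := by
  rw [← contMDiffAt_iff_contDiffAt]
  have h1 : ContMDiffAt 𝓘(ℝ, E) 𝓘(ℝ, E) ∞ (chartAt E x₀).symm y :=
    contMDiffOn_chart_symm.contMDiffAt ((chartAt E x₀).open_target.mem_nhds hy)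
  have h2 : ContMDiffAt 𝓘(ℝ, E) 𝓘(ℝ, E) ∞ (chartAt E x₀) (α (s, (chartAt E x₀).symm y)) :=
    contMDiffOn_chart.contMDiffAt ((chartAt E x₀).open_source.mem_nhds hs)
  have h3 : ContMDiffAt 𝓘(ℝ, ℝ × E) 𝓘(ℝ, ℝ) ∞ (fun p : ℝ × E => p.1) (s, y) :=
    contDiffAt_fst.contMDiffAt
  have h4 : ContMDiffAt 𝓘(ℝ, ℝ × E) 𝓘(ℝ, E) ∞ (fun p : ℝ × E => p.2) (s, y) :=
    contDiffAt_snd.contMDiffAt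
  have h5 : ContMDiffAt 𝓘(ℝ, ℝ × E) 𝓘(ℝ, E) ∞ (fun p : ℝ × E => (chartAt E x₀).symm p.2) (s, y) :=
    ContMDiffAt.comp (s, y) (f := fun p : ℝ × E => p.2) h1 h4
  have h6 := ContMDiffAt.comp (s, y) (f := fun p : ℝ × E => (p.1, (chartAt E x₀).symm p.2))
    (hα.contMDiffAt) (h3.prodMk h5)
  exact ContMDiffAt.comp (s, y) (f := fun p : ℝ × E => α (p.1, (chartAt E x₀).symm p.2)) h2 h6

omit [IsManifold 𝓘(ℝ, E) ∞ M] in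
theorem diffAt_flow_right (s : ℝ) (x : M) : DiffAt E E (fun z => α (s, z)) x :=
  ((hα.comp (contMDiff_const.prodMk contMDiff_id)).contMDiffAt).mdifferentiableAt (by simp)

omit [IsManifold 𝓘(ℝ, E) ∞ M] in
theorem diffAt_flow_left (s : ℝ) (x : M) : DiffAt ℝ E (fun r => α (r, x)) s :=
  ((hα.comp (contMDiff_id.prodMk contMDiff_const)).contMDiffAt).mdifferentiableAt (by simp)

theorem fderiv_coordFlow_inr {s : ℝ} {y : E} (hy : y ∈ (chartAt E x₀).target)
    (hs : α (s, (chartAt E x₀).symm y) ∈ (chartAt E x₀).source) (w : E) :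
    fderiv ℝ (coordFlow E α x₀) (s, y) (0, w) =
      dAt E E (chartAt E x₀) (α (s, (chartAt E x₀).symm y))
        (dAt E E (fun z => α (s, z)) ((chartAt E x₀).symm y)
          (dAt E E (chartAt E x₀).symm y w)) := by
  have h1 : HasFDerivAt (fun z : E => coordFlow E α x₀ (s, z))
      ((fderiv ℝ (coordFlow E α x₀) (s, y)).comp (ContinuousLinearMap.inr ℝ ℝ E)) y :=
    ((contDiffAt_coordFlow hα hy hs).differentiableAt (by simp)).hasFDerivAt.comp y
      (hasFDerivAt_prodMk_right s y)
  have h2 := DFunLike.congr_fun h1.fderiv w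
  rw [← dAt_eq_fderiv] at h2
  have h3 : DiffAt E E (fun z => α (s, (chartAt E x₀).symm z)) y :=
    (diffAt_flow_right hα s _).comp y (diffAt_chart_symm x₀ hy)
  change dAt E E (fun z => chartAt E x₀ (α (s, (chartAt E x₀).symm z))) y w = _ at h2
  rw [dAt_comp_apply (g := chartAt E x₀) (f := fun z => α (s, (chartAt E x₀).symm z))
    (diffAt_chart x₀ hs) h3,
    dAt_comp_apply (g := fun z => α (s, z)) (diffAt_flow_right hα s _)
      (diffAt_chart_symm x₀ hy)] at h2
  exact h2.symm

variable (h0 : ∀ x, α (0, x) = x)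

include h0

omit hα [NormedSpace ℝ E] [IsManifold 𝓘(ℝ, E) ∞ M] in
theorem coordFlow_zero {y : E} (hy : y ∈ (chartAt E x₀).target) :
    coordFlow E α x₀ (0, y) = y := by
  rw [coordFlow, h0, (chartAt E x₀).right_inv hy]

theorem fderiv_coordFlow_time {y : E} (hy : y ∈ (chartAt E x₀).target) :
    fderiv ℝ (coordFlow E α x₀) (0, y) (1, 0) =
      dAt E E (chartAt E x₀) ((chartAt E x₀).symm y)
        (vel E (fun s => α (s, (chartAt E x₀).symm y)) 0) := by
  have hs : α (0, (chartAt E x₀).symm y) ∈ (chartAt E x₀).source := by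
    rw [h0]; exact (chartAt E x₀).map_target hy
  have hd : HasFDerivAt (coordFlow E α x₀) (fderiv ℝ (coordFlow E α x₀) (0, y)) (0, y) :=
    ((contDiffAt_coordFlow hα hy hs).differentiableAt (by simp)).hasFDerivAt
  have h1 : HasFDerivAt (fun s : ℝ => coordFlow E α x₀ (s, y))
      ((fderiv ℝ (coordFlow E α x₀) (0, y)).comp (ContinuousLinearMap.inl ℝ ℝ E)) 0 :=
    HasFDerivAt.comp (g := coordFlow E α x₀) (f := fun s : ℝ => (s, y)) (0 : ℝ) hd
      (hasFDerivAt_prodMk_left (𝕜 := ℝ) (0 : ℝ) y)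
  have h2 := DFunLike.congr_fun h1.fderiv 1
  rw [← dAt_eq_fderiv] at h2
  change vel E (fun s => chartAt E x₀ (α (s, (chartAt E x₀).symm y))) 0 = _ at h2
  rw [vel_comp (f := chartAt E x₀) (diffAt_chart x₀ hs) (diffAt_flow_left hα 0 _), h0] at h2
  exact h2.symm

/-- The velocity field of the flow in coordinates is differentiable, and the spatial derivative of
the flow depends differentiably on time and position. -/
theorem hasFDerivAt_coordFlow {y₀ : E} (hy : y₀ ∈ (chartAt E x₀).target) :
    DifferentiableAt ℝ (fun y => fderiv ℝ (coordFlow E α x₀) (0, y) (1, 0)) y₀ ∧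
    HasFDerivAt (fun p => (fderiv ℝ (coordFlow E α x₀) p).comp (ContinuousLinearMap.inr ℝ ℝ E))
      ((ContinuousLinearMap.fst ℝ ℝ E).smulRight
        (fderiv ℝ (fun y => fderiv ℝ (coordFlow E α x₀) (0, y) (1, 0)) y₀)) (0, y₀) := by
  refine hasFDerivAt_spatial_fderiv_flow ?_ ?_
  · refine (contDiffAt_coordFlow hα hy ?_).of_le ENat.LEInfty.out
    rw [h0]; exact (chartAt E x₀).map_target hy
  · filter_upwards [(chartAt E x₀).open_target.mem_nhds hy] with y hy
    exact coordFlow_zero h0 hy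

end CoordinateFlow

/-! ### The adjoint action and its derivative -/

section Adjoint

variable {E : Type*} [NormedAddCommGroup E] [NormedSpace ℝ E]
  {G : Type*} [TopologicalSpace G] [ChartedSpace E G] [Group G]

namespace IsOneParameterSubgroup

variable {φ : ℝ → G} (hφ : IsOneParameterSubgroup E φ)

include hφ

theorem map_zero : φ 0 = 1 := by
  have h := hφ.2 0 0
  rw [add_zero] at h
  exact left_eq_mul.1 h

theorem map_neg (t : ℝ) : φ (-t) = (φ t)⁻¹ := by
  rw [eq_inv_iff_mul_eq_one, ← hφ.2, neg_add_cancel, hφ.map_zero]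

theorem diffAt (t : ℝ) : DiffAt ℝ E φ t := hφ.1.contMDiffAt.mdifferentiableAt (by simp)

variable [LieGroup 𝓘(ℝ, E) ∞ G]

theorem vel_eq (t : ℝ) : vel E φ t = dAt E E (fun b => φ t * b) 1 (velocity φ : E) := by
  have h1 : vel E (fun s => φ (t + s)) 0 = vel E φ t := by
    have := vel_reparam (E := E) (γ := φ) (r := fun s => t + s) (r' := 1) (t := 0)
      (by simpa using hφ.diffAt t) ((hasDerivAt_id (0 : ℝ)).const_add t)
    simpa using this
  have h2 : (fun s => φ (t + s)) = fun s => (fun b => φ t * b) (φ s) := by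
    ext s; exact hφ.2 t s
  rw [← h1, h2, vel_comp (f := fun b => φ t * b) (diffAt_mul_left _ _) (hφ.diffAt 0), hφ.map_zero]
  rfl

end IsOneParameterSubgroup

variable [LieGroup 𝓘(ℝ, E) ∞ G]

/-- Conjugation is a left translation followed by a right translation. For `a = φ t` this reads:
take the left-invariant field at `φ t` and carry it back to `1` by the flow of right translations.
-/
theorem Ad_eq (a : G) (X : GroupLieAlgebra 𝓘(ℝ, E) G) :
    (Ad a X : E) = dAt E E (fun b => b * a⁻¹) a (dAt E E (fun b => a * b) 1 (X : E)) := by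
  rw [Ad_apply]
  have h := dAt_comp_of_eq (E := E) (E' := E) (E'' := E) (g := fun b : G => b * a⁻¹)
    (f := fun b : G => a * b) (mul_one a) (diffAt_mul_right a⁻¹ a) (diffAt_mul_left a 1)
  exact DFunLike.congr_fun h X

theorem Ad_mul (a c : G) (X : GroupLieAlgebra 𝓘(ℝ, E) G) : Ad (a * c) X = Ad a (Ad c X) := by
  have h := dAt_comp_of_eq (E := E) (E' := E) (E'' := E) (g := fun b : G => a * b * a⁻¹)
    (f := fun b : G => c * b * c⁻¹) (x := 1) (y := 1) (by simp) (diffAt_conj a 1) (diffAt_conj c 1)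
  have h2 : (fun b : G => a * c * b * (a * c)⁻¹) = fun b => a * (c * b * c⁻¹) * a⁻¹ := by
    ext b; group
  rw [Ad_apply, h2, h]
  rfl

omit [LieGroup 𝓘(ℝ, E) ∞ G] in
theorem Ad_one (X : GroupLieAlgebra 𝓘(ℝ, E) G) : Ad (1 : G) X = X := by
  rw [Ad_apply]
  simp only [one_mul, inv_one, mul_one, dAt_id]
  rfl

/-- The left-invariant vector field with value `X` at the identity, with values in the model
space. -/
def leftInvariant (X : GroupLieAlgebra 𝓘(ℝ, E) G) (a : G) : E := dAt E E (fun b => a * b) 1 (X : E)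

/-- A one-parameter subgroup is commutative, so conjugation by `φ s` fixes the whole curve and with
it the velocity. -/
theorem IsOneParameterSubgroup.Ad_velocity {φ : ℝ → G} (hφ : IsOneParameterSubgroup E φ) (s : ℝ) :
    Ad (φ s) (velocity φ) = velocity (E := E) φ := by
  have h4 := vel_comp (E := E) (E' := E) (f := fun b : G => φ s * b * (φ s)⁻¹) (γ := φ) (t := 0)
    (diffAt_conj _ _) (hφ.diffAt 0)
  have h5 : (fun r => φ s * φ r * (φ s)⁻¹) = φ := by
    ext r; rw [← hφ.2, add_comm, hφ.2, mul_inv_cancel_right]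
  rw [h5, hφ.map_zero] at h4
  exact h4.symm

theorem contMDiff_rightFlow {φ : ℝ → G} (hφ : IsOneParameterSubgroup E φ) :
    ContMDiff (𝓘(ℝ, ℝ).prod 𝓘(ℝ, E)) 𝓘(ℝ, E) ∞ (fun p : ℝ × G => p.2 * φ p.1) :=
  contMDiff_snd.mul (hφ.1.comp contMDiff_fst)

/-- The flow of a left-invariant field consists of right translations. -/
theorem vel_rightFlow {φ : ℝ → G} (hφ : IsOneParameterSubgroup E φ) (a : G) :
    vel E (fun s => a * φ s) 0 = leftInvariant (velocity φ) a := by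
  rw [vel_comp (f := fun b => a * b) (diffAt_mul_left _ _) (hφ.diffAt 0), hφ.map_zero]
  rfl

/-- The derivative at time `0` of the adjoint action of a one-parameter subgroup is the bracket with
its velocity. -/
theorem hasDerivAt_Ad_zero {φ : ℝ → G} (hφ : IsOneParameterSubgroup E φ)
    (Y : GroupLieAlgebra 𝓘(ℝ, E) G) :
    HasDerivAt (fun t => (Ad (φ t) Y : E)) (⁅velocity (E := E) φ, Y⁆ : GroupLieAlgebra 𝓘(ℝ, E) G) 0 := by
  set X := velocity (E := E) φ with hX
  set e := chartAt E (1 : G) with he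
  set e₁ : E := e 1 with he₁
  have hα := contMDiff_rightFlow (E := E) hφ
  set α : ℝ × G → G := fun p => p.2 * φ p.1 with hαdef
  have h0 : ∀ x, α (0, x) = x := fun x => by simp [hαdef, hφ.map_zero]
  have ht₁ : e₁ ∈ e.target := mem_chart_target E (1 : G)
  obtain ⟨hK, hD⟩ := hasFDerivAt_coordFlow (E := E) hα h0 ht₁
  set K : E → E := fun y => fderiv ℝ (coordFlow E α 1) (0, y) (1, 0) with hKdef
  let Y' : E → E := fun y => dAt E E e (e.symm y) (leftInvariant Y (e.symm y))
  have hY' : DifferentiableAt ℝ Y' e₁ :=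
    (contDiffAt_coordinate_vectorField (contMDiff_mulInvariantVectorField_infty Y)
      (1 : G)).differentiableAt (by simp)
  have hKX : ∀ y ∈ e.target, K y = dAt E E e (e.symm y) (leftInvariant X (e.symm y)) := by
    intro y hy
    have := fderiv_coordFlow_time hα h0 (x₀ := (1 : G)) hy
    rw [vel_rightFlow hφ] at this
    exact this
  have hbr : @Eq E (⁅X, Y⁆ : GroupLieAlgebra 𝓘(ℝ, E) G)
      (fderiv ℝ Y' e₁ (K e₁) - fderiv ℝ K e₁ (Y' e₁)) :=
    mlieBracket_eq_fderiv _ _ (1 : G)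
      (Filter.eventually_of_mem (e.open_target.mem_nhds ht₁) hKX)
      (Filter.Eventually.of_forall fun y => rfl)
  have hφsrc : ∀ᶠ t in 𝓝 (0 : ℝ), φ t ∈ e.source := by
    refine (hφ.diffAt 0).continuousAt.preimage_mem_nhds (e.open_source.mem_nhds ?_)
    rw [hφ.map_zero]; exact mem_chart_source E (1 : G)
  have hc : HasDerivAt (fun t => e (φ t)) (K e₁) 0 := by
    have h1 := (differentiableAt_chart_comp (1 : G) (hφ.diffAt 0) hφsrc.self_of_nhds).hasDerivAt
    convert h1 using 1
    rw [hKX e₁ ht₁, ← vel_eq_deriv, vel_comp (diffAt_chart _ hφsrc.self_of_nhds) (hφ.diffAt 0),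
      hφ.vel_eq, he₁, e.left_inv (mem_chart_source E (1 : G)), hφ.map_zero]
    rfl
  -- `Ad (φ t) Y` is the left-invariant field of `Y` at `φ t`, transported to `1` by the time `-t`
  -- flow of `X`; in coordinates, a spatial derivative of the flow applied to `Y'`.
  have hev : (fun t => (Ad (φ t) Y : E)) =ᶠ[𝓝 0] fun t =>
      ((fderiv ℝ (coordFlow E α 1) (-t, e (φ t))).comp (ContinuousLinearMap.inr ℝ ℝ E))
        (Y' (e (φ t))) := by
    filter_upwards [hφsrc] with t ht
    have hα1 : α (-t, φ t) = 1 := by simp [hαdef, hφ.map_neg]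
    have h1 := fderiv_coordFlow_inr hα (x₀ := (1 : G)) (s := -t) (y := e (φ t)) (e.map_source ht)
      (by rw [e.left_inv ht, hα1]; exact mem_chart_source E (1 : G)) (Y' (e (φ t)))
    rw [ContinuousLinearMap.comp_apply, ContinuousLinearMap.inr_apply, h1]
    simp only [Y', ← he]
    rw [e.left_inv ht, hα1, dAt_chart_symm_dAt_chart (1 : G) ht, he, dAt_chart_self, Ad_eq]
    simp only [hαdef, hφ.map_neg]
    rfl
  have hcurve : HasDerivAt (fun t : ℝ => (-t, e (φ t))) ((-1 : ℝ), K e₁) 0 :=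
    (hasDerivAt_neg (0 : ℝ)).prodMk hc
  have hpt : ((-0 : ℝ), e (φ 0)) = (0, e₁) := by rw [hφ.map_zero, neg_zero]
  -- The time component `-1` of the curve contributes `-DK(Y')`; together with `DY'(K)` from the
  -- field this is the coordinate bracket.
  have hD' := HasFDerivAt.comp_hasDerivAt_of_eq (0 : ℝ) hD hcurve hpt.symm
  have hYc : HasDerivAt (fun t => Y' (e (φ t))) (fderiv ℝ Y' e₁ (K e₁)) 0 :=
    HasFDerivAt.comp_hasDerivAt_of_eq (0 : ℝ) hY'.hasFDerivAt hc (by rw [hφ.map_zero])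
  have h3 := (hD'.clm_apply hYc).congr_of_eventuallyEq hev
  refine h3.congr_deriv (Eq.trans (b := (fderiv ℝ Y' e₁ (K e₁) - fderiv ℝ K e₁ (Y' e₁) : E)) ?_
    hbr.symm)
  have hid : (fderiv ℝ (coordFlow E α 1) (0, e₁)).comp (ContinuousLinearMap.inr ℝ ℝ E)
      = ContinuousLinearMap.id ℝ E := by
    apply ContinuousLinearMap.ext
    intro w
    have hs : α (0, e.symm e₁) ∈ e.source := by rw [h0]; exact e.map_target ht₁
    rw [ContinuousLinearMap.comp_apply, ContinuousLinearMap.inr_apply,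
      fderiv_coordFlow_inr hα ht₁ hs, h0]
    have : (fun z => α (0, z)) = fun z => z := funext h0
    rw [this, dAt_id]
    exact dAt_chart_dAt_chart_symm (1 : G) ht₁ w
  have hval : ∀ w : E, (fderiv ℝ (coordFlow E α 1) (-0, e (φ 0))).comp
      (ContinuousLinearMap.inr ℝ ℝ E) w = w := by
    intro w
    rw [hpt, hid]
    rfl
  rw [Function.comp_apply, hval, hφ.map_zero, ← he₁]
  simp only [ContinuousLinearMap.smulRight_apply, ContinuousLinearMap.coe_fst', neg_smul, one_smul,
    neg_apply]
  abel

end Adjoint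

/-! ### Homogeneous spaces: smooth action, fundamental fields, the Lie algebra of `H` -/

section Homogeneous

variable {E : Type*} [NormedAddCommGroup E] [NormedSpace ℝ E]
  {F : Type*} [NormedAddCommGroup F] [NormedSpace ℝ F]
  {G : Type*} [TopologicalSpace G] [ChartedSpace E G] [Group G] [LieGroup 𝓘(ℝ, E) ∞ G]
  {H : Subgroup G} [ChartedSpace F (G ⧸ H)] [IsManifold 𝓘(ℝ, F) ∞ (G ⧸ H)]

omit [LieGroup 𝓘(ℝ, E) ∞ G] [IsManifold 𝓘(ℝ, F) ∞ (G ⧸ H)] in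
/-- A submersion `G → G ⧸ H` has smooth local sections. -/
theorem exists_local_section (hM : IsQuotientManifold E F H) (a : G) :
    ∃ σ : G ⧸ H → G, ContMDiffAt 𝓘(ℝ, F) 𝓘(ℝ, E) ∞ σ (a : G ⧸ H) ∧ σ (a : G ⧸ H) = a ∧
      ∀ᶠ x in 𝓝 (a : G ⧸ H), (σ x : G ⧸ H) = x := by
  obtain ⟨F', _, _, hM'⟩ := hM
  have h := hM' a
  set D := h.domChart
  set C := h.codChart
  set L := h.equiv
  have hw : ∀ z ∈ D.target, C ((D.symm z : G) : G ⧸ H) = (L z).1 := by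
    intro z hz
    have hz' : z ∈ (D.extend 𝓘(ℝ, E)).target := by simpa using hz
    exact h.writtenInCharts hz'
  have haD : a ∈ D.source := h.mem_domChart_source
  have haC : (a : G ⧸ H) ∈ C.source := h.mem_codChart_source
  have hCa : C (a : G ⧸ H) = (L (D a)).1 := by
    have := hw (D a) (D.map_source haD)
    rwa [D.left_inv haD] at this
  have hz₀ : L.symm (C (a : G ⧸ H), (L (D a)).2) = D a := by
    rw [hCa]; exact L.symm_apply_apply (D a)
  have hC : ContMDiffAt 𝓘(ℝ, F) 𝓘(ℝ, F) ∞ C (a : G ⧸ H) :=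
    (contMDiffOn_of_mem_maximalAtlas h.codChart_mem_maximalAtlas).contMDiffAt
      (C.open_source.mem_nhds haC)
  have hinner : ContMDiffAt 𝓘(ℝ, F) 𝓘(ℝ, E) ∞
      (fun x => L.symm (C x, (L (D a)).2)) (a : G ⧸ H) := by
    have : ContDiff ℝ ∞ (fun y : F => L.symm (y, (L (D a)).2)) := by fun_prop
    exact ContMDiffAt.comp (a : G ⧸ H) (f := C) this.contDiffAt.contMDiffAt hC
  have hD : ContMDiffAt 𝓘(ℝ, E) 𝓘(ℝ, E) ∞ D.symm (D a) :=
    (contMDiffOn_symm_of_mem_maximalAtlas h.domChart_mem_maximalAtlas).contMDiffAt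
      (D.open_target.mem_nhds (D.map_source haD))
  -- In submersion charts the projection is the first coordinate, so a section arises by freezing
  -- the second coordinate at its value for `a`.
  refine ⟨fun x => D.symm (L.symm (C x, (L (D a)).2)), hD.comp_of_eq hinner hz₀, ?_, ?_⟩
  · simp only [hz₀]; exact D.left_inv haD
  · have h1 : ∀ᶠ x in 𝓝 (a : G ⧸ H), L.symm (C x, (L (D a)).2) ∈ D.target :=
      hinner.continuousAt.preimage_mem_nhds
        (D.open_target.mem_nhds (by simp only [hz₀]; exact D.map_source haD))
    filter_upwards [h1, C.open_source.mem_nhds haC] with x hx hxC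
    refine C.injOn (h.mapsto_domChart_source_codChart_source (D.map_target hx)) hxC ?_
    rw [hw _ hx, ContinuousLinearEquiv.apply_symm_apply]

omit [IsManifold 𝓘(ℝ, F) ∞ (G ⧸ H)] in
/-- The action of `G` on `G ⧸ H` is smooth. -/
theorem contMDiff_action (hM : IsQuotientManifold E F H) :
    ContMDiff (𝓘(ℝ, E).prod 𝓘(ℝ, F)) 𝓘(ℝ, F) ∞ (fun p : G × (G ⧸ H) => p.1 • p.2) := by
  rintro ⟨a, x⟩
  obtain ⟨c, rfl⟩ := QuotientGroup.mk_surjective x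
  obtain ⟨σ, hσ, -, hev⟩ := exists_local_section hM c
  -- Near `(a, cH)` the action factors as `(a, x) ↦ a * σ x` followed by the projection.
  have h1 : ContMDiffAt (𝓘(ℝ, E).prod 𝓘(ℝ, F)) 𝓘(ℝ, E) ∞
      (fun p : G × (G ⧸ H) => p.1 * σ p.2) (a, (c : G ⧸ H)) :=
    contMDiffAt_fst.mul (ContMDiffAt.comp (a, (c : G ⧸ H)) (f := Prod.snd) hσ contMDiffAt_snd)
  have h2 : ContMDiff 𝓘(ℝ, E) 𝓘(ℝ, F) ∞ (fun a : G => (a : G ⧸ H)) := hM.contMDiff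
  refine (ContMDiffAt.comp (a, (c : G ⧸ H)) (f := fun p : G × (G ⧸ H) => p.1 * σ p.2)
    h2.contMDiffAt h1).congr_of_eventuallyEq ?_
  have h3 : ∀ᶠ p : G × (G ⧸ H) in 𝓝 (a, (c : G ⧸ H)), (σ p.2 : G ⧸ H) = p.2 :=
    (continuous_snd.tendsto (a, (c : G ⧸ H))).eventually hev
  filter_upwards [h3] with p hp
  conv_lhs => rw [← hp]
  rfl

omit [LieGroup 𝓘(ℝ, E) ∞ G] [IsManifold 𝓘(ℝ, F) ∞ (G ⧸ H)] in
theorem diffAt_proj (hM : IsQuotientManifold E F H) (a : G) :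
    DiffAt E F (fun a : G => (a : G ⧸ H)) a :=
  (Manifold.IsSubmersion.contMDiff hM).contMDiffAt.mdifferentiableAt (by simp)

omit [LieGroup 𝓘(ℝ, E) ∞ G] [IsManifold 𝓘(ℝ, F) ∞ (G ⧸ H)] in
theorem dAt_proj_surjective (hM : IsQuotientManifold E F H) (a : G) :
    Function.Surjective (dAt E F (fun a : G => (a : G ⧸ H)) a) := by
  intro v
  obtain ⟨σ, hσ, hσa, hev⟩ := exists_local_section hM a
  have h1 := dAt_comp_of_eq (E := F) (E' := E) (E'' := F) (g := fun a : G => (a : G ⧸ H)) (f := σ)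
    hσa (diffAt_proj hM a) (hσ.mdifferentiableAt (by simp))
  rw [dAt_congr (show (fun x => (σ x : G ⧸ H)) =ᶠ[𝓝 (a : G ⧸ H)] fun x => x from hev), dAt_id] at h1
  exact ⟨dAt F E σ a v, (DFunLike.congr_fun h1 v).symm⟩

omit [IsManifold 𝓘(ℝ, F) ∞ (G ⧸ H)] in
theorem diffAt_smul (hM : IsQuotientManifold E F H) (a : G) (x : G ⧸ H) :
    DiffAt F F (fun y : G ⧸ H => a • y) x :=
  ((contMDiff_action hM).comp (contMDiff_const.prodMk contMDiff_id)).contMDiffAt.mdifferentiableAt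
    (by simp)

omit [IsManifold 𝓘(ℝ, F) ∞ (G ⧸ H)] in
theorem diffAt_orbit (hM : IsQuotientManifold E F H) (a : G) (x : G ⧸ H) :
    DiffAt E F (fun c : G => c • x) a :=
  ((contMDiff_action hM).comp (contMDiff_id.prodMk contMDiff_const)).contMDiffAt.mdifferentiableAt
    (by simp)

variable (F) in
/-- The value at `x` of the fundamental (Killing) vector field on `G ⧸ H` defined by `X`. -/
def fund (X : GroupLieAlgebra 𝓘(ℝ, E) G) (x : G ⧸ H) : F :=
  dAt E F (fun a : G => a • x) 1 (X : E)

omit [LieGroup 𝓘(ℝ, E) ∞ G] [IsManifold 𝓘(ℝ, F) ∞ (G ⧸ H)] in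
theorem fund_one (X : GroupLieAlgebra 𝓘(ℝ, E) G) :
    fund F X ((1 : G) : G ⧸ H) = dproj F H X := by
  have h : (fun a : G => a • ((1 : G) : G ⧸ H)) = fun a : G => (a : G ⧸ H) := by
    ext a
    change ((a * 1 : G) : G ⧸ H) = a
    rw [mul_one]
  rw [fund, h]
  rfl

-- Differentiate `a • (c • x) = (a * c * a⁻¹) • (a • x)` in `c` at `1`.
omit [IsManifold 𝓘(ℝ, F) ∞ (G ⧸ H)] in
theorem dAt_smul_fund (hM : IsQuotientManifold E F H) (a : G) (X : GroupLieAlgebra 𝓘(ℝ, E) G)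
    (x : G ⧸ H) :
    dAt F F (fun y : G ⧸ H => a • y) x (fund F X x) = fund F (Ad a X) (a • x) := by
  have h1 := dAt_comp_of_eq (E := E) (E' := F) (E'' := F) (g := fun y : G ⧸ H => a • y)
    (f := fun c : G => c • x) (x := 1) (one_smul G x) (diffAt_smul hM a x) (diffAt_orbit hM 1 x)
  have h2 := dAt_comp_of_eq (E := E) (E' := E) (E'' := F) (g := fun c : G => c • (a • x))
    (f := fun c : G => a * c * a⁻¹) (x := 1) (y := 1) (by simp) (diffAt_orbit hM 1 (a • x))
    (diffAt_conj a 1)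
  have h3 : (fun c : G => (a * c * a⁻¹) • (a • x)) = fun c => a • (c • x) := by
    ext c; simp [mul_smul]
  rw [h3, h1] at h2
  exact DFunLike.congr_fun h2 X

-- Writing `φ s = φ (s - t) * φ t` moves the question to time `0` at the point `φ t • x`.
omit [IsManifold 𝓘(ℝ, F) ∞ (G ⧸ H)] in
theorem vel_orbit (hM : IsQuotientManifold E F H) {φ : ℝ → G} (hφ : IsOneParameterSubgroup E φ)
    (x : G ⧸ H) (t : ℝ) : vel F (fun s => φ s • x) t = fund F (velocity (E := E) φ) (φ t • x) := by
  have h1 : vel F (fun s => φ (s - t) • (φ t • x)) t = fund F (velocity (E := E) φ) (φ t • x) := by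
    have h2 : vel E (fun s => φ (s - t)) t = velocity φ := by
      have := vel_reparam (E := E) (γ := φ) (r := fun s => s - t) (r' := 1) (t := t)
        (hφ.diffAt _) ((hasDerivAt_id t).sub_const t)
      simp only [one_smul, sub_self] at this
      exact this
    have h3 : DiffAt ℝ E (fun s => φ (s - t)) t :=
      MDifferentiableAt.comp (f := fun s : ℝ => s - t) t (hφ.diffAt _)
        (diffAt_iff.2 (by fun_prop))
    rw [vel_comp (f := fun c : G => c • (φ t • x)) (diffAt_orbit hM _ _) h3, h2, sub_self,
      hφ.map_zero]
    rfl
  rw [← h1]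
  congr 1
  ext s
  rw [← mul_smul, ← hφ.2, sub_add_cancel]

omit [IsManifold 𝓘(ℝ, F) ∞ (G ⧸ H)] in
theorem diffAt_orbit_curve (hM : IsQuotientManifold E F H) {φ : ℝ → G}
    (hφ : IsOneParameterSubgroup E φ) (x : G ⧸ H) (t : ℝ) : DiffAt ℝ F (fun s => φ s • x) t :=
  (diffAt_orbit hM (φ t) x).comp t (hφ.diffAt t)

-- At the origin this is the submersion property; transitivity carries it to the other points.
omit [IsManifold 𝓘(ℝ, F) ∞ (G ⧸ H)] in
theorem fund_surjective (hM : IsQuotientManifold E F H) (x : G ⧸ H) :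
    Function.Surjective (fun X : GroupLieAlgebra 𝓘(ℝ, E) G => fund F X x) := by
  obtain ⟨a, rfl⟩ := QuotientGroup.mk_surjective x
  have ha : (a : G ⧸ H) = a • ((1 : G) : G ⧸ H) := by
    change (a : G ⧸ H) = ((a * 1 : G) : G ⧸ H)
    rw [mul_one]
  intro v
  obtain ⟨X, hX⟩ : ∃ X : GroupLieAlgebra 𝓘(ℝ, E) G, (dproj F H X : F) =
      dAt F F (fun y : G ⧸ H => a⁻¹ • y) (a : G ⧸ H) v := dAt_proj_surjective hM 1 _
  refine ⟨Ad a X, ?_⟩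
  change fund F (Ad a X) (a : G ⧸ H) = v
  have h1 : fund F X ((1 : G) : G ⧸ H) = dAt F F (fun y : G ⧸ H => a⁻¹ • y) (a : G ⧸ H) v := by
    rw [fund_one]; exact hX
  rw [ha, ← dAt_smul_fund hM, h1]
  have h2 := dAt_comp_of_eq (E := F) (E' := F) (E'' := F) (g := fun y : G ⧸ H => a • y)
    (f := fun y : G ⧸ H => a⁻¹ • y) (x := (a : G ⧸ H)) (y := ((1 : G) : G ⧸ H))
    (by rw [ha, inv_smul_smul]) (diffAt_smul hM _ _) (diffAt_smul hM _ _)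
  simp only [smul_inv_smul, dAt_id] at h2
  exact (DFunLike.congr_fun h2 v).symm

omit [LieGroup 𝓘(ℝ, E) ∞ G] [TopologicalSpace G] [ChartedSpace E G] [ChartedSpace F (G ⧸ H)]
  [IsManifold 𝓘(ℝ, F) ∞ (G ⧸ H)] in
theorem smul_origin {a : G} (ha : a ∈ H) : a • ((1 : G) : G ⧸ H) = ((1 : G) : G ⧸ H) := by
  change ((a * 1 : G) : G ⧸ H) = ((1 : G) : G ⧸ H)
  rw [mul_one, QuotientGroup.eq]; simpa using ha

/-- A one-parameter subgroup whose velocity is tangent to `H` stays in `H`. -/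
theorem mem_of_dproj_velocity_eq_zero (hM : IsQuotientManifold E F H) {φ : ℝ → G}
    (hφ : IsOneParameterSubgroup E φ) (h : dproj F H (velocity (E := E) φ) = 0) (t : ℝ) : φ t ∈ H := by
  have h1 : φ t • ((1 : G) : G ⧸ H) = φ 0 • ((1 : G) : G ⧸ H) := by
    refine eq_of_vel_eq_zero (E := F) isOpen_univ Set.ordConnected_univ
      (γ := fun s => φ s • ((1 : G) : G ⧸ H)) (fun s _ => ⟨diffAt_orbit_curve hM hφ _ s, ?_⟩)
      (Set.mem_univ t) (Set.mem_univ 0)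
    -- Since `Ad (φ s)` fixes the generator, the velocity of the orbit at time `s` is the translate
    -- of its velocity at time `0`, which is zero.
    rw [vel_orbit hM hφ, ← hφ.Ad_velocity s, ← dAt_smul_fund hM, fund_one, h]
    exact ContinuousLinearMap.map_zero _
  rw [hφ.map_zero, one_smul] at h1
  have h2 : ((φ t * 1 : G) : G ⧸ H) = ((1 : G) : G ⧸ H) := h1
  rw [mul_one, QuotientGroup.eq] at h2
  simpa using h2

omit [IsManifold 𝓘(ℝ, F) ∞ (G ⧸ H)] in
theorem dproj_velocity_eq_zero (hM : IsQuotientManifold E F H) {φ : ℝ → G}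
    (hφ : IsOneParameterSubgroup E φ) (h : ∀ t, φ t ∈ H) : dproj F H (velocity (E := E) φ) = 0 := by
  have h1 := vel_orbit hM hφ ((1 : G) : G ⧸ H) 0
  simp only [fun s => smul_origin (h s), vel_const] at h1
  rw [← fund_one]
  exact h1.symm

omit [IsManifold 𝓘(ℝ, F) ∞ (G ⧸ H)] in
theorem dproj_Ad (hM : IsQuotientManifold E F H) {a : G} (ha : a ∈ H)
    {X : GroupLieAlgebra 𝓘(ℝ, E) G} (hX : dproj F H X = 0) : dproj F H (Ad a X) = 0 := by
  have h1 := dAt_smul_fund hM a X ((1 : G) : G ⧸ H)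
  rw [smul_origin ha, fund_one, fund_one, hX] at h1
  exact h1.symm.trans (ContinuousLinearMap.map_zero _)

variable [T2Space G] [CompleteSpace E]

/-- The Lie algebra of `H` is the kernel of the differential of `G → G ⧸ H`. -/
theorem mem_lieAlgebraOf_iff (hM : IsQuotientManifold E F H) (X : GroupLieAlgebra 𝓘(ℝ, E) G) :
    X ∈ lieAlgebraOf E H ↔ dproj F H X = 0 := by
  constructor
  · intro hX
    -- The Lie span of the velocities stays in the kernel of the differential once that kernel is
    -- known to be a subalgebra.
    let K : LieSubalgebra ℝ (GroupLieAlgebra 𝓘(ℝ, E) G) :=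
      { carrier := {Y | dproj F H Y = 0}
        add_mem' := by
          intro Y Z hY hZ
          exact (ContinuousLinearMap.map_add _ Y Z).trans
            ((congrArg₂ (· + ·) hY hZ).trans (add_zero _))
        zero_mem' := ContinuousLinearMap.map_zero _
        smul_mem' := by
          intro r Y hY
          exact (ContinuousLinearMap.map_smul _ r Y).trans
            ((congrArg (r • ·) hY).trans (smul_zero r))
        lie_mem' := by
          intro Y Z hY hZ
          -- A kernel vector generates a subgroup of `H`, and `Ad_H` preserves the kernel; the
          -- derivative of `Ad (φ t) Z` at `0` is the bracket.
          obtain ⟨φ, hφ, rfl⟩ := exists_oneParameterSubgroup Y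
          have hφH := mem_of_dproj_velocity_eq_zero hM hφ hY
          have h1 := hasDerivAt_Ad_zero hφ Z
          have h2 : HasDerivAt (fun t => dAt E F (fun a : G => (a : G ⧸ H)) 1 (Ad (φ t) Z))
              (dAt E F (fun a : G => (a : G ⧸ H)) 1 (⁅velocity (E := E) φ, Z⁆ :
                GroupLieAlgebra 𝓘(ℝ, E) G)) 0 :=
            (dAt E F (fun a : G => (a : G ⧸ H)) 1).hasFDerivAt.comp_hasDerivAt (0 : ℝ) h1
          have h3 : (fun t => dAt E F (fun a : G => (a : G ⧸ H)) 1 (Ad (φ t) Z)) = fun _ => 0 := by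
            ext t; exact dproj_Ad hM (hφH t) hZ
          rw [h3] at h2
          exact h2.unique (hasDerivAt_const _ _) }
    have hle : lieAlgebraOf E H ≤ K := by
      refine LieSubalgebra.lieSpan_le.2 ?_
      rintro Y ⟨φ, hφ, hφH, rfl⟩
      exact dproj_velocity_eq_zero hM hφ hφH
    exact hle hX
  · intro hX
    obtain ⟨φ, hφ, rfl⟩ := exists_oneParameterSubgroup X
    exact LieSubalgebra.subset_lieSpan ⟨φ, hφ, mem_of_dproj_velocity_eq_zero hM hφ hX, rfl⟩

end Homogeneous

/-! ### Riemannian metrics in charts -/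

section MetricCoordinates

variable {F : Type*} [NormedAddCommGroup F] [NormedSpace ℝ F]
  {M : Type*} [TopologicalSpace M] [ChartedSpace F M] [IsManifold 𝓘(ℝ, F) ∞ M]

/-- The scalar product of a metric at a point, as a bilinear form on the model space. -/
def Metric.at (g : Metric F M) (x : M) : F →L[ℝ] F →L[ℝ] ℝ := g.inner x

theorem Metric.at_symm (g : Metric F M) (x : M) (u v : F) : g.at x u v = g.at x v u := g.symm x u v

theorem Metric.at_pos (g : Metric F M) (x : M) {u : F} (hu : u ≠ 0) : 0 < g.at x u u :=
  g.pos x u hu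

/-- The matrix of a metric in the chart around `x₀`. -/
def metricCoord (g : Metric F M) (x₀ : M) (y : F) : F →L[ℝ] F →L[ℝ] ℝ :=
  (g.at ((chartAt F x₀).symm y)).bilinearComp (dAt F F (chartAt F x₀).symm y)
    (dAt F F (chartAt F x₀).symm y)

theorem metricCoord_apply (g : Metric F M) (x₀ : M) (y u v : F) :
    metricCoord g x₀ y u v = g.at ((chartAt F x₀).symm y) (dAt F F (chartAt F x₀).symm y u)
      (dAt F F (chartAt F x₀).symm y v) := rfl

theorem metricCoord_symm (g : Metric F M) (x₀ : M) (y u v : F) :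
    metricCoord g x₀ y u v = metricCoord g x₀ y v u := g.at_symm _ _ _

theorem metricCoord_pos (g : Metric F M) (x₀ : M) {y u : F} (hy : y ∈ (chartAt F x₀).target)
    (hu : u ≠ 0) : 0 < metricCoord g x₀ y u u := by
  refine g.at_pos _ fun h => hu ?_
  have h' : dAt F F (chartAt F x₀).symm y u = 0 := h
  rw [← dAt_chart_dAt_chart_symm x₀ hy u, h', map_zero]

theorem contMDiffAt_dAt_chart_symm (x₀ : M) {y : F} (hy : y ∈ (chartAt F x₀).target) (u : F) :
    ContMDiffAt 𝓘(ℝ, F) 𝓘(ℝ, F).tangent ∞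
      (fun z => (Bundle.TotalSpace.mk' F ((chartAt F x₀).symm z)
        (mfderiv 𝓘(ℝ, F) 𝓘(ℝ, F) (chartAt F x₀).symm z u) : TangentBundle 𝓘(ℝ, F) M)) y := by
  have h1 : ContMDiffAt 𝓘(ℝ, F) 𝓘(ℝ, F).tangent ∞
      (fun z => (Bundle.TotalSpace.mk' F z u : TangentBundle 𝓘(ℝ, F) F)) y := by
    rw [← contMDiffWithinAt_univ]
    exact contMDiffWithinAt_vectorSpace_iff_contDiffWithinAt.2 contDiffWithinAt_const
  have h2 : ContMDiffOn 𝓘(ℝ, F) 𝓘(ℝ, F) ∞ (chartAt F x₀).symm (chartAt F x₀).target :=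
    contMDiffOn_chart_symm
  have h3 := h2.contMDiffOn_tangentMapWithin (m := ∞) (by simp)
    (chartAt F x₀).open_target.uniqueMDiffOn
  have hopen : IsOpen (Bundle.TotalSpace.proj ⁻¹' (chartAt F x₀).target :
      Set (TangentBundle 𝓘(ℝ, F) F)) :=
    (chartAt F x₀).open_target.preimage (FiberBundle.continuous_proj F (TangentSpace 𝓘(ℝ, F)))
  have h4 := h3.contMDiffAt (x := Bundle.TotalSpace.mk' F y u) (hopen.mem_nhds hy)
  refine (ContMDiffAt.comp y (f := fun z => (Bundle.TotalSpace.mk' F z u :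
    TangentBundle 𝓘(ℝ, F) F)) h4 h1).congr_of_eventuallyEq ?_
  filter_upwards [(chartAt F x₀).open_target.mem_nhds hy] with z hz
  simp only [Function.comp_apply, tangentMapWithin]
  rw [mfderivWithin_of_isOpen (chartAt F x₀).open_target hz]

theorem contDiffAt_metricCoord [FiniteDimensional ℝ F] (g : Metric F M) (x₀ : M) {y : F}
    (hy : y ∈ (chartAt F x₀).target) : ContDiffAt ℝ ∞ (metricCoord g x₀) y := by
  have h : ∀ y ∈ (chartAt F x₀).target, ∀ u v,
      ContDiffAt ℝ ∞ (fun z => metricCoord g x₀ z u v) y := by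
    intro y hy u v
    have hs : ContMDiffAt 𝓘(ℝ, F) 𝓘(ℝ, F) ∞ (chartAt F x₀).symm y :=
      contMDiffOn_chart_symm.contMDiffAt ((chartAt F x₀).open_target.mem_nhds hy)
    have h1 : ContMDiffAt 𝓘(ℝ, F) (𝓘(ℝ, F).prod 𝓘(ℝ, F →L[ℝ] F →L[ℝ] ℝ)) ∞
        (fun z => Bundle.TotalSpace.mk' (F →L[ℝ] F →L[ℝ] ℝ)
          (E := fun x : M => TangentSpace 𝓘(ℝ, F) x →L[ℝ] TangentSpace 𝓘(ℝ, F) x →L[ℝ] ℝ)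
          ((chartAt F x₀).symm z) (g.inner ((chartAt F x₀).symm z))) y :=
      ContMDiffAt.comp y (f := (chartAt F x₀).symm) g.contMDiff.contMDiffAt hs
    have h2 := ContMDiffAt.clm_bundle_apply₂ (F₁ := F) (F₂ := F)
      (E₃ := Bundle.Trivial M ℝ) h1 (contMDiffAt_dAt_chart_symm x₀ hy u)
      (contMDiffAt_dAt_chart_symm x₀ hy v)
    simp only [Bundle.contMDiffAt_totalSpace] at h2
    exact contMDiffAt_iff_contDiffAt.1 h2.2
  -- In finite dimension, smoothness of an operator-valued map can be tested on fixed vectors.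
  have h3 : ContDiffOn ℝ ∞ (metricCoord g x₀) (chartAt F x₀).target :=
    contDiffOn_clm_apply.2 fun u => contDiffOn_clm_apply.2 fun v z hz =>
      (h z hz u v).contDiffWithinAt
  exact h3.contDiffAt ((chartAt F x₀).open_target.mem_nhds hy)

theorem chartMetric_fderiv [FiniteDimensional ℝ F] (g : Metric F M) (x₀ : M) {y : F}
    (hy : y ∈ (chartAt F x₀).target) (u v w : F) :
    fderiv ℝ (fun z => chartMetric g x₀ z u v) y w = fderiv ℝ (metricCoord g x₀) y w u v := by
  have h1 : HasFDerivAt (metricCoord g x₀) (fderiv ℝ (metricCoord g x₀) y) y :=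
    ((contDiffAt_metricCoord g x₀ hy).differentiableAt (by simp)).hasFDerivAt
  have h2 := (h1.clm_apply (hasFDerivAt_const u y)).clm_apply (hasFDerivAt_const v y)
  have h3 : (fun z => chartMetric g x₀ z u v) = fun z => metricCoord g x₀ z u v := rfl
  rw [h3, h2.fderiv]
  simp

/-- The geodesic equation in terms of the matrix of the metric. -/
theorem geodesicEquationAt_iff [FiniteDimensional ℝ F] (g : Metric F M) (x₀ : M) {c : ℝ → F}
    {t : ℝ} (ht : c t ∈ (chartAt F x₀).target) :
    GeodesicEquationAt g x₀ c t ↔ ∀ v : F,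
      metricCoord g x₀ (c t) (deriv (deriv c) t) v
        + fderiv ℝ (metricCoord g x₀) (c t) (deriv c t) (deriv c t) v
        - (1 / 2) * fderiv ℝ (metricCoord g x₀) (c t) v (deriv c t) (deriv c t) = 0 := by
  simp only [GeodesicEquationAt, chartMetric_fderiv g x₀ ht]
  rfl

end MetricCoordinates

/-! ### Killing equation and Noether's theorem -/

section Noether

variable {E : Type*} [NormedAddCommGroup E] [NormedSpace ℝ E]
  {F : Type*} [NormedAddCommGroup F] [NormedSpace ℝ F]
  {G : Type*} [TopologicalSpace G] [ChartedSpace E G] [Group G] [LieGroup 𝓘(ℝ, E) ∞ G]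
  {H : Subgroup G} [ChartedSpace F (G ⧸ H)] [IsManifold 𝓘(ℝ, F) ∞ (G ⧸ H)]

theorem IsInvariant.at_smul {g : Metric F (G ⧸ H)} (hg : IsInvariant g) (a : G) (x : G ⧸ H)
    (u v : F) : g.at (a • x) (dAt F F (fun y : G ⧸ H => a • y) x u)
      (dAt F F (fun y : G ⧸ H => a • y) x v) = g.at x u v := hg a x u v

theorem IsInvariant.at_fund {g : Metric F (G ⧸ H)} (hg : IsInvariant g)
    (hM : IsQuotientManifold E F H) (a : G) (x : G ⧸ H) (X Y : GroupLieAlgebra 𝓘(ℝ, E) G) :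
    g.at (a • x) (fund F (Ad a X) (a • x)) (fund F (Ad a Y) (a • x)) =
      g.at x (fund F X x) (fund F Y x) := by
  rw [← dAt_smul_fund hM, ← dAt_smul_fund hM, hg.at_smul]

omit [IsManifold 𝓘(ℝ, F) ∞ (G ⧸ H)] in
theorem contMDiff_orbitFlow (hM : IsQuotientManifold E F H) {φ : ℝ → G}
    (hφ : IsOneParameterSubgroup E φ) :
    ContMDiff (𝓘(ℝ, ℝ).prod 𝓘(ℝ, F)) 𝓘(ℝ, F) ∞ (fun p : ℝ × (G ⧸ H) => φ p.1 • p.2) :=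
  (contMDiff_action hM).comp ((hφ.1.comp contMDiff_fst).prodMk contMDiff_snd)

variable [FiniteDimensional ℝ F] {g : Metric F (G ⧸ H)} (hg : IsInvariant g)
  (hM : IsQuotientManifold E F H) {φ : ℝ → G} (hφ : IsOneParameterSubgroup E φ)

variable (F H) in
/-- The coordinate expression of the action of a one-parameter subgroup. -/
def orbitFlow (φ : ℝ → G) (x₀ : G ⧸ H) : ℝ × F → F :=
  coordFlow F (fun p : ℝ × (G ⧸ H) => φ p.1 • p.2) x₀

variable (F H) in
/-- The coordinate expression of a fundamental vector field. -/
def fundCoord (φ : ℝ → G) (x₀ : G ⧸ H) (y : F) : F := fderiv ℝ (orbitFlow F H φ x₀) (0, y) (1, 0)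

omit [FiniteDimensional ℝ F] in
include hM hφ in
theorem fundCoord_eq (x₀ : G ⧸ H) {y : F} (hy : y ∈ (chartAt F x₀).target) :
    fundCoord F H φ x₀ y = dAt F F (chartAt F x₀) ((chartAt F x₀).symm y)
      (fund F (velocity (E := E) φ) ((chartAt F x₀).symm y)) := by
  have h := fderiv_coordFlow_time (contMDiff_orbitFlow hM hφ)
    (fun x => by simp [hφ.map_zero]) (x₀ := x₀) hy
  simp only [vel_orbit hM hφ, hφ.map_zero, one_smul] at h
  exact h

include hg hM hφ in
/-- Fundamental vector fields satisfy the Killing equation for an invariant metric. -/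
theorem killing_equation (x₀ : G ⧸ H) {y : F} (hy : y ∈ (chartAt F x₀).target) (u v : F) :
    DifferentiableAt ℝ (fundCoord F H φ x₀) y ∧
    fderiv ℝ (metricCoord g x₀) y (fundCoord F H φ x₀ y) u v +
      metricCoord g x₀ y (fderiv ℝ (fundCoord F H φ x₀) y u) v +
      metricCoord g x₀ y u (fderiv ℝ (fundCoord F H φ x₀) y v) = 0 := by
  have hα := contMDiff_orbitFlow hM hφ
  have h0 : ∀ x : G ⧸ H, φ 0 • x = x := fun x => by rw [hφ.map_zero, one_smul]
  obtain ⟨hK, hD⟩ := hasFDerivAt_coordFlow hα h0 hy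
  refine ⟨hK, ?_⟩
  set e := chartAt F x₀
  have hsrc : ∀ᶠ s in 𝓝 (0 : ℝ), φ s • e.symm y ∈ e.source := by
    have hcont : ContinuousAt (fun s => φ s • e.symm y) 0 :=
      (diffAt_orbit_curve hM hφ (e.symm y) 0).continuousAt
    refine hcont.preimage_mem_nhds (e.open_source.mem_nhds ?_)
    rw [h0]; exact e.map_target hy
  set A : ℝ → F →L[ℝ] F := fun s =>
    (fderiv ℝ (orbitFlow F H φ x₀) (s, y)).comp (ContinuousLinearMap.inr ℝ ℝ F) with hA
  have hA1 : HasDerivAt A (fderiv ℝ (fundCoord F H φ x₀) y) 0 := by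
    have h1 : HasDerivAt (fun s : ℝ => (s, y)) ((1 : ℝ), (0 : F)) 0 :=
      (hasDerivAt_id _).prodMk (hasDerivAt_const _ _)
    refine (hD.comp_hasDerivAt (0 : ℝ) h1).congr_deriv ?_
    rw [ContinuousLinearMap.smulRight_apply]
    exact one_smul _ _
  have hAapp : ∀ᶠ s in 𝓝 (0 : ℝ), ∀ w, dAt F F e.symm (orbitFlow F H φ x₀ (s, y)) (A s w) =
      dAt F F (fun z : G ⧸ H => φ s • z) (e.symm y) (dAt F F e.symm y w) := by
    filter_upwards [hsrc] with s hs w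
    have h1 : A s w = _ := fderiv_coordFlow_inr hα hy hs w
    rw [h1]
    exact dAt_chart_symm_dAt_chart x₀ hs _
  -- The flow acts by isometries, so the pulled back coefficients do not depend on `s`; the Killing
  -- equation is the derivative of this at `s = 0`.
  have hinv : (fun s => metricCoord g x₀ (orbitFlow F H φ x₀ (s, y)) (A s u) (A s v)) =ᶠ[𝓝 0]
      fun _ => metricCoord g x₀ y u v := by
    filter_upwards [hsrc, hAapp] with s hs hAs
    rw [metricCoord_apply, hAs, hAs, metricCoord_apply]
    have h1 : e.symm (orbitFlow F H φ x₀ (s, y)) = φ s • e.symm y := e.left_inv hs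
    rw [h1, hg.at_smul]
  have hflow : HasDerivAt (fun s => orbitFlow F H φ x₀ (s, y)) (fundCoord F H φ x₀ y) 0 := by
    have h1 : HasDerivAt (fun s : ℝ => (s, y)) ((1 : ℝ), (0 : F)) 0 :=
      (hasDerivAt_id _).prodMk (hasDerivAt_const _ _)
    have h2 : HasFDerivAt (orbitFlow F H φ x₀) (fderiv ℝ (orbitFlow F H φ x₀) (0, y)) (0, y) :=
      ((contDiffAt_coordFlow hα hy hsrc.self_of_nhds).differentiableAt (by simp)).hasFDerivAt
    exact h2.comp_hasDerivAt (0 : ℝ) h1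
  have hflow0 : orbitFlow F H φ x₀ (0, y) = y := coordFlow_zero h0 hy
  have hG : HasDerivAt (fun s => metricCoord g x₀ (orbitFlow F H φ x₀ (s, y)))
      (fderiv ℝ (metricCoord g x₀) y (fundCoord F H φ x₀ y)) 0 :=
    HasFDerivAt.comp_hasDerivAt_of_eq (0 : ℝ)
      ((contDiffAt_metricCoord g x₀ hy).differentiableAt (by simp)).hasFDerivAt hflow hflow0.symm
  have hA0 : ∀ w, A 0 w = w := by
    intro w
    have h1 := hAapp.self_of_nhds w
    rw [hflow0] at h1
    have h2 : (fun z : G ⧸ H => φ 0 • z) = fun z => z := funext h0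
    rw [h2, dAt_id] at h1
    have h3 := congrArg (dAt F F e (e.symm y)) h1
    rw [dAt_chart_dAt_chart_symm x₀ hy] at h3
    exact h3.trans (dAt_chart_dAt_chart_symm x₀ hy w)
  have hmain := (hG.clm_apply (hA1.clm_apply (hasDerivAt_const (0 : ℝ) u))).clm_apply
    (hA1.clm_apply (hasDerivAt_const (0 : ℝ) v))
  have h3 := hmain.unique ((hasDerivAt_const (0 : ℝ) _).congr_of_eventuallyEq hinv)
  simp only [hflow0, hA0, add_zero, add_apply] at h3
  linarith

include hg hM in
/-- **Noether's theorem**: the scalar product of the velocity of a geodesic with a fundamental vector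
field is conserved. -/
theorem hasDerivAt_momentum [T2Space G] [CompleteSpace E] {γ : ℝ → G ⧸ H} {J : Set ℝ}
    (hJ : IsOpen J) (hγ : IsGeodesicOn g γ J) (Y : GroupLieAlgebra 𝓘(ℝ, E) G) {t : ℝ} (ht : t ∈ J) :
    HasDerivAt (fun s => g.at (γ s) (vel F γ s) (fund F Y (γ s))) 0 t := by
  obtain ⟨φ, hφ, rfl⟩ := exists_oneParameterSubgroup Y
  obtain ⟨x₀, hx₀, heq⟩ := hγ.2 t ht
  set e := chartAt F x₀ with he
  have hγd : ∀ s ∈ J, ContMDiffAt 𝓘(ℝ, ℝ) 𝓘(ℝ, F) 2 γ s := fun s hs =>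
    hγ.1.contMDiffAt (hJ.mem_nhds hs)
  have hγdiff : ∀ s ∈ J, DiffAt ℝ F γ s := fun s hs => (hγd s hs).mdifferentiableAt (by simp)
  set c : ℝ → F := fun s => e (γ s) with hc
  have hc2 : ContDiffAt ℝ 2 c t := by
    have h1 : ContMDiffAt 𝓘(ℝ, F) 𝓘(ℝ, F) ∞ e (γ t) :=
      contMDiffOn_chart.contMDiffAt (e.open_source.mem_nhds hx₀)
    exact contMDiffAt_iff_contDiffAt.1 (ContMDiffAt.comp t (h1.of_le ENat.LEInfty.out) (hγd t ht))
  have hct : c t ∈ e.target := e.map_source hx₀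
  have hev : ∀ᶠ s in 𝓝 t, s ∈ J ∧ γ s ∈ e.source :=
    Filter.Eventually.and (hJ.mem_nhds ht)
      ((hγdiff t ht).continuousAt.preimage_mem_nhds (e.open_source.mem_nhds hx₀))
  set K := fundCoord F H φ x₀ with hK
  have hfun : (fun s => g.at (γ s) (vel F γ s) (fund F (velocity (E := E) φ) (γ s))) =ᶠ[𝓝 t]
      fun s => metricCoord g x₀ (c s) (deriv c s) (K (c s)) := by
    filter_upwards [hev] with s hs
    have h1 : e.symm (c s) = γ s := e.left_inv hs.2
    rw [metricCoord_apply, hK, fundCoord_eq hM hφ x₀ (e.map_source hs.2), ← he, h1,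
      dAt_chart_symm_dAt_chart x₀ hs.2, vel_eq_dAt_chart_symm x₀ (hγdiff s hs.1) hs.2]
  refine HasDerivAt.congr_of_eventuallyEq ?_ hfun
  have hc1 : HasDerivAt c (deriv c t) t := (hc2.differentiableAt (by norm_num)).hasDerivAt
  have hc' : HasDerivAt (deriv c) (deriv (deriv c) t) t := by
    have h1 : ContDiffAt ℝ 1 (deriv c) t := by
      have h2 : ContDiffAt ℝ 1 (fderiv ℝ c) t := hc2.fderiv_right (by norm_num)
      have h3 : deriv c = fun s => fderiv ℝ c s 1 := by ext s; simp
      rw [h3]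
      exact h2.clm_apply contDiffAt_const
    exact (h1.differentiableAt (by norm_num)).hasDerivAt
  obtain ⟨hKd, hkill⟩ := killing_equation hg hM hφ x₀ hct (deriv c t) (deriv c t)
  have hKc : HasDerivAt (fun s => K (c s)) (fderiv ℝ K (c t) (deriv c t)) t :=
    hKd.hasFDerivAt.comp_hasDerivAt t hc1
  have hGc : HasDerivAt (fun s => metricCoord g x₀ (c s))
      (fderiv ℝ (metricCoord g x₀) (c t) (deriv c t)) t :=
    ((contDiffAt_metricCoord g x₀ hct).differentiableAt (by simp)).hasFDerivAt.comp_hasDerivAt t hc1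
  refine ((hGc.clm_apply hc').clm_apply hKc).congr_deriv ?_
  -- The geodesic equation tested on `K` turns the first two terms into `(1/2) (∂_K g)(c', c')`; the
  -- Killing equation with `u = v = c'` says that this cancels `g(c', DK c')`.
  have hgeo := (geodesicEquationAt_iff g x₀ hct).1 heq (K (c t))
  rw [metricCoord_symm g x₀ _ (fderiv ℝ (fundCoord F H φ x₀) (c t) (deriv c t))] at hkill
  rw [← hK] at hkill
  simp only [add_apply]
  linarith

end Noether

/-! ### Local existence of geodesics -/

section GeodesicExistence

variable {F : Type*} [NormedAddCommGroup F] [NormedSpace ℝ F] [FiniteDimensional ℝ F]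

/-- A positive definite bilinear form on a finite-dimensional space is invertible. -/
theorem isInvertible_of_pos (B : F →L[ℝ] F →L[ℝ] ℝ) (hB : ∀ u, u ≠ 0 → 0 < B u u) :
    B.IsInvertible := by
  have hinj : Function.Injective (B : F →ₗ[ℝ] F →L[ℝ] ℝ) := by
    refine (injective_iff_map_eq_zero _).2 fun u hu => ?_
    by_contra h
    have h1 : B u u = 0 := by
      have h2 : B u = 0 := hu
      rw [h2]; rfl
    exact (hB u h).ne' h1
  have hdim : Module.finrank ℝ F = Module.finrank ℝ (F →L[ℝ] ℝ) := by
    rw [← Subspace.dual_finrank_eq (K := ℝ) (V := F)]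
    exact (LinearMap.toContinuousLinearMap (𝕜 := ℝ) (E := F) (F' := ℝ)).finrank_eq
  refine ⟨((B : F →ₗ[ℝ] F →L[ℝ] ℝ).linearEquivOfInjective hinj hdim).toContinuousLinearEquiv, ?_⟩
  ext u v
  rfl

/-- A second order equation `B(c) c'' = ℓ(c, c')` with smooth data and `B` positive definite has
local solutions. -/
theorem exists_second_order_solution {U : Set F} (hU : IsOpen U)
    {B : F → F →L[ℝ] F →L[ℝ] ℝ} (hB : ∀ y ∈ U, ContDiffAt ℝ 1 B y)
    (hpos : ∀ y ∈ U, ∀ u, u ≠ 0 → 0 < B y u u)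
    {ell : F × F → F →L[ℝ] ℝ} (hell : ∀ p : F × F, p.1 ∈ U → ContDiffAt ℝ 1 ell p)
    {y₀ : F} (hy₀ : y₀ ∈ U) (u₀ : F) :
    ∃ (c : ℝ → F) (ε : ℝ), 0 < ε ∧ c 0 = y₀ ∧ deriv c 0 = u₀ ∧ ContDiffOn ℝ 2 c (Set.Ioo (-ε) ε) ∧
      ∀ t ∈ Set.Ioo (-ε) ε, c t ∈ U ∧ B (c t) (deriv (deriv c) t) = ell (c t, deriv c t) := by
  -- The equivalent first-order system for the pair `(c, c')`, solved for `c''` by inverting `B`.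
  let f : F × F → F × F := fun p => (p.2, (B p.1).inverse (ell p))
  have hf : ∀ p : F × F, p.1 ∈ U → ContDiffAt ℝ 1 f p := by
    intro p hp
    obtain ⟨e, he⟩ := isInvertible_of_pos (B p.1) (hpos p.1 hp)
    have h1 : ContDiffAt ℝ 1 (fun q : F × F => (B q.1).inverse) p := by
      have h2 : ContDiffAt ℝ 1 ContinuousLinearMap.inverse (B p.1) := by
        rw [← he]; exact contDiffAt_map_inverse e
      exact ContDiffAt.comp p h2 ((hB p.1 hp).comp p contDiffAt_fst)
    exact contDiffAt_snd.prodMk (h1.clm_apply (hell p hp))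
  obtain ⟨α, hα0, ε₀, hε₀, hα⟩ :=
    (hf (y₀, u₀) hy₀).exists_forall_mem_closedBall_exists_eq_forall_mem_Ioo_hasDerivAt₀ 0
  have hαc : ContinuousAt α 0 := (hα 0 (by constructor <;> linarith)).continuousAt
  have hU' : ∀ᶠ t in 𝓝 (0 : ℝ), (α t).1 ∈ U := by
    refine (continuous_fst.continuousAt.comp hαc).preimage_mem_nhds (hU.mem_nhds ?_)
    rw [Function.comp_apply, hα0]; exact hy₀
  obtain ⟨ε₁, hε₁, hball⟩ := Metric.eventually_nhds_iff_ball.1 hU'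
  set ε := min ε₀ ε₁ with hε
  have hεpos : 0 < ε := lt_min hε₀ hε₁
  set J := Set.Ioo (-ε) ε with hJ
  have hJo : IsOpen J := isOpen_Ioo
  have h0J : (0 : ℝ) ∈ J := ⟨by linarith, hεpos⟩
  have hαJ : ∀ t ∈ J, HasDerivAt α (f (α t)) t := fun t ht =>
    hα t ⟨by linarith [ht.1, min_le_left ε₀ ε₁], by linarith [ht.2, min_le_left ε₀ ε₁]⟩
  have hUJ : ∀ t ∈ J, (α t).1 ∈ U := fun t ht => hball t (by
    rw [Real.ball_eq_Ioo]
    exact ⟨by linarith [ht.1, min_le_right ε₀ ε₁], by linarith [ht.2, min_le_right ε₀ ε₁]⟩)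
  have hc1 : ∀ t ∈ J, HasDerivAt (fun t => (α t).1) (α t).2 t := fun t ht => (hαJ t ht).fst
  have hc2 : ∀ t ∈ J, HasDerivAt (fun t => (α t).2) ((B (α t).1).inverse (ell (α t))) t :=
    fun t ht => (hαJ t ht).snd
  have hderiv : ∀ t ∈ J, deriv (fun t => (α t).1) =ᶠ[𝓝 t] fun t => (α t).2 := by
    intro t ht
    filter_upwards [hJo.mem_nhds ht] with s hs
    exact (hc1 s hs).deriv
  have hαcont : ContinuousOn α J := fun t ht => (hαJ t ht).continuousAt.continuousWithinAt
  -- The solution is differentiable with continuous derivative `f ∘ α`, hence `C¹`; since `c'` is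
  -- its second component, `c` is `C²`.
  have hα1 : ContDiffOn ℝ 1 α J := by
    rw [show (1 : WithTop ℕ∞) = 0 + 1 by simp, contDiffOn_succ_iff_deriv_of_isOpen hJo]
    refine ⟨fun t ht => (hαJ t ht).differentiableAt.differentiableWithinAt, by simp, ?_⟩
    rw [contDiffOn_zero]
    have h1 : ContinuousOn (fun t => f (α t)) J := fun t ht =>
      ContinuousAt.comp_continuousWithinAt (g := f) (hf (α t) (hUJ t ht)).continuousAt (hαcont t ht)
    exact h1.congr fun t ht => (hαJ t ht).deriv
  refine ⟨fun t => (α t).1, ε, hεpos, by simp [hα0], ?_, ?_, fun t ht => ⟨hUJ t ht, ?_⟩⟩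
  · rw [(hc1 0 h0J).deriv, hα0]
  · rw [show (2 : WithTop ℕ∞) = 1 + 1 by norm_num, contDiffOn_succ_iff_deriv_of_isOpen hJo]
    refine ⟨fun t ht => (hc1 t ht).differentiableAt.differentiableWithinAt, by simp, ?_⟩
    exact hα1.snd.congr fun t ht => (hc1 t ht).deriv
  · rw [(hderiv t ht).deriv_eq, (hc2 t ht).deriv, (hc1 t ht).deriv]
    exact (isInvertible_of_pos _ (hpos _ (hUJ t ht))).self_apply_inverse _

omit [FiniteDimensional ℝ F] in
theorem contDiffAt_fderiv_fst {W : Type*} [NormedAddCommGroup W] [NormedSpace ℝ W] {f : F → W}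
    {p : F × F} (hf : ContDiffAt ℝ ∞ f p.1) :
    ContDiffAt ℝ 1 (fun q : F × F => fderiv ℝ f q.1) p :=
  ContDiffAt.comp p (g := fderiv ℝ f)
    ((hf.of_le (n := ∞) (m := 2) ENat.LEInfty.out).fderiv_right (by norm_num)) contDiffAt_fst

variable {M : Type*} [TopologicalSpace M] [ChartedSpace F M] [IsManifold 𝓘(ℝ, F) ∞ M]

/-- Every tangent vector is the initial velocity of a geodesic. -/
theorem exists_geodesic (g : Metric F M) (x₀ : M) (v : F) :
    ∃ (γ : ℝ → M) (J : Set ℝ), IsOpen J ∧ J.OrdConnected ∧ (0 : ℝ) ∈ J ∧ IsGeodesicOn g γ J ∧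
      γ 0 = x₀ ∧ vel F γ 0 = v := by
  set e := chartAt F x₀ with he
  set B := metricCoord g x₀ with hB
  -- The geodesic equation solved for `g(c'', w)`: the right-hand side is `(1/2) (∂_w g)(c', c') -
  -- (∂_{c'} g)(c', w)`.
  let ell : F × F → F →L[ℝ] ℝ := fun p =>
    (1 / 2 : ℝ) • ((fderiv ℝ B p.1).flip p.2).flip p.2 - fderiv ℝ B p.1 p.2 p.2
  have hBs : ∀ y ∈ e.target, ContDiffAt ℝ ∞ B y := fun y hy => contDiffAt_metricCoord g x₀ hy
  have hell : ∀ p : F × F, p.1 ∈ e.target → ContDiffAt ℝ 1 ell p := by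
    have hopen : IsOpen {p : F × F | p.1 ∈ e.target} := e.open_target.preimage continuous_fst
    have hon : ContDiffOn ℝ 1 ell {p : F × F | p.1 ∈ e.target} := by
      refine contDiffOn_clm_apply.2 fun w p hp => ContDiffAt.contDiffWithinAt ?_
      have hD := contDiffAt_fderiv_fst (hBs p.1 hp)
      have h1 : ContDiffAt ℝ 1 (fun q : F × F => fderiv ℝ B q.1 w q.2 q.2) p :=
        ((hD.clm_apply contDiffAt_const).clm_apply contDiffAt_snd).clm_apply contDiffAt_snd
      have h2 : ContDiffAt ℝ 1 (fun q : F × F => fderiv ℝ B q.1 q.2 q.2 w) p :=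
        ((hD.clm_apply contDiffAt_snd).clm_apply contDiffAt_snd).clm_apply contDiffAt_const
      exact (contDiffAt_const (c := (1 / 2 : ℝ))).smul h1 |>.sub h2
    exact fun p hp => hon.contDiffAt (hopen.mem_nhds hp)
  obtain ⟨c, ε, hε, hc0, hc0', hc2, hc⟩ := exists_second_order_solution e.open_target
    (fun y hy => (hBs y hy).of_le ENat.LEInfty.out)
    (fun y hy u hu => metricCoord_pos g x₀ hy hu) hell (mem_chart_target F x₀) v
  set J := Set.Ioo (-ε) ε with hJ
  have hJo : IsOpen J := isOpen_Ioo
  have h0J : (0 : ℝ) ∈ J := ⟨by linarith, hε⟩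
  have hx : e.symm (c 0) = x₀ := by rw [hc0]; exact e.left_inv (mem_chart_source F x₀)
  have hγ2 : ContMDiffOn 𝓘(ℝ, ℝ) 𝓘(ℝ, F) 2 (fun t => e.symm (c t)) J := by
    have h1 : ContMDiffOn 𝓘(ℝ, F) 𝓘(ℝ, F) ∞ e.symm e.target := contMDiffOn_chart_symm
    exact (h1.of_le ENat.LEInfty.out).comp hc2.contMDiffOn fun t ht => (hc t ht).1
  refine ⟨fun t => e.symm (c t), J, hJo, Set.ordConnected_Ioo, h0J, ⟨hγ2, fun t ht => ?_⟩, hx, ?_⟩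
  · refine ⟨x₀, e.map_target (hc t ht).1, ?_⟩
    have hev : (fun s => e (e.symm (c s))) =ᶠ[𝓝 t] c := by
      filter_upwards [hJo.mem_nhds ht] with s hs
      exact e.right_inv (hc s hs).1
    rw [geodesicEquationAt_iff g x₀ (by rw [← he, hev.eq_of_nhds]; exact (hc t ht).1), ← he]
    intro w
    rw [hev.deriv.deriv_eq, hev.deriv_eq, hev.eq_of_nhds]
    have h1 := DFunLike.congr_fun (hc t ht).2 w
    rw [← hB, h1]
    simp only [ell, sub_apply, smul_apply, smul_eq_mul, ContinuousLinearMap.flip_apply]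
    ring
  · have hd : DiffAt ℝ F (fun t => e.symm (c t)) 0 :=
      (hγ2.contMDiffAt (hJo.mem_nhds h0J)).mdifferentiableAt (by simp)
    have h0s : e.symm (c 0) ∈ e.source := by rw [hx]; exact mem_chart_source F x₀
    have h1 := vel_eq_dAt_chart_symm x₀ hd h0s
    have hev : (fun s => e (e.symm (c s))) =ᶠ[𝓝 0] c := by
      filter_upwards [hJo.mem_nhds h0J] with s hs
      exact e.right_inv (hc s hs).1
    rw [h1, hev.deriv_eq, hc0', ← he]
    -- The preferred chart at `x₀` has identity differential there, so the coordinate velocity `v`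
    -- is the velocity itself.
    have h2 := dAt_chart_symm_dAt_chart x₀ (mem_chart_source F x₀) v
    rw [dAt_chart_self] at h2
    rw [hx]
    exact h2

end GeodesicExistence

/-! ### Symmetric endomorphisms for a positive definite form -/

section Spectral

variable {L : Type*} [AddCommGroup L] [Module ℝ L] [FiniteDimensional ℝ L]

/-- An endomorphism that is symmetric for a positive definite form is diagonalizable. -/
theorem iSup_eigenspace_eq_top (b : LinearMap.BilinForm ℝ L) (hsymm : ∀ X Y, b X Y = b Y X)
    (hpos : ∀ X, X ≠ 0 → 0 < b X X) (T : Module.End ℝ L) (hT : ∀ X Y, b (T X) Y = b X (T Y)) :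
    ⨆ μ, Module.End.eigenspace T μ = ⊤ := by
  have hnn : ∀ X, 0 ≤ b X X := fun X => by
    by_cases h : X = 0
    · simp [h]
    · exact (hpos X h).le
  let core : InnerProductSpace.Core ℝ L :=
    { inner := fun X Y => b X Y
      conj_inner_symm := fun X Y => hsymm Y X
      re_inner_nonneg := fun X => hnn X
      add_left := fun X Y Z => by simp
      smul_left := fun X Y r => by simp
      definite := fun X h => by
        by_contra hX
        exact (hpos X hX).ne' h }
  let : NormedAddCommGroup L := core.toNormedAddCommGroup
  let : InnerProductSpace ℝ L := InnerProductSpace.ofCore core.toCore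
  have hTs : T.IsSymmetric := fun X Y => hT X Y
  have h := hTs.orthogonalComplement_iSup_eigenspaces_eq_bot
  rwa [Submodule.orthogonal_eq_bot_iff] at h

/-- An invariant subspace on which an endomorphism is symmetric for a positive definite form is
spanned by eigenvectors. -/
theorem le_iSup_inf_eigenspace {b : LinearMap.BilinForm ℝ L} (hsymm : ∀ X Y, b X Y = b Y X)
    (hpos : ∀ X, X ≠ 0 → 0 < b X X) {T : Module.End ℝ L} {V : Submodule ℝ L}
    (hV : ∀ X ∈ V, T X ∈ V) (hT : ∀ X ∈ V, ∀ Y ∈ V, b (T X) Y = b X (T Y)) :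
    V ≤ ⨆ μ, V ⊓ Module.End.eigenspace T μ := by
  have h := iSup_eigenspace_eq_top (b.restrict V) (fun X Y => hsymm X Y)
    (fun X hX => hpos X (by simpa using hX)) (T.restrict hV) (fun X Y => hT X X.2 Y Y.2)
  have h2 : Submodule.map V.subtype (⨆ μ, Module.End.eigenspace (T.restrict hV) μ) ≤
      ⨆ μ, V ⊓ Module.End.eigenspace T μ := by
    rw [Submodule.map_iSup]
    refine iSup_mono fun μ => ?_
    rintro _ ⟨X, hX, rfl⟩
    refine ⟨X.2, ?_⟩
    have hX' := Module.End.mem_eigenspace_iff.1 hX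
    exact Module.End.mem_eigenspace_iff.2 (congrArg Subtype.val hX')
  rw [h, Submodule.map_top, Submodule.range_subtype] at h2
  exact h2

omit [FiniteDimensional ℝ L] in
theorem eq_zero_of_mem_orthogonal {b : LinearMap.BilinForm ℝ L} (hpos : ∀ X, X ≠ 0 → 0 < b X X)
    {X : L} (h : b X X = 0) : X = 0 := by
  by_contra hX
  exact (hpos X hX).ne' h

/-- Orthogonal projection for a positive definite form. -/
theorem exists_sub_mem_orthogonal {b : LinearMap.BilinForm ℝ L} (hsymm : ∀ X Y, b X Y = b Y X)
    (hpos : ∀ X, X ≠ 0 → 0 < b X X) (U : Submodule ℝ L) (X : L) :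
    ∃ Y ∈ U, X - Y ∈ b.orthogonal U := by
  have hr : b.IsRefl := fun X Y h => by rw [hsymm]; exact h
  have hnd : (b.restrict U).Nondegenerate := by
    have hsep : ∀ Y : U, (∀ Z : U, b Y Z = 0) → Y = 0 := fun Y hY =>
      Subtype.ext (eq_zero_of_mem_orthogonal hpos (hY Y))
    refine ⟨fun Y hY => hsep Y hY, fun Y hY => hsep Y fun Z => ?_⟩
    rw [hsymm]; exact hY Z
  have hc := (LinearMap.BilinForm.isCompl_orthogonal_of_restrict_nondegenerate hr hnd)
  have hX : X ∈ U ⊔ b.orthogonal U := by rw [hc.sup_eq_top]; trivial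
  obtain ⟨Y, hY, Z, hZ, rfl⟩ := Submodule.mem_sup.1 hX
  exact ⟨Y, hY, by simpa using hZ⟩

end Spectral

/-! ### The algebra of the geodesic lemma -/

section Algebra

variable {L : Type*} [LieRing L] [LieAlgebra ℝ L] [FiniteDimensional ℝ L]

/-- The algebraic data of a geodesic orbit metric: an invariant Euclidean form on a Lie algebra, a
subalgebra `h` and a symmetric `h`-equivariant endomorphism `T` of its orthogonal complement that
satisfies the geodesic lemma. -/
structure GOData (b : LinearMap.BilinForm ℝ L) (h : LieSubalgebra ℝ L) (T : Module.End ℝ L) :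
    Prop where
  symm : ∀ X Y : L, b X Y = b Y X
  pos : ∀ X : L, X ≠ 0 → 0 < b X X
  skew : ∀ X Y Z : L, b ⁅X, Y⁆ Z = -b Y ⁅X, Z⁆
  map_symm : ∀ X ∈ b.orthogonal h.toSubmodule, ∀ Y ∈ b.orthogonal h.toSubmodule,
    b (T X) Y = b X (T Y)
  map_lie : ∀ Z : L, Z ∈ h → ∀ X ∈ b.orthogonal h.toSubmodule, T ⁅Z, X⁆ = ⁅Z, T X⁆
  geodesic : ∀ X ∈ b.orthogonal h.toSubmodule, ∃ Z : L, Z ∈ h ∧ ⁅X + Z, T X⁆ = 0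

namespace GOData

variable {b : LinearMap.BilinForm ℝ L} {h : LieSubalgebra ℝ L} {T : Module.End ℝ L}
  (D : GOData b h T)

include D

omit [FiniteDimensional ℝ L] in
theorem eq_zero {X : L} (hX : b X X = 0) : X = 0 := eq_zero_of_mem_orthogonal D.pos hX

omit [FiniteDimensional ℝ L] in
/-- The commutator of eigenvectors with different eigenvalues. -/
theorem sub_smul_lie {X Y : L} {lam mu : ℝ} (hX : X ∈ b.orthogonal h.toSubmodule)
    (hY : Y ∈ b.orthogonal h.toSubmodule) (hTX : T X = lam • X) (hTY : T Y = mu • Y) :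
    ∃ Z : L, Z ∈ h ∧ (mu - lam) • ⁅X, Y⁆ = -(lam • ⁅Z, X⁆) - mu • ⁅Z, Y⁆ := by
  obtain ⟨Z, hZ, h0⟩ := D.geodesic (X + Y) (add_mem hX hY)
  refine ⟨Z, hZ, ?_⟩
  rw [map_add, hTX, hTY] at h0
  simp only [add_lie, lie_add, lie_smul, lie_self, zero_add, add_zero] at h0
  have h1 : ⁅Y, X⁆ = -⁅X, Y⁆ := (lie_skew Y X).symm
  rw [h1] at h0
  rw [sub_smul, ← sub_eq_zero, ← h0]
  module

variable {V : Submodule ℝ L} (hVm : V ≤ b.orthogonal h.toSubmodule) (hVT : ∀ X ∈ V, T X ∈ V)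

include hVm hVT

theorem le_iSup : V ≤ ⨆ μ, V ⊓ Module.End.eigenspace T μ :=
  le_iSup_inf_eigenspace D.symm D.pos hVT fun X hX Y hY => D.map_symm X (hVm hX) Y (hVm hY)

/-- `T X - mu • X` pairs with an eigenvector `W` of eigenvalue `nu` as `(nu - mu) * b X W`. If `X`
is orthogonal to the other eigenspaces, this vanishes for every `nu`, and the eigenvectors span `V`.
-/
theorem mem_eigenspace {X : L} {mu : ℝ} (hX : X ∈ V)
    (h0 : ∀ nu, nu ≠ mu → ∀ W ∈ V, T W = nu • W → b X W = 0) : T X = mu • X := by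
  rw [← sub_eq_zero]
  set Y := T X - mu • X with hY
  have hYV : Y ∈ V := sub_mem (hVT X hX) (V.smul_mem mu hX)
  refine D.eq_zero ?_
  have key : ∀ W ∈ ⨆ ν, V ⊓ Module.End.eigenspace T ν, b Y W = 0 := by
    intro W hW
    induction hW using Submodule.iSup_induction' with
    | mem nu W hW =>
      have hTW := Module.End.mem_eigenspace_iff.1 hW.2
      have h1 : b Y W = (nu - mu) * b X W := by
        rw [hY, map_sub, LinearMap.sub_apply, D.map_symm X (hVm hX) W (hVm hW.1), hTW]
        simp only [map_smul, LinearMap.smul_apply, smul_eq_mul]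
        ring
      rw [h1]
      by_cases hnu : nu = mu
      · simp [hnu]
      · rw [h0 nu hnu W hW.1 hTW, mul_zero]
    | zero => simp
    | add W W' _ _ h1 h2 => rw [map_add, h1, h2, add_zero]
  exact key Y (D.le_iSup hVm hVT hYV)

theorem eq_smul_of_eigenspaces {c : ℝ}
    (h0 : ∀ mu, mu ≠ c → V ⊓ Module.End.eigenspace T mu = ⊥) {X : L} (hX : X ∈ V) :
    T X = c • X := by
  refine D.mem_eigenspace hVm hVT hX fun nu hnu W hW hTW => ?_
  have h1 : W ∈ V ⊓ Module.End.eigenspace T nu := ⟨hW, Module.End.mem_eigenspace_iff.2 hTW⟩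
  rw [h0 nu hnu, Submodule.mem_bot] at h1
  rw [h1, map_zero]

theorem exists_eigenspace_ne_bot (hV : V ≠ ⊥) : ∃ mu, V ⊓ Module.End.eigenspace T mu ≠ ⊥ := by
  by_contra! h0
  refine hV ((Submodule.eq_bot_iff _).2 fun X hX => ?_)
  -- Without eigenvectors `T` would be every scalar on `V`; the two scalars `0` and `1` already
  -- force `X = 0`.
  have h1 := D.eq_smul_of_eigenspaces hVm hVT (c := 0) (fun mu _ => h0 mu) hX
  have h2 := D.eq_smul_of_eigenspaces hVm hVT (c := 1) (fun mu _ => h0 mu) hX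
  rw [h1, zero_smul, one_smul] at h2
  exact h2.symm

/-- Eigenspaces in a `T`-invariant `ad l`-submodule `V` orthogonal to `l = h + q` are
`ad l`-submodules. -/
theorem lie_mem_eigenspace {l : LieSubalgebra ℝ L} (hhl : h ≤ l)
    (hlV : ∀ Y ∈ l, ∀ X ∈ V, ⁅Y, X⁆ ∈ V) (hVl : ∀ Y ∈ l, ∀ X ∈ V, b Y X = 0)
    (hqT : ∀ X ∈ l.toSubmodule ⊓ b.orthogonal h.toSubmodule,
      T X ∈ l.toSubmodule ⊓ b.orthogonal h.toSubmodule)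
    {mu : ℝ} {X : L} (hX : X ∈ V) (hTX : T X = mu • X) {Y : L} (hY : Y ∈ l) :
    T ⁅Y, X⁆ = mu • ⁅Y, X⁆ := by
  have hh : ∀ Z ∈ h, T ⁅Z, X⁆ = mu • ⁅Z, X⁆ := by
    intro Z hZ
    rw [D.map_lie Z hZ X (hVm hX), hTX, lie_smul]
  obtain ⟨Z, hZ, hYZ⟩ := exists_sub_mem_orthogonal D.symm D.pos h.toSubmodule Y
  -- The part of `Y` in `h` is settled by equivariance. Its part orthogonal to `h` is a sum of
  -- eigenvectors `Q` of `T`, treated one at a time.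
  have hq : ∀ Q ∈ l.toSubmodule ⊓ b.orthogonal h.toSubmodule, T ⁅Q, X⁆ = mu • ⁅Q, X⁆ := by
    intro Q hQ
    have hQ' := D.le_iSup (V := l.toSubmodule ⊓ b.orthogonal h.toSubmodule) inf_le_right hqT hQ
    clear hQ
    induction hQ' using Submodule.iSup_induction' with
    | mem nu Q hQ =>
      have hTQ := Module.End.mem_eigenspace_iff.1 hQ.2
      have hQl : Q ∈ l := hQ.1.1
      have hQX : ⁅Q, X⁆ ∈ V := hlV Q hQl X hX
      by_cases hnu : nu = mu
      -- Equal eigenvalues: `b ⁅Q, X⁆ W = b Q ⁅X, W⁆`, and for `W` of another eigenvalue `⁅X, W⁆`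
      -- lies in `V`, which is orthogonal to `l`.
      · refine D.mem_eigenspace hVm hVT hQX fun mu' hmu' W hW hTW => ?_
        obtain ⟨Z', hZ', hXW⟩ := D.sub_smul_lie (hVm hX) (hVm hW) hTX hTW
        have hV1 : (mu' - mu) • ⁅X, W⁆ ∈ V := by
          rw [hXW]
          exact sub_mem (neg_mem (V.smul_mem _ (hlV Z' (hhl hZ') X hX)))
            (V.smul_mem _ (hlV Z' (hhl hZ') W hW))
        have h1 := hVl Q hQl _ hV1
        rw [map_smul, smul_eq_mul, mul_eq_zero, or_iff_right (sub_ne_zero.2 hmu')] at h1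
        rw [← lie_skew, map_neg, LinearMap.neg_apply, D.skew, neg_neg]
        exact h1
      -- Different eigenvalues: the term `nu • ⁅Z', Q⁆` lies in `l` and all others in `V`, so it
      -- vanishes. Then `⁅Q, X⁆` is a multiple of `⁅Z', X⁆`, where equivariance under `h` applies.
      · obtain ⟨Z', hZ', hQXe⟩ := D.sub_smul_lie hQ.1.2 (hVm hX) hTQ hTX
        have hZQl : nu • ⁅Z', Q⁆ ∈ l := l.smul_mem _ (l.lie_mem (hhl hZ') hQl)
        have hZQV : nu • ⁅Z', Q⁆ ∈ V := by
          have : nu • ⁅Z', Q⁆ = -((mu - nu) • ⁅Q, X⁆) - mu • ⁅Z', X⁆ := by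
            rw [hQXe]; abel
          rw [this]
          exact sub_mem (neg_mem (V.smul_mem _ hQX)) (V.smul_mem _ (hlV Z' (hhl hZ') X hX))
        have hZQ0 : nu • ⁅Z', Q⁆ = 0 := D.eq_zero (hVl _ hZQl _ hZQV)
        rw [hZQ0, neg_zero, zero_sub] at hQXe
        have h2 : (mu - nu) • T ⁅Q, X⁆ = (mu - nu) • mu • ⁅Q, X⁆ := by
          rw [← map_smul, smul_comm _ mu, hQXe, map_neg, map_smul, hh Z' hZ', smul_neg]
        exact smul_right_injective L (sub_ne_zero.2 (Ne.symm hnu)) h2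
    | zero => simp
    | add Q Q' _ _ h1 h2 => rw [add_lie, map_add, h1, h2, smul_add]
  have hsplit : ⁅Y, X⁆ = ⁅Z, X⁆ + ⁅Y - Z, X⁆ := by rw [sub_lie]; abel
  have hZl : Z ∈ l := hhl hZ
  rw [hsplit, map_add, hh Z hZ, hq (Y - Z) ⟨l.sub_mem hY hZl, hYZ⟩, smul_add]

end GOData

/-- The algebraic core: an endomorphism that preserves the decomposition defined by two generating
subalgebras and satisfies the geodesic lemma is scalar on `p₁ + p₂ + n`. -/
theorem GOData.exists_eq_smul {b : LinearMap.BilinForm ℝ L} {h k k' : LieSubalgebra ℝ L}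
    {T : Module.End ℝ L} (D : GOData b h T) (hk : h ≤ k) (hk' : h ≤ k')
    (hk_proper : k ≠ ⊤) (hk'_proper : k' ≠ ⊤) (hgen : k ⊔ k' = ⊤)
    {q p₁ p₂ n : Submodule ℝ L}
    (hq : ∀ X, X ∈ q ↔ X ∈ k ⊓ k' ∧ X ∈ b.orthogonal h.toSubmodule)
    (hp₁ : ∀ X, X ∈ p₁ ↔ X ∈ k ∧ ∀ Y ∈ k ⊓ k', b Y X = 0)
    (hp₂ : ∀ X, X ∈ p₂ ↔ X ∈ k' ∧ ∀ Y ∈ k ⊓ k', b Y X = 0)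
    (hn : ∀ X, X ∈ n ↔ (∀ Y ∈ k, b Y X = 0) ∧ ∀ Y ∈ k', b Y X = 0)
    (horth : ∀ X ∈ p₁, ∀ Y ∈ p₂, b X Y = 0)
    (hcomm : ∀ V W : Submodule ℝ L, V ≤ p₁ → W ≤ p₂ → V ≠ ⊥ → W ≠ ⊥ →
      (∀ Z ∈ h.toSubmodule ⊔ q, ∀ X ∈ V, ⁅Z, X⁆ ∈ V) →
      (∀ Z ∈ h.toSubmodule ⊔ q, ∀ X ∈ W, ⁅Z, X⁆ ∈ W) → ¬ ∀ X ∈ V, ∀ Y ∈ W, ⁅X, Y⁆ = 0)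
    (hTq : ∀ X ∈ q, T X ∈ q) (hT₁ : ∀ X ∈ p₁, T X ∈ p₁) (hT₂ : ∀ X ∈ p₂, T X ∈ p₂)
    (hTn : ∀ X ∈ n, T X ∈ n) :
    ∃ c : ℝ, ∀ X ∈ p₁ ⊔ p₂ ⊔ n, T X = c • X := by
  -- `l` plays the role of `h + q`.
  set l := k ⊓ k' with hl
  have hhl : h ≤ l := le_inf hk hk'
  have hlk : ∀ Y ∈ l, Y ∈ k := fun Y hY => hY.1
  have hlk' : ∀ Y ∈ l, Y ∈ k' := fun Y hY => hY.2
  have hmem_m : ∀ X, (∀ Y ∈ l, b Y X = 0) → X ∈ b.orthogonal h.toSubmodule :=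
    fun X hX Y hY => hX Y (hhl hY)
  have hp₁l : ∀ Y ∈ l, ∀ X ∈ p₁, b Y X = 0 := fun Y hY X hX => ((hp₁ X).1 hX).2 Y hY
  have hp₂l : ∀ Y ∈ l, ∀ X ∈ p₂, b Y X = 0 := fun Y hY X hX => ((hp₂ X).1 hX).2 Y hY
  have hnl : ∀ Y ∈ l, ∀ X ∈ n, b Y X = 0 := fun Y hY X hX => ((hn X).1 hX).1 Y (hlk Y hY)
  have hp₁m : p₁ ≤ b.orthogonal h.toSubmodule := fun X hX => hmem_m X fun Y hY => hp₁l Y hY X hX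
  have hp₂m : p₂ ≤ b.orthogonal h.toSubmodule := fun X hX => hmem_m X fun Y hY => hp₂l Y hY X hX
  have hnm : n ≤ b.orthogonal h.toSubmodule := fun X hX => hmem_m X fun Y hY => hnl Y hY X hX
  have skew' : ∀ X Y Z : L, b Z ⁅X, Y⁆ = -b ⁅X, Z⁆ Y := by
    intro X Y Z; rw [D.symm, D.skew, D.symm]
  have hl₁ : ∀ Y ∈ l, ∀ X ∈ p₁, ⁅Y, X⁆ ∈ p₁ := by
    intro Y hY X hX
    refine (hp₁ _).2 ⟨k.lie_mem (hlk Y hY) ((hp₁ X).1 hX).1, fun Z hZ => ?_⟩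
    rw [skew', hp₁l _ (l.lie_mem hY hZ) X hX, neg_zero]
  have hl₂ : ∀ Y ∈ l, ∀ X ∈ p₂, ⁅Y, X⁆ ∈ p₂ := by
    intro Y hY X hX
    refine (hp₂ _).2 ⟨k'.lie_mem (hlk' Y hY) ((hp₂ X).1 hX).1, fun Z hZ => ?_⟩
    rw [skew', hp₂l _ (l.lie_mem hY hZ) X hX, neg_zero]
  have hkn : ∀ Y ∈ k, ∀ X ∈ n, ∀ Z ∈ k, b Z ⁅Y, X⁆ = 0 := by
    intro Y hY X hX Z hZ
    rw [skew', ((hn X).1 hX).1 _ (k.lie_mem hY hZ), neg_zero]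
  have hkn' : ∀ Y ∈ k', ∀ X ∈ n, ∀ Z ∈ k', b Z ⁅Y, X⁆ = 0 := by
    intro Y hY X hX Z hZ
    rw [skew', ((hn X).1 hX).2 _ (k'.lie_mem hY hZ), neg_zero]
  have hln : ∀ Y ∈ l, ∀ X ∈ n, ⁅Y, X⁆ ∈ n := fun Y hY X hX =>
    (hn _).2 ⟨hkn Y (hlk Y hY) X hX, hkn' Y (hlk' Y hY) X hX⟩
  have hdec : ∀ X ∈ k, ∃ Y ∈ l, X - Y ∈ p₁ := by
    intro X hX
    obtain ⟨Y, hY, hXY⟩ := exists_sub_mem_orthogonal D.symm D.pos l.toSubmodule X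
    exact ⟨Y, hY, (hp₁ _).2 ⟨k.sub_mem hX (hlk Y hY), hXY⟩⟩
  have hdec' : ∀ X ∈ k', ∃ Y ∈ l, X - Y ∈ p₂ := by
    intro X hX
    obtain ⟨Y, hY, hXY⟩ := exists_sub_mem_orthogonal D.symm D.pos l.toSubmodule X
    exact ⟨Y, hY, (hp₂ _).2 ⟨k'.sub_mem hX (hlk' Y hY), hXY⟩⟩
  -- `k = l + p₁`, and both summands are orthogonal to `p₂`.
  have hp₂k : ∀ X ∈ k, ∀ Y ∈ p₂, b X Y = 0 := by
    intro X hX Y hY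
    obtain ⟨Z, hZ, hXZ⟩ := hdec X hX
    have : X = Z + (X - Z) := by abel
    rw [this, map_add, LinearMap.add_apply, hp₂l Z hZ Y hY, horth _ hXZ Y hY, add_zero]
  have hp₁k' : ∀ X ∈ k', ∀ Y ∈ p₁, b X Y = 0 := by
    intro X hX Y hY
    obtain ⟨Z, hZ, hXZ⟩ := hdec' X hX
    have : X = Z + (X - Z) := by abel
    rw [this, map_add, LinearMap.add_apply, hp₁l Z hZ Y hY, D.symm, horth Y hY _ hXZ, add_zero]
  -- By skewness, `b Z ⁅X, Y⁆` with `Z ∈ k` is up to sign `b ⁅X, Z⁆ Y`, a pairing of `k` with `p₂`;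
  -- symmetrically for `Z ∈ k'`.
  have h12n : ∀ X ∈ p₁, ∀ Y ∈ p₂, ⁅X, Y⁆ ∈ n := by
    intro X hX Y hY
    refine (hn _).2 ⟨fun Z hZ => ?_, fun Z hZ => ?_⟩
    · rw [skew', hp₂k _ (k.lie_mem ((hp₁ X).1 hX).1 hZ) Y hY, neg_zero]
    · rw [← lie_skew, map_neg, skew', hp₁k' _ (k'.lie_mem ((hp₂ Y).1 hY).1 hZ) X hX, neg_zero,
        neg_zero]
  have hqT : ∀ X ∈ l.toSubmodule ⊓ b.orthogonal h.toSubmodule,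
      T X ∈ l.toSubmodule ⊓ b.orthogonal h.toSubmodule :=
    fun X hX => (hq _).1 (hTq X ((hq X).2 hX))
  have hhq : ∀ Z ∈ h.toSubmodule ⊔ q, Z ∈ l := by
    have : h.toSubmodule ⊔ q ≤ l.toSubmodule :=
      sup_le (fun Z hZ => hhl hZ) fun Z hZ => ((hq Z).1 hZ).1
    exact fun Z hZ => this hZ
  have hstable : ∀ V : Submodule ℝ L, V ≤ b.orthogonal h.toSubmodule → (∀ X ∈ V, T X ∈ V) →
      (∀ Y ∈ l, ∀ X ∈ V, ⁅Y, X⁆ ∈ V) → (∀ Y ∈ l, ∀ X ∈ V, b Y X = 0) → ∀ mu,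
      ∀ Y ∈ l, ∀ X ∈ V ⊓ Module.End.eigenspace T mu, ⁅Y, X⁆ ∈ V ⊓ Module.End.eigenspace T mu := by
    intro V h1 h2 h3 h4 mu Y hY X hX
    exact ⟨h3 Y hY X hX.1, Module.End.mem_eigenspace_iff.2
      (D.lie_mem_eigenspace h1 h2 hhl h3 h4 hqT hX.1 (Module.End.mem_eigenspace_iff.1 hX.2) hY)⟩
  -- If `p₁ = 0` then `k = l` lies in `k'`, so `k'` alone would generate.
  have hp₁ne : p₁ ≠ ⊥ := by
    intro h0
    refine hk'_proper (hgen ▸ (sup_eq_right.2 fun X hX => ?_).symm)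
    obtain ⟨Y, hY, hXY⟩ := hdec X hX
    rw [h0, Submodule.mem_bot, sub_eq_zero] at hXY
    exact hXY ▸ hlk' Y hY
  have hp₂ne : p₂ ≠ ⊥ := by
    intro h0
    refine hk_proper (hgen ▸ (sup_eq_left.2 fun X hX => ?_).symm)
    obtain ⟨Y, hY, hXY⟩ := hdec' X hX
    rw [h0, Submodule.mem_bot, sub_eq_zero] at hXY
    exact hXY ▸ hlk Y hY
  -- For `lam ≠ mu` the commutator `⁅X, Y⁆` lies in `n` and also in `p₁ + p₂`, hence is zero; the
  -- eigenspaces would be commuting submodules.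
  have hsame : ∀ lam mu, p₁ ⊓ Module.End.eigenspace T lam ≠ ⊥ →
      p₂ ⊓ Module.End.eigenspace T mu ≠ ⊥ → lam = mu := by
    intro lam mu h1 h2
    by_contra hne
    refine hcomm _ _ inf_le_left inf_le_left h1 h2
      (fun Z hZ => hstable p₁ hp₁m hT₁ hl₁ hp₁l lam Z (hhq Z hZ))
      (fun Z hZ => hstable p₂ hp₂m hT₂ hl₂ hp₂l mu Z (hhq Z hZ)) ?_
    intro X hX Y hY
    obtain ⟨Z, hZ, hXY⟩ := D.sub_smul_lie (hp₁m hX.1) (hp₂m hY.1)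
      (Module.End.mem_eigenspace_iff.1 hX.2) (Module.End.mem_eigenspace_iff.1 hY.2)
    have hXYn := (hn _).1 (h12n X hX.1 Y hY.1)
    refine D.eq_zero ?_
    have h3 : (mu - lam) * b ⁅X, Y⁆ ⁅X, Y⁆ = 0 := by
      rw [← smul_eq_mul, ← LinearMap.smul_apply, ← map_smul, hXY, map_sub, LinearMap.sub_apply,
        map_neg, LinearMap.neg_apply, map_smul, LinearMap.smul_apply, map_smul,
        LinearMap.smul_apply, hXYn.1 _ ((hp₁ _).1 (hl₁ Z (hhl hZ) X hX.1)).1,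
        hXYn.2 _ ((hp₂ _).1 (hl₂ Z (hhl hZ) Y hY.1)).1]
      simp
    exact (mul_eq_zero.1 h3).resolve_left (sub_ne_zero.2 (Ne.symm hne))
  obtain ⟨c, hc⟩ := D.exists_eigenspace_ne_bot hp₁m hT₁ hp₁ne
  have hTp₂ : ∀ X ∈ p₂, T X = c • X := fun X hX =>
    D.eq_smul_of_eigenspaces hp₂m hT₂ (fun mu hmu => by
      by_contra h2; exact hmu (hsame c mu hc h2).symm) hX
  obtain ⟨c', hc'⟩ := D.exists_eigenspace_ne_bot hp₂m hT₂ hp₂ne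
  obtain rfl : c = c' := hsame c c' hc hc'
  have hTp₁ : ∀ X ∈ p₁, T X = c • X := fun X hX =>
    D.eq_smul_of_eigenspaces hp₁m hT₁ (fun mu hmu => by
      by_contra h2; exact hmu (hsame mu c h2 hc')) hX
  have hnc : ∀ mu, mu ≠ c → n ⊓ Module.End.eigenspace T mu = ⊥ := by
    intro mu hmu
    set N := n ⊓ Module.End.eigenspace T mu with hN
    have hlN : ∀ Y ∈ l, ∀ W ∈ N, ⁅Y, W⁆ ∈ N := hstable n hnm hTn hln hnl mu
    -- The term `c • ⁅Z, X⁆` is orthogonal to the other two terms of the commutator formula, so it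
    -- vanishes. What remains writes `⁅X, W⁆` as a multiple of `⁅Z, W⁆ ∈ N`, since `mu ≠ c`.
    have hpN : ∀ X W, W ∈ N → X ∈ b.orthogonal h.toSubmodule → T X = c • X →
        (∀ Z ∈ h, b ⁅Z, X⁆ ⁅X, W⁆ = 0) → (∀ Z ∈ h, b ⁅Z, X⁆ ⁅Z, W⁆ = 0) → ⁅X, W⁆ ∈ N := by
      intro X W hW hXm hTX h1 h2
      obtain ⟨Z, hZ, hXW⟩ := D.sub_smul_lie hXm (hnm hW.1) hTX
        (Module.End.mem_eigenspace_iff.1 hW.2)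
      have h3 : c • ⁅Z, X⁆ = -((mu - c) • ⁅X, W⁆) - mu • ⁅Z, W⁆ := by rw [hXW]; abel
      have h4 : c • ⁅Z, X⁆ = 0 := by
        refine D.eq_zero ?_
        have h5 : b (c • ⁅Z, X⁆) (c • ⁅Z, X⁆) =
            b (c • ⁅Z, X⁆) (-((mu - c) • ⁅X, W⁆) - mu • ⁅Z, W⁆) := by rw [← h3]
        rw [h5, map_smul, LinearMap.smul_apply, map_sub, map_neg, map_smul, map_smul, h1 Z hZ, h2 Z hZ]
        simp
      rw [h4, neg_zero, zero_sub] at hXW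
      have h5 : (mu - c) • ⁅X, W⁆ ∈ N := by
        rw [hXW]; exact neg_mem (N.smul_mem _ (hlN Z (hhl hZ) W hW))
      exact (N.smul_mem_iff (sub_ne_zero.2 hmu)).1 h5
    have hkN : ∀ Y ∈ k, ∀ W ∈ N, ⁅Y, W⁆ ∈ N := by
      intro Y hY W hW
      obtain ⟨Z, hZ, hYZ⟩ := hdec Y hY
      have hYZk := ((hp₁ _).1 hYZ).1
      have hsplit : ⁅Y, W⁆ = ⁅Z, W⁆ + ⁅Y - Z, W⁆ := by rw [sub_lie]; abel
      rw [hsplit]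
      refine add_mem (hlN Z hZ W hW) (hpN _ W hW (hp₁m hYZ) (hTp₁ _ hYZ) ?_ ?_)
      · exact fun U hU => hkn _ hYZk W hW.1 _ (k.lie_mem (hk hU) hYZk)
      · exact fun U hU => hkn _ (hk hU) W hW.1 _ (k.lie_mem (hk hU) hYZk)
    have hkN' : ∀ Y ∈ k', ∀ W ∈ N, ⁅Y, W⁆ ∈ N := by
      intro Y hY W hW
      obtain ⟨Z, hZ, hYZ⟩ := hdec' Y hY
      have hYZk := ((hp₂ _).1 hYZ).1
      have hsplit : ⁅Y, W⁆ = ⁅Z, W⁆ + ⁅Y - Z, W⁆ := by rw [sub_lie]; abel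
      rw [hsplit]
      refine add_mem (hlN Z hZ W hW) (hpN _ W hW (hp₂m hYZ) (hTp₂ _ hYZ) ?_ ?_)
      · exact fun U hU => hkn' _ hYZk W hW.1 _ (k'.lie_mem (hk' hU) hYZk)
      · exact fun U hU => hkn' _ (hk' hU) W hW.1 _ (k'.lie_mem (hk' hU) hYZk)
    -- Orthogonality to `N` alone is not closed under brackets; together with stability of `N` it
    -- is, because `b ⁅X, Y⁆ W = -b Y ⁅X, W⁆`.
    let S : LieSubalgebra ℝ L :=
      { carrier := {X | (∀ W ∈ N, b X W = 0) ∧ ∀ W ∈ N, ⁅X, W⁆ ∈ N}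
        add_mem' := fun {X Y} hX hY =>
          ⟨fun W hW => by rw [map_add, LinearMap.add_apply, hX.1 W hW, hY.1 W hW, add_zero],
            fun W hW => by rw [add_lie]; exact add_mem (hX.2 W hW) (hY.2 W hW)⟩
        zero_mem' := ⟨fun W _ => by simp, fun W _ => by simp⟩
        smul_mem' := fun r X hX =>
          ⟨fun W hW => by rw [map_smul, LinearMap.smul_apply, hX.1 W hW, smul_zero],
            fun W hW => by rw [smul_lie]; exact N.smul_mem r (hX.2 W hW)⟩
        lie_mem' := fun {X Y} hX hY =>
          ⟨fun W hW => by rw [D.skew, hY.1 _ (hX.2 W hW), neg_zero],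
            fun W hW => by
              rw [lie_lie]
              exact sub_mem (hX.2 _ (hY.2 W hW)) (hY.2 _ (hX.2 W hW))⟩ }
    have hS : S = ⊤ := by
      refine top_le_iff.1 (hgen ▸ sup_le ?_ ?_)
      · exact fun X hX => ⟨fun W hW => ((hn W).1 hW.1).1 X hX, hkN X hX⟩
      · exact fun X hX => ⟨fun W hW => ((hn W).1 hW.1).2 X hX, hkN' X hX⟩
    -- As `S` is everything, `N` is orthogonal to itself.
    refine (Submodule.eq_bot_iff _).2 fun W hW => D.eq_zero ?_
    have hWS : W ∈ S := hS ▸ LieSubalgebra.mem_top W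
    exact hWS.1 W hW
  have hTn' : ∀ X ∈ n, T X = c • X := fun X hX => D.eq_smul_of_eigenspaces hnm hTn hnc hX
  refine ⟨c, fun X hX => ?_⟩
  obtain ⟨Y, hY, W, hW, rfl⟩ := Submodule.mem_sup.1 hX
  obtain ⟨U, hU, V, hV, rfl⟩ := Submodule.mem_sup.1 hY
  rw [map_add, map_add, hTp₁ U hU, hTp₂ V hV, hTn' W hW, smul_add, smul_add]

end Algebra

/-! ### The geodesic lemma for GO-metrics and the passage to algebra -/

theorem hasDerivAt_bilinForm {E : Type*} [NormedAddCommGroup E] [NormedSpace ℝ E]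
    [FiniteDimensional ℝ E] (B : LinearMap.BilinForm ℝ E) {f g : ℝ → E} {f' g' : E} {t : ℝ}
    (hf : HasDerivAt f f' t) (hg : HasDerivAt g g' t) :
    HasDerivAt (fun s => B (f s) (g s)) (B f' (g t) + B (f t) g') t := by
  let B' : E →L[ℝ] E →L[ℝ] ℝ := LinearMap.toContinuousLinearMap
    ((LinearMap.toContinuousLinearMap : (E →ₗ[ℝ] ℝ) ≃ₗ[ℝ] E →L[ℝ] ℝ).toLinearMap ∘ₗ B)
  have h1 : HasDerivAt (fun s => B' (f s)) (B' f') t := B'.hasFDerivAt.comp_hasDerivAt t hf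
  exact h1.clm_apply hg

section GeodesicLemma

variable {E : Type*} [NormedAddCommGroup E] [NormedSpace ℝ E]
  {F : Type*} [NormedAddCommGroup F] [NormedSpace ℝ F]
  {G : Type*} [TopologicalSpace G] [ChartedSpace E G] [Group G] [LieGroup 𝓘(ℝ, E) ∞ G]

instance instFiniteDimensionalGroupLieAlgebra [FiniteDimensional ℝ E] :
    FiniteDimensional ℝ (GroupLieAlgebra 𝓘(ℝ, E) G) :=
  inferInstanceAs (FiniteDimensional ℝ E)

/-- A bilinear form preserved by a one-parameter group is preserved infinitesimally. -/
theorem bilinForm_lie_of_Ad_invariant [FiniteDimensional ℝ E]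
    (B : LinearMap.BilinForm ℝ (GroupLieAlgebra 𝓘(ℝ, E) G)) {φ : ℝ → G}
    (hφ : IsOneParameterSubgroup E φ)
    (hB : ∀ t X Y, B (Ad (φ t) X) (Ad (φ t) Y) = B X Y) (X Y : GroupLieAlgebra 𝓘(ℝ, E) G) :
    B ⁅velocity (E := E) φ, X⁆ Y = -B X ⁅velocity (E := E) φ, Y⁆ := by
  have h1 := hasDerivAt_bilinForm (E := E) B (hasDerivAt_Ad_zero hφ X) (hasDerivAt_Ad_zero hφ Y)
  have h2 : HasDerivAt (fun s => B (Ad (φ s) X) (Ad (φ s) Y)) 0 0 := by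
    simp only [hB]
    exact hasDerivAt_const _ _
  have h3 := h1.unique h2
  have h4 : B ⁅velocity (E := E) φ, X⁆ (Ad (φ 0) Y) + B (Ad (φ 0) X) ⁅velocity (E := E) φ, Y⁆ = 0 :=
    h3
  rw [hφ.map_zero, Ad_one, Ad_one] at h4
  linarith

theorem IsInvariantEuclidean.skew [FiniteDimensional ℝ E] [T2Space G] [CompleteSpace E]
    {b : LinearMap.BilinForm ℝ (GroupLieAlgebra 𝓘(ℝ, E) G)} (hb : IsInvariantEuclidean b)
    (X Y Z : GroupLieAlgebra 𝓘(ℝ, E) G) : b ⁅X, Y⁆ Z = -b Y ⁅X, Z⁆ := by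
  obtain ⟨φ, hφ, rfl⟩ := exists_oneParameterSubgroup X
  exact bilinForm_lie_of_Ad_invariant b hφ (fun t => hb.ad_invariant (φ t)) Y Z

variable {H : Subgroup G} [ChartedSpace F (G ⧸ H)] [IsManifold 𝓘(ℝ, F) ∞ (G ⧸ H)]

variable (E F H) in
/-- The differential of the projection at the identity, between model spaces. -/
def dprojL : E →L[ℝ] F := dAt E F (fun a : G => (a : G ⧸ H)) 1

variable (E) in
/-- The pullback to the Lie algebra of a metric on `G ⧸ H`. -/
def metricForm (g : Metric F (G ⧸ H)) : LinearMap.BilinForm ℝ (GroupLieAlgebra 𝓘(ℝ, E) G) :=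
  (LinearMap.mk₂ ℝ (fun X Y : E => g.at ((1 : G) : G ⧸ H) (dprojL E F H X) (dprojL E F H Y))
    (fun X Y Z => by simp) (fun r X Y => by simp) (fun X Y Z => by simp) (fun r X Y => by simp) :
    LinearMap.BilinForm ℝ E)

omit [LieGroup 𝓘(ℝ, E) ∞ G] [IsManifold 𝓘(ℝ, F) ∞ (G ⧸ H)] in
theorem dproj_sub (X Y : GroupLieAlgebra 𝓘(ℝ, E) G) :
    dproj F H (X - Y) = dproj F H X - dproj F H Y := map_sub (dprojL E F H) X Y

omit [LieGroup 𝓘(ℝ, E) ∞ G] in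
theorem metricForm_dproj (g : Metric F (G ⧸ H)) (X Y : GroupLieAlgebra 𝓘(ℝ, E) G) :
    metricForm E g X Y = g.at ((1 : G) : G ⧸ H) (dproj F H X) (dproj F H Y) := rfl

omit [LieGroup 𝓘(ℝ, E) ∞ G] in
theorem metricForm_apply (g : Metric F (G ⧸ H)) (X Y : GroupLieAlgebra 𝓘(ℝ, E) G) :
    metricForm E g X Y = g.at ((1 : G) : G ⧸ H) (fund F X ((1 : G) : G ⧸ H))
      (fund F Y ((1 : G) : G ⧸ H)) := by
  rw [fund_one, fund_one]; rfl

omit [LieGroup 𝓘(ℝ, E) ∞ G] in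
theorem metricForm_symm (g : Metric F (G ⧸ H)) (X Y : GroupLieAlgebra 𝓘(ℝ, E) G) :
    metricForm E g X Y = metricForm E g Y X := g.at_symm _ _ _

omit [LieGroup 𝓘(ℝ, E) ∞ G] in
theorem metricForm_eq_zero_right (g : Metric F (G ⧸ H)) (X : GroupLieAlgebra 𝓘(ℝ, E) G)
    {Y : GroupLieAlgebra 𝓘(ℝ, E) G} (hY : dproj F H Y = 0) : metricForm E g X Y = 0 := by
  have h : dprojL E F H Y = 0 := hY
  change g.at _ _ (dprojL E F H Y) = 0
  rw [h, map_zero]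

omit [LieGroup 𝓘(ℝ, E) ∞ G] in
theorem metricForm_pos (g : Metric F (G ⧸ H)) {X : GroupLieAlgebra 𝓘(ℝ, E) G}
    (hX : dproj F H X ≠ 0) : 0 < metricForm E g X X :=
  g.at_pos ((1 : G) : G ⧸ H) (u := dprojL E F H X) hX

theorem IsInvariant.metricForm_Ad {g : Metric F (G ⧸ H)} (hg : IsInvariant g)
    (hM : IsQuotientManifold E F H) {a : G} (ha : a ∈ H) (X Y : GroupLieAlgebra 𝓘(ℝ, E) G) :
    metricForm E g (Ad a X) (Ad a Y) = metricForm E g X Y := by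
  have h := hg.at_fund hM a ((1 : G) : G ⧸ H) X Y
  rw [smul_origin ha] at h
  rw [metricForm_apply, metricForm_apply, h]

variable [FiniteDimensional ℝ E] [FiniteDimensional ℝ F] [T2Space G] [CompleteSpace E]

/-- The geodesics of a geodesic orbit metric that issue from the origin provide geodesic vectors. -/
theorem IsGOMetric.exists_geodesic_vector {g : Metric F (G ⧸ H)} (hg : IsGOMetric E g)
    (hM : IsQuotientManifold E F H) (X : GroupLieAlgebra 𝓘(ℝ, E) G) :
    ∃ X' : GroupLieAlgebra 𝓘(ℝ, E) G, dproj F H X' = dproj F H X ∧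
      ∀ Y, metricForm E g X ⁅X', Y⁆ = 0 := by
  obtain ⟨γ, J, hJ, hJc, h0, hγ, hγ0, hγv⟩ :=
    exists_geodesic g ((1 : G) : G ⧸ H) (dprojL E F H X)
  obtain ⟨φ, hφ, hφγ⟩ := hg.2 γ J hJ hJc h0 hγ
  rw [hγ0] at hφγ
  have hvel : ∀ t ∈ J, vel F γ t = fund F (velocity (E := E) φ) (φ t • ((1 : G) : G ⧸ H)) := by
    intro t ht
    rw [← vel_orbit hM hφ]
    refine vel_congr ?_
    filter_upwards [hJ.mem_nhds ht] with s hs using hφγ s hs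
  have hX : dproj F H (velocity (E := E) φ) = dproj F H X := by
    have h1 := hvel 0 h0
    rw [hφ.map_zero, one_smul, fund_one, hγv] at h1
    exact h1.symm
  refine ⟨velocity φ, hX, fun Y => ?_⟩
  have h1 := hasDerivAt_momentum hg.1 hM hJ hγ Y h0
  -- Translating by `φ s` back to the origin fixes the generator and replaces `Y` by `Ad (φ (-s))
  -- Y`.
  have h2 : (fun s => g.at (γ s) (vel F γ s) (fund F Y (γ s))) =ᶠ[𝓝 0]
      fun s => metricForm E g X (Ad (φ (-s)) Y) := by
    filter_upwards [hJ.mem_nhds h0] with s hs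
    have h3 := hg.1.at_fund hM (φ s) ((1 : G) : G ⧸ H) (velocity (E := E) φ) (Ad (φ (-s)) Y)
    rw [hφ.Ad_velocity, ← Ad_mul, ← hφ.2, add_neg_cancel, hφ.map_zero, Ad_one] at h3
    rw [hvel s hs, hφγ s hs, h3, metricForm_dproj, fund_one, fund_one, hX]
  have h3 : HasDerivAt (F := E) (fun s => Ad (φ (-s)) Y)
      (-⁅velocity (E := E) φ, Y⁆ : GroupLieAlgebra 𝓘(ℝ, E) G) 0 := by
    have hneg : ∀ {f : ℝ → E} {f' : E}, HasDerivAt f f' 0 →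
        HasDerivAt (fun s => f (-s)) (-f') 0 := fun hf => by
      simpa [Function.comp_def] using hf.scomp_of_eq (0 : ℝ) (hasDerivAt_neg (0 : ℝ)) (by simp)
    exact hneg (hasDerivAt_Ad_zero hφ Y)
  have h4 := hasDerivAt_bilinForm (E := E) (metricForm E g) 
    (hasDerivAt_const (F := E) (0 : ℝ) X) h3
  -- The momentum has derivative `0` by Noether and `-g(X, [X', Y])` by the formula above.
  have h5 := (h1.congr_of_eventuallyEq h2.symm).unique h4
  have h6 : 0 = metricForm E g 0 (Ad (φ (-0)) Y) +
      metricForm E g X (-⁅velocity (E := E) φ, Y⁆) := h5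
  rw [map_zero, LinearMap.zero_apply, map_neg, zero_add] at h6
  linarith

variable {b : LinearMap.BilinForm ℝ (GroupLieAlgebra 𝓘(ℝ, E) G)} (hb : IsInvariantEuclidean b)

include hb

omit [T2Space G] in
theorem IsInvariantEuclidean.exists_sub_mem_mSpace (X : GroupLieAlgebra 𝓘(ℝ, E) G) :
    ∃ Z : GroupLieAlgebra 𝓘(ℝ, E) G, Z ∈ lieAlgebraOf E H ∧ X - Z ∈ mSpace b H :=
  exists_sub_mem_orthogonal hb.symm hb.pos (lieAlgebraOf E H).toSubmodule X

-- The defining identity on `𝔪` extends to all `Y`, because both sides vanish for `Y ∈ 𝔥`.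
omit [FiniteDimensional ℝ F] in
theorem IsMetricEndomorphism.metricForm_eq (hM : IsQuotientManifold E F H)
    {g : Metric F (G ⧸ H)} {A : Module.End ℝ (mSpace b H)} (hA : IsMetricEndomorphism b g A)
    (X : mSpace b H) (Y : GroupLieAlgebra 𝓘(ℝ, E) G) :
    metricForm E g X Y = b (A X) Y := by
  obtain ⟨Z, hZ, hYZ⟩ := hb.exists_sub_mem_mSpace (H := H) Y
  have h1 : metricForm E g X (Y - Z) = b (A X) (Y - Z) := hA X ⟨Y - Z, hYZ⟩
  have h2 : b (A X) Z = 0 := by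
    rw [hb.symm]; exact (A X).2 Z hZ
  rw [map_sub, map_sub, h2, metricForm_eq_zero_right g _ ((mem_lieAlgebraOf_iff hM Z).1 hZ)] at h1
  simpa using h1

/-- A geodesic orbit metric satisfies the algebraic geodesic condition. -/
theorem IsGOMetric.goData (hM : IsQuotientManifold E F H) {g : Metric F (G ⧸ H)}
    (hg : IsGOMetric E g) {A : Module.End ℝ (mSpace b H)} (hA : IsMetricEndomorphism b g A)
    {T : Module.End ℝ (GroupLieAlgebra 𝓘(ℝ, E) G)} (hT : ∀ X : mSpace b H, T X = A X) :
    GOData b (lieAlgebraOf E H) T where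
  symm := hb.symm
  pos := hb.pos
  skew := hb.skew
  map_symm X hX Y hY := by
    have h1 := hA.metricForm_eq hb hM ⟨X, hX⟩ Y
    have h2 := hA.metricForm_eq hb hM ⟨Y, hY⟩ X
    rw [← hT] at h1 h2
    rw [← h1, hb.symm X, ← h2]
    exact metricForm_symm g X Y
  map_lie Z hZ X hX := by
    obtain ⟨φ, hφ, rfl⟩ := exists_oneParameterSubgroup Z
    have hφH := mem_of_dproj_velocity_eq_zero hM hφ ((mem_lieAlgebraOf_iff hM _).1 hZ)
    have hZX : ⁅velocity (E := E) φ, X⁆ ∈ mSpace b H := by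
      intro W hW
      have h1 := hX _ ((lieAlgebraOf E H).lie_mem hZ hW)
      change b W ⁅velocity (E := E) φ, X⁆ = 0
      change b ⁅velocity (E := E) φ, W⁆ X = 0 at h1
      rw [hb.skew] at h1
      linarith
    rw [← sub_eq_zero]
    -- The defect `D` is paired with itself: skewness of `ad` for both `b` and the metric form makes
    -- the two contributions cancel.
    set D := T ⁅velocity (E := E) φ, X⁆ - ⁅velocity (E := E) φ, T X⁆ with hD
    refine eq_zero_of_mem_orthogonal hb.pos ?_
    have h1 : b (T ⁅velocity (E := E) φ, X⁆) D = metricForm E g ⁅velocity (E := E) φ, X⁆ D := by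
      rw [hT ⟨_, hZX⟩]; exact (hA.metricForm_eq hb hM ⟨_, hZX⟩ D).symm
    have h2 : b (T X) ⁅velocity (E := E) φ, D⁆ = metricForm E g X ⁅velocity (E := E) φ, D⁆ := by
      rw [hT ⟨X, hX⟩]; exact (hA.metricForm_eq hb hM ⟨X, hX⟩ _).symm
    have h3 := bilinForm_lie_of_Ad_invariant (metricForm E g) hφ
      (fun t => hg.1.metricForm_Ad hM (hφH t)) X D
    have h4 : b D D = b (T ⁅velocity (E := E) φ, X⁆) D - b ⁅velocity (E := E) φ, T X⁆ D := by
      rw [← LinearMap.sub_apply, ← map_sub]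
    rw [h4, h1, h3, hb.skew, h2]
    ring
  geodesic X hX := by
    obtain ⟨X', hX', h⟩ := hg.exists_geodesic_vector hM X
    refine ⟨X' - X, ?_, ?_⟩
    · rw [mem_lieAlgebraOf_iff hM]
      exact (dproj_sub X' X).trans (sub_eq_zero.2 hX')
    · rw [add_sub_cancel]
      refine eq_zero_of_mem_orthogonal hb.pos ?_
      -- `b ⁅X', T X⁆ Y = -b (T X) ⁅X', Y⁆`, which is minus the metric pairing of `X` with `⁅X',
      -- Y⁆`, hence zero.
      rw [hb.skew, hT ⟨X, hX⟩, ← hA.metricForm_eq hb hM]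
      rw [h, neg_zero]

variable {k k' : LieSubalgebra ℝ (GroupLieAlgebra 𝓘(ℝ, E) G)}
  (hk : lieAlgebraOf E H ≤ k) (hk' : lieAlgebraOf E H ≤ k')

omit [FiniteDimensional ℝ E] [T2Space G] hb in
theorem mem_qSpace_iff (X : GroupLieAlgebra 𝓘(ℝ, E) G) :
    X ∈ qSpace b H k k' ↔ X ∈ k ⊓ k' ∧ X ∈ b.orthogonal (lieAlgebraOf E H).toSubmodule :=
  ⟨fun h => ⟨⟨h.1.1, h.2.1⟩, h.1.2⟩, fun h => ⟨⟨h.1.1, h.2⟩, h.1.2, h.2⟩⟩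

-- Since `𝔨 ∩ 𝔨' = 𝔥 + 𝔮`, orthogonality to `𝔥` and `𝔮` can be stated through the subalgebras alone,
-- the form used by the algebraic core.
omit [T2Space G] in
include hk hk' in
theorem mem_orthogonal_qSpace (X : GroupLieAlgebra 𝓘(ℝ, E) G) :
    (X ∈ mSpace b H ∧ X ∈ b.orthogonal (qSpace b H k k')) ↔ ∀ Y ∈ k ⊓ k', b Y X = 0 := by
  refine ⟨fun hX Y hY => ?_, fun h => ⟨fun Y hY => h Y ⟨hk hY, hk' hY⟩, fun Y hY =>
    h Y ⟨hY.1.1, hY.2.1⟩⟩⟩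
  obtain ⟨Z, hZ, hYZ⟩ := hb.exists_sub_mem_mSpace (H := H) Y
  have h1 : b Z X = 0 := hX.1 Z hZ
  have h2 : b (Y - Z) X = 0 := hX.2 _ ((mem_qSpace_iff _).2
    ⟨(k ⊓ k').sub_mem hY ⟨hk hZ, hk' hZ⟩, hYZ⟩)
  rw [map_sub, LinearMap.sub_apply, h1, sub_zero] at h2
  exact h2

omit [T2Space G] in
include hk hk' in
theorem mem_p1Space_iff (X : GroupLieAlgebra 𝓘(ℝ, E) G) :
    X ∈ p1Space b H k k' ↔ X ∈ k ∧ ∀ Y ∈ k ⊓ k', b Y X = 0 := by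
  rw [← mem_orthogonal_qSpace hb hk hk']
  exact and_assoc

omit [T2Space G] in
include hk hk' in
theorem mem_p2Space_iff (X : GroupLieAlgebra 𝓘(ℝ, E) G) :
    X ∈ p2Space b H k k' ↔ X ∈ k' ∧ ∀ Y ∈ k ⊓ k', b Y X = 0 := by
  rw [← mem_orthogonal_qSpace hb hk hk']
  exact and_assoc

omit [T2Space G] in
include hk hk' in
theorem mem_nSpace_iff (X : GroupLieAlgebra 𝓘(ℝ, E) G) :
    X ∈ nSpace b H k k' ↔ (∀ Y ∈ k, b Y X = 0) ∧ ∀ Y ∈ k', b Y X = 0 := by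
  -- A subalgebra `j` containing `𝔥` is `𝔥 + (j ∩ 𝔪)`.
  have key : ∀ j : LieSubalgebra ℝ (GroupLieAlgebra 𝓘(ℝ, E) G), lieAlgebraOf E H ≤ j →
      X ∈ mSpace b H → (∀ Y ∈ pSpace b H j, b Y X = 0) → ∀ Y ∈ j, b Y X = 0 := by
    intro j hj hX h Y hY
    obtain ⟨Z, hZ, hYZ⟩ := hb.exists_sub_mem_mSpace (H := H) Y
    have h1 : b Z X = 0 := hX Z hZ
    have h2 : b (Y - Z) X = 0 := h _ ⟨j.sub_mem hY (hj hZ), hYZ⟩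
    rw [map_sub, LinearMap.sub_apply, h1, sub_zero] at h2
    exact h2
  constructor
  · rintro ⟨h1, h2⟩
    exact ⟨key k hk h1 fun Y hY => h2 Y (Submodule.mem_sup_left hY),
      key k' hk' h1 fun Y hY => h2 Y (Submodule.mem_sup_right hY)⟩
  · rintro ⟨h1, h2⟩
    refine ⟨fun Y hY => h1 Y (hk hY), fun Y hY => ?_⟩
    obtain ⟨U, hU, V, hV, rfl⟩ := Submodule.mem_sup.1 hY
    change b (U + V) X = 0
    rw [map_add, LinearMap.add_apply, h1 U hU.1, h2 V hV.1, add_zero]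

include hk hk' in
/-- A geodesic orbit metric whose metric endomorphism preserves the decomposition defined by two
generating subalgebras is scalar outside their intersection. -/
theorem IsGOMetric.exists_eq_smul (hM : IsQuotientManifold E F H) (hk_proper : k ≠ ⊤)
    (hk'_proper : k' ≠ ⊤) (hgen : k ⊔ k' = ⊤)
    (horth : ∀ X ∈ p1Space b H k k', ∀ Y ∈ p2Space b H k k', b X Y = 0)
    (hcomm : NoCommutingSubmodules b H k k') {g : Metric F (G ⧸ H)}
    (hg : IsGOMetric E g) {A : Module.End ℝ (mSpace b H)} (hA : IsMetricEndomorphism b g A)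
    (hAq : Preserves A (qSpace b H k k')) (hA₁ : Preserves A (p1Space b H k k'))
    (hA₂ : Preserves A (p2Space b H k k')) (hAn : Preserves A (nSpace b H k k')) :
    ∃ c : ℝ, ∀ X : mSpace b H, (X : GroupLieAlgebra 𝓘(ℝ, E) G) ∈ p1Space b H k k' ⊔
      p2Space b H k k' ⊔ nSpace b H k k' → A X = c • X := by
  -- Any linear extension of `A` to the Lie algebra serves, since only its values on `𝔪` matter.
  obtain ⟨T, hT⟩ := LinearMap.exists_extend ((mSpace b H).subtype ∘ₗ A)
  have hT' : ∀ X : mSpace b H, T X = A X := fun X => LinearMap.congr_fun hT X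
  have hpres : ∀ V : Submodule ℝ (GroupLieAlgebra 𝓘(ℝ, E) G), V ≤ mSpace b H → Preserves A V →
      ∀ X ∈ V, T X ∈ V := by
    intro V hV hAV X hX
    rw [hT' ⟨X, hV hX⟩]
    exact hAV ⟨X, hV hX⟩ hX
  obtain ⟨c, hc⟩ := (hg.goData hb hM hA hT').exists_eq_smul hk hk' hk_proper hk'_proper hgen
    mem_qSpace_iff (mem_p1Space_iff hb hk hk') (mem_p2Space_iff hb hk hk')
    (mem_nSpace_iff hb hk hk') horth hcomm
    (hpres _ (fun X hX => hX.1.2) hAq) (hpres _ (fun X hX => hX.1.2) hA₁)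
    (hpres _ (fun X hX => hX.1.2) hA₂) (hpres _ (fun X hX => hX.1) hAn)
  refine ⟨c, fun X hX => Subtype.ext ?_⟩
  rw [← hT', hc X hX]
  rfl

end GeodesicLemma

/-! ### Normal metrics are GO -/

section NormalMetric

variable {E : Type*} [NormedAddCommGroup E] [NormedSpace ℝ E]
  {F : Type*} [NormedAddCommGroup F] [NormedSpace ℝ F]
  {G : Type*} [TopologicalSpace G] [ChartedSpace E G] [Group G] [LieGroup 𝓘(ℝ, E) ∞ G]
  {H : Subgroup G} [ChartedSpace F (G ⧸ H)] [IsManifold 𝓘(ℝ, F) ∞ (G ⧸ H)]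

/-- A curve tangent to a fundamental vector field is an orbit of the one-parameter subgroup. -/
theorem eq_smul_of_vel_eq_fund (hM : IsQuotientManifold E F H) {φ : ℝ → G}
    (hφ : IsOneParameterSubgroup E φ) {γ : ℝ → G ⧸ H} {J : Set ℝ} (hJ : IsOpen J)
    (hJc : J.OrdConnected) (h0 : (0 : ℝ) ∈ J) (hγ : ∀ t ∈ J, DiffAt ℝ F γ t)
    (hvel : ∀ t ∈ J, vel F γ t = fund F (velocity (E := E) φ) (γ t)) {t : ℝ} (ht : t ∈ J) :
    γ t = φ t • γ 0 := by
  -- The curve `φ (-r) • γ r` has zero velocity: the two Leibniz terms are opposite because `Ad (φ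
  -- (-s))` fixes the generator.
  have key : ∀ s ∈ J, DiffAt ℝ F (fun r => φ (-r) • γ r) s ∧
      vel F (fun r => φ (-r) • γ r) s = 0 := by
    intro s hs
    have hneg : DiffAt ℝ ℝ (fun r : ℝ => -r) s := diffAt_iff.2 differentiableAt_id.neg
    obtain ⟨h1, h2⟩ := dAt_prod (α := fun p : ℝ × (G ⧸ H) => φ p.1 • p.2)
      (((contMDiff_orbitFlow hM hφ).contMDiffAt (x := (-s, γ s))).mdifferentiableAt (by simp))
      hneg (hγ s hs)
    refine ⟨h1, h2.trans ?_⟩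
    rw [← vel_comp (diffAt_orbit_curve hM hφ (γ s) (-s)) hneg,
      vel_reparam (γ := fun r => φ r • γ s) (r := fun r => -r) (diffAt_orbit_curve hM hφ (γ s) (-s))
        (hasDerivAt_neg s),
      vel_orbit hM hφ, hvel s hs]
    change _ + dAt F F (fun y => φ (-s) • y) (γ s) _ = 0
    rw [dAt_smul_fund hM, hφ.Ad_velocity, neg_smul, one_smul,
      neg_add_cancel]
  have h1 := eq_of_vel_eq_zero hJ hJc key ht h0
  simp only [neg_zero, hφ.map_zero, one_smul] at h1
  rw [← h1, hφ.map_neg, smul_inv_smul]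

variable [FiniteDimensional ℝ E] [FiniteDimensional ℝ F] [T2Space G] [CompleteSpace E]
  {b : LinearMap.BilinForm ℝ (GroupLieAlgebra 𝓘(ℝ, E) G)} (hb : IsInvariantEuclidean b)

include hb

omit [FiniteDimensional ℝ F] in
/-- For a metric proportional to `b`, tangent vectors are values of fundamental vector fields
whose momentum is given by `b`. -/
theorem exists_fund_eq (hM : IsQuotientManifold E F H) {g : Metric F (G ⧸ H)}
    (hg : IsInvariant g) {c : ℝ} (hc : ∀ X ∈ mSpace b H, ∀ Y ∈ mSpace b H,
      metricForm E g X Y = c * b X Y) (x : G ⧸ H) (v : F) :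
    ∃ V : GroupLieAlgebra 𝓘(ℝ, E) G, fund F V x = v ∧
      ∀ Y : GroupLieAlgebra 𝓘(ℝ, E) G, g.at x v (fund F Y x) = c * b V Y := by
  obtain ⟨a, rfl⟩ := QuotientGroup.mk_surjective x
  have ha : (a : G ⧸ H) = a • ((1 : G) : G ⧸ H) := by
    rw [MulAction.Quotient.smul_coe, smul_eq_mul, mul_one]
  rw [ha]
  obtain ⟨W, rfl⟩ := fund_surjective hM (a • ((1 : G) : G ⧸ H)) v
  -- Move the vector to the origin and keep only the `𝔪`-component of its generator; there the
  -- metric is `c` times `b`, even when paired with `𝔥`.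
  obtain ⟨Z, hZ, hX⟩ := hb.exists_sub_mem_mSpace (H := H) (Ad a⁻¹ W)
  set X := Ad a⁻¹ W - Z with hXdef
  have hc' : ∀ Y, metricForm E g X Y = c * b X Y := by
    intro Y
    obtain ⟨U, hU, hY⟩ := hb.exists_sub_mem_mSpace (H := H) Y
    have h1 := hc X hX _ hY
    have h2 : b X U = 0 := (hb.symm X U).trans (hX U hU)
    rw [(metricForm E g X).map_sub, (b X).map_sub, h2,
      metricForm_eq_zero_right g _ ((mem_lieAlgebraOf_iff hM U).1 hU),
      sub_zero, sub_zero] at h1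
    exact h1
  have hW : fund F (Ad a X) (a • ((1 : G) : G ⧸ H)) = fund F W (a • ((1 : G) : G ⧸ H)) := by
    have h1 : W = Ad a (Ad a⁻¹ W) := by rw [← Ad_mul, mul_inv_cancel, Ad_one]
    rw [h1, ← dAt_smul_fund hM, ← dAt_smul_fund hM, fund_one, fund_one, hXdef]
    congr 1
    exact (dproj_sub _ _).trans ((congrArg _ ((mem_lieAlgebraOf_iff hM Z).1 hZ)).trans (sub_zero _))
  refine ⟨Ad a X, hW, fun Y => ?_⟩
  have hY : Y = Ad a (Ad a⁻¹ Y) := by rw [← Ad_mul, mul_inv_cancel, Ad_one]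
  change g.at _ (fund F W (a • ((1 : G) : G ⧸ H))) _ = _
  rw [← hW, hY, hg.at_fund hM, ← metricForm_apply, hc', hb.ad_invariant]

/-- Normal metrics are geodesic orbit metrics. -/
theorem IsNormalMetric.isGOMetric (hM : IsQuotientManifold E F H) {g : Metric F (G ⧸ H)}
    (hg : IsNormalMetric b g) : IsGOMetric E g := by
  obtain ⟨hinv, c, hcpos, hc⟩ := hg
  refine ⟨hinv, fun γ J hJ hJc h0 hγ => ?_⟩
  have key := fun t : ℝ => exists_fund_eq hb hM hinv hc (γ t) (vel F γ t)
  choose V hV hmom using key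
  -- The momentum of `γ` against `Y` is `c * b (V t) Y`. Its conservation for all `Y`, with `c ≠ 0`,
  -- makes `V` constant.
  have hconst : ∀ t ∈ J, V t = V 0 := by
    intro t ht
    rw [← sub_eq_zero]
    refine eq_zero_of_mem_orthogonal hb.pos ?_
    have h1 : ∀ Y, b (V t) Y = b (V 0) Y := by
      intro Y
      have hd := fun s (hs : s ∈ J) => hasDerivAt_momentum hinv hM hJ hγ Y hs
      have h2 := hJ.is_const_of_deriv_eq_zero hJc.isPreconnected
        (fun s hs => (hd s hs).differentiableAt.differentiableWithinAt)
        (fun s hs => (hd s hs).deriv) ht h0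
      rw [hmom, hmom] at h2
      exact mul_left_cancel₀ hcpos.ne' h2
    rw [b.map_sub, LinearMap.sub_apply, h1, sub_self]
  obtain ⟨φ, hφ, hφV⟩ := exists_oneParameterSubgroup (V 0)
  refine ⟨φ, hφ, fun t ht => eq_smul_of_vel_eq_fund hM hφ hJ hJc h0 (fun s hs =>
    (hγ.1.contMDiffAt (hJ.mem_nhds hs)).mdifferentiableAt (by simp)) (fun s hs => ?_) ht⟩
  rw [hφV, ← hconst s hs, hV]

end NormalMetric

/-! ### Representing bilinear forms on subspaces -/

section Representation

variable {L : Type*} [AddCommGroup L] [Module ℝ L] [FiniteDimensional ℝ L]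

/-- A bilinear form is represented on a subspace by a positive definite form. -/
theorem exists_bilinForm_repr {b : LinearMap.BilinForm ℝ L} (hsymm : ∀ X Y, b X Y = b Y X)
    (hpos : ∀ X, X ≠ 0 → 0 < b X X) (B : LinearMap.BilinForm ℝ L) (U : Submodule ℝ L) :
    ∃ f : L →ₗ[ℝ] U, ∀ (X : L) (Y : U), b (f X) Y = B X Y := by
  have hnd : (b.restrict U).Nondegenerate := by
    have hsep : ∀ Y : U, (∀ Z : U, b Y Z = 0) → Y = 0 := fun Y hY =>
      Subtype.ext (eq_zero_of_mem_orthogonal hpos (hY Y))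
    refine ⟨fun Y hY => hsep Y hY, fun Y hY => hsep Y fun Z => ?_⟩
    rw [hsymm]; exact hY Z
  refine ⟨((b.restrict U).toDual hnd).symm.toLinearMap ∘ₗ U.subtype.dualMap ∘ₗ B, fun X Y => ?_⟩
  exact LinearMap.BilinForm.apply_toDual_symm_apply (B := b.restrict U) (hB := hnd)
    (U.subtype.dualMap (B X)) Y

omit [FiniteDimensional ℝ L] in
/-- A vector of `P + R` orthogonal to `R` lies in `P`, if `P` and `R` are orthogonal. -/
theorem mem_of_mem_sup_of_orthogonal {b : LinearMap.BilinForm ℝ L}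
    (hpos : ∀ X, X ≠ 0 → 0 < b X X) {P R : Submodule ℝ L} (hPR : ∀ X ∈ P, ∀ Y ∈ R, b X Y = 0)
    {X : L} (hX : X ∈ P ⊔ R) (hXR : ∀ Y ∈ R, b X Y = 0) : X ∈ P := by
  obtain ⟨U, hU, V, hV, rfl⟩ := Submodule.mem_sup.1 hX
  have h1 := hXR V hV
  rw [map_add, LinearMap.add_apply, hPR U hU V hV, zero_add] at h1
  rw [eq_zero_of_mem_orthogonal hpos h1, add_zero]
  exact hU

end Representation

/-! ### Schur's lemma and the strictly non-equivalent case -/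

section DisjointModules

variable {E : Type*} [NormedAddCommGroup E] [NormedSpace ℝ E]
  {F : Type*} [NormedAddCommGroup F] [NormedSpace ℝ F]
  {G : Type*} [TopologicalSpace G] [ChartedSpace E G] [Group G] [LieGroup 𝓘(ℝ, E) ∞ G]
  {H : Subgroup G}

variable [FiniteDimensional ℝ E]
  {b : LinearMap.BilinForm ℝ (GroupLieAlgebra 𝓘(ℝ, E) G)} (hb : IsInvariantEuclidean b)

/-- **Schur's lemma**: disjoint modules are orthogonal for each invariant bilinear form. -/
theorem AreDisjointModules.bilinForm_eq_zero (hb : IsInvariantEuclidean b)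
    {B : LinearMap.BilinForm ℝ (GroupLieAlgebra 𝓘(ℝ, E) G)}
    (hB : ∀ a ∈ H, ∀ X Y, B (Ad a X) (Ad a Y) = B X Y)
    {P Q : Submodule ℝ (GroupLieAlgebra 𝓘(ℝ, E) G)} (hP : IsAdSubmodule H P)
    (hQ : IsAdSubmodule H Q) (hPQ : AreDisjointModules H P Q) :
    ∀ X ∈ P, ∀ Y ∈ Q, B X Y = 0 := by
  have hAdinv : ∀ (a : G) (X : GroupLieAlgebra 𝓘(ℝ, E) G), Ad a (Ad a⁻¹ X) = X := fun a X => by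
    rw [← Ad_mul, mul_inv_cancel, Ad_one]
  -- `f` is the `Q`-valued operator with `b (f X) Y = B X Y`; invariance of `b` and `B` makes it
  -- `Ad_H`-equivariant.
  obtain ⟨f, hf⟩ := exists_bilinForm_repr hb.symm hb.pos B Q
  have hfAd : ∀ a ∈ H, ∀ X, (f (Ad a X) : GroupLieAlgebra 𝓘(ℝ, E) G) = Ad (E := E) a (f X) := by
    intro a ha X
    have hmem : Ad (E := E) a (f X : GroupLieAlgebra 𝓘(ℝ, E) G) ∈ Q := hQ a ha _ (f X).2
    rw [← sub_eq_zero]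
    have key : ∀ Y ∈ Q, b (f (Ad a X) - Ad (E := E) a (f X)) Y = 0 := by
      intro Y hY
      have h1 := hf X ⟨_, hQ a⁻¹ (H.inv_mem ha) Y hY⟩
      have h2 := hf (Ad a X) ⟨Y, hY⟩
      have h3 := hb.ad_invariant a (f X) (Ad a⁻¹ Y)
      have h4 := hB a ha X (Ad a⁻¹ Y)
      rw [hAdinv] at h3 h4
      rw [b.map_sub, LinearMap.sub_apply, h2, h3, h1, h4, sub_self]
    exact eq_zero_of_mem_orthogonal hb.pos (key _ (Q.sub_mem (f _).2 hmem))
  let K : Submodule ℝ (GroupLieAlgebra 𝓘(ℝ, E) G) := P ⊓ LinearMap.ker f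
  have hK : IsAdSubmodule H K := by
    rintro a ha X ⟨hXP, hX⟩
    have hX' : f X = 0 := hX
    refine ⟨hP a ha X hXP, ?_⟩
    change f (Ad a X) = 0
    have h1 := hfAd a ha X
    rw [hX'] at h1
    have h2 : (f (Ad a X) : GroupLieAlgebra 𝓘(ℝ, E) G) = 0 :=
      h1.trans ((dAt E E (fun x : G => a * x * a⁻¹) 1).map_zero)
    exact Subtype.ext h2
  -- The complement of the kernel of `f` in `P` is mapped isomorphically onto a submodule of `Q`, so
  -- disjointness kills it and `f` vanishes on `P`.
  let V : Submodule ℝ (GroupLieAlgebra 𝓘(ℝ, E) G) := P ⊓ b.orthogonal K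
  have hV : IsAdSubmodule H V := by
    rintro a ha X ⟨hXP, hX⟩
    refine ⟨hP a ha X hXP, fun Z hZ => ?_⟩
    have h1 : b (Ad a⁻¹ Z) X = 0 := hX _ (hK a⁻¹ (H.inv_mem ha) Z hZ)
    change b Z (Ad a X) = 0
    rw [← h1, ← hb.ad_invariant a (Ad a⁻¹ Z), hAdinv]
  let fV : V →ₗ[ℝ] GroupLieAlgebra 𝓘(ℝ, E) G := Q.subtype ∘ₗ f ∘ₗ V.subtype
  have hinj : Function.Injective fV := by
    refine (injective_iff_map_eq_zero fV).2 fun X hX => Subtype.ext ?_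
    have h1 : f X = 0 := Subtype.ext hX
    exact eq_zero_of_mem_orthogonal hb.pos (X.2.2 X ⟨X.2.1, h1⟩)
  have hW : IsAdSubmodule H (LinearMap.range fV) := by
    rintro a ha _ ⟨X, rfl⟩
    exact ⟨⟨Ad a X, hV a ha X X.2⟩, hfAd a ha X⟩
  have hbot : V = ⊥ := by
    refine hPQ V (LinearMap.range fV) inf_le_left ?_ hV hW (LinearEquiv.ofInjective fV hinj) ?_
    · rintro _ ⟨X, rfl⟩
      exact (f X).2
    · intro a ha X X' hX
      have h1 := hfAd a ha X
      rw [← hX] at h1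
      exact h1
  intro X hX Y hY
  obtain ⟨Z, hZ, hXZ⟩ := exists_sub_mem_orthogonal hb.symm hb.pos K X
  have h1 : X - Z ∈ V := ⟨P.sub_mem hX hZ.1, hXZ⟩
  rw [hbot, Submodule.mem_bot, sub_eq_zero] at h1
  have h2 : f X = 0 := h1 ▸ hZ.2
  rw [← hf X ⟨Y, hY⟩, h2]
  simp

variable [CompleteSpace E] [T2Space G] {k k' : LieSubalgebra ℝ (GroupLieAlgebra 𝓘(ℝ, E) G)}

-- With `𝔮 = 0` orthogonality to `𝔮` is no condition, so `𝔭₁ = 𝔭` and `𝔭₂ = 𝔭'`, and `𝔫` is the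
-- complement of their sum.
omit [T2Space G] in
include hb in
theorem mSpace_le_sup_of_qSpace_eq_bot (hq : qSpace b H k k' = ⊥) :
    mSpace b H ≤ p1Space b H k k' ⊔ p2Space b H k k' ⊔ nSpace b H k k' := by
  have h1 : p1Space b H k k' = pSpace b H k := by
    rw [p1Space, hq]; exact inf_eq_left.2 fun X _ Y hY => by
      rw [(Submodule.mem_bot ℝ).1 hY]; exact LinearMap.map_zero₂ b X
  have h2 : p2Space b H k k' = pSpace b H k' := by
    rw [p2Space, hq]; exact inf_eq_left.2 fun X _ Y hY => by
      rw [(Submodule.mem_bot ℝ).1 hY]; exact LinearMap.map_zero₂ b X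
  intro X hX
  rw [h1, h2]
  obtain ⟨Y, hY, hXY⟩ := exists_sub_mem_orthogonal hb.symm hb.pos (pSpace b H k ⊔ pSpace b H k') X
  have hYm : Y ∈ mSpace b H :=
    (sup_le inf_le_right inf_le_right : pSpace b H k ⊔ pSpace b H k' ≤ mSpace b H) hY
  have h3 : X - Y ∈ nSpace b H k k' := ⟨(mSpace b H).sub_mem hX hYm, hXY⟩
  have h4 := Submodule.add_mem_sup hY h3
  rwa [add_sub_cancel] at h4

variable [FiniteDimensional ℝ F] [ChartedSpace F (G ⧸ H)] [IsManifold 𝓘(ℝ, F) ∞ (G ⧸ H)]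

omit [T2Space G] [FiniteDimensional ℝ F] in
include hb in
/-- The metric endomorphism of an invariant metric exists. -/
theorem exists_isMetricEndomorphism (g : Metric F (G ⧸ H)) :
    ∃ A : Module.End ℝ (mSpace b H), IsMetricEndomorphism b g A := by
  obtain ⟨f, hf⟩ := exists_bilinForm_repr hb.symm hb.pos (metricForm E g) (mSpace b H)
  exact ⟨f ∘ₗ (mSpace b H).subtype, fun X Y => (hf X Y).symm⟩

include hb in
/-- If the decomposition defined by two generating subalgebras consists of disjoint `Ad_H`-modules
and the subalgebras meet in the isotropy subalgebra, geodesic orbit metrics are normal. -/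
theorem IsGOMetric.isNormalMetric (hM : IsQuotientManifold E F H)
    (hk : lieAlgebraOf E H ≤ k) (hk' : lieAlgebraOf E H ≤ k') (hk_proper : k ≠ ⊤)
    (hk'_proper : k' ≠ ⊤) (hgen : k ⊔ k' = ⊤)
    (horth : ∀ X ∈ p1Space b H k k', ∀ Y ∈ p2Space b H k k', b X Y = 0)
    (hcomm : NoCommutingSubmodules b H k k') (hq : qSpace b H k k' = ⊥)
    (h₁ : IsAdSubmodule H (p1Space b H k k')) (h₂ : IsAdSubmodule H (p2Space b H k k'))
    (hn : IsAdSubmodule H (nSpace b H k k'))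
    (h₁₂ : AreDisjointModules H (p1Space b H k k') (p2Space b H k k'))
    (h₁n : AreDisjointModules H (p1Space b H k k') (nSpace b H k k'))
    (h₂n : AreDisjointModules H (p2Space b H k k') (nSpace b H k k'))
    {g : Metric F (G ⧸ H)} (hg : IsGOMetric E g) : IsNormalMetric b g := by
  obtain ⟨A, hA⟩ := exists_isMetricEndomorphism hb g
  have hm := mSpace_le_sup_of_qSpace_eq_bot hb hq
  have hB : ∀ a ∈ H, ∀ X Y, metricForm E g (Ad a X) (Ad a Y) = metricForm E g X Y :=
    fun a ha => hg.1.metricForm_Ad hM ha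
  have g₁₂ := h₁₂.bilinForm_eq_zero hb hB h₁ h₂
  have g₁n := h₁n.bilinForm_eq_zero hb hB h₁ hn
  have g₂n := h₂n.bilinForm_eq_zero hb hB h₂ hn
  have o₁n : ∀ X ∈ p1Space b H k k', ∀ Y ∈ nSpace b H k k', b X Y = 0 := fun X hX Y hY =>
    hY.2 X (Submodule.mem_sup_left hX.1)
  have o₂n : ∀ X ∈ p2Space b H k k', ∀ Y ∈ nSpace b H k k', b X Y = 0 := fun X hX Y hY =>
    hY.2 X (Submodule.mem_sup_right hX.1)
  have hsplit : ∀ {P R S : Submodule ℝ (GroupLieAlgebra 𝓘(ℝ, E) G)}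
      {B : LinearMap.BilinForm ℝ (GroupLieAlgebra 𝓘(ℝ, E) G)},
      (∀ X ∈ P, ∀ Y ∈ R, B X Y = 0) → (∀ X ∈ P, ∀ Y ∈ S, B X Y = 0) →
      ∀ X ∈ P, ∀ Y ∈ R ⊔ S, B X Y = 0 := by
    intro P R S B hR hS X hX Y hY
    obtain ⟨U, hU, V, hV, rfl⟩ := Submodule.mem_sup.1 hY
    rw [(B X).map_add, hR X hX U hU, hS X hX V hV, add_zero]
  -- If `P` and `R` span `𝔪` and are orthogonal for both `b` and `g`, then `A P` is `b`-orthogonal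
  -- to `R`, hence contained in `P`.
  have hpres : ∀ {P R : Submodule ℝ (GroupLieAlgebra 𝓘(ℝ, E) G)}, R ≤ mSpace b H →
      mSpace b H ≤ P ⊔ R → (∀ X ∈ P, ∀ Y ∈ R, b X Y = 0) →
      (∀ X ∈ P, ∀ Y ∈ R, metricForm E g X Y = 0) → Preserves A P := by
    intro P R hRm hPR ho hgo X hX
    refine mem_of_mem_sup_of_orthogonal hb.pos ho (hPR (A X).2) fun Y hY => ?_
    rw [← hA.metricForm_eq hb hM, hgo X hX Y hY]
  have hp₁m : p1Space b H k k' ≤ mSpace b H := fun X hX => hX.1.2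
  have hp₂m : p2Space b H k k' ≤ mSpace b H := fun X hX => hX.1.2
  have hnm : nSpace b H k k' ≤ mSpace b H := fun X hX => hX.1
  have flip : ∀ {P R : Submodule ℝ (GroupLieAlgebra 𝓘(ℝ, E) G)}
      {B : LinearMap.BilinForm ℝ (GroupLieAlgebra 𝓘(ℝ, E) G)}, (∀ X Y, B X Y = B Y X) →
      (∀ X ∈ P, ∀ Y ∈ R, B X Y = 0) → ∀ X ∈ R, ∀ Y ∈ P, B X Y = 0 :=
    fun hsymm h X hX Y hY => (hsymm X Y).trans (h Y hY X hX)
  obtain ⟨c, hc⟩ := hg.exists_eq_smul hb hk hk' hM hk_proper hk'_proper hgen horth hcomm hA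
    (fun X hX => by
      rw [hq, Submodule.mem_bot] at hX ⊢
      rw [Subtype.ext (a1 := X) (a2 := 0) hX, map_zero]; rfl)
    (hpres (sup_le hp₂m hnm) (by rwa [← sup_assoc]) (hsplit horth o₁n) (hsplit g₁₂ g₁n))
    (hpres (sup_le hp₁m hnm) (by rwa [← sup_assoc, sup_comm (p2Space b H k k')])
      (hsplit (flip hb.symm horth) o₂n) (hsplit (flip (metricForm_symm g) g₁₂) g₂n))
    (hpres (sup_le hp₁m hp₂m) (by rwa [sup_comm])
      (hsplit (flip hb.symm o₁n) (flip hb.symm o₂n))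
      (hsplit (flip (metricForm_symm g) g₁n) (flip (metricForm_symm g) g₂n)))
  have hgc : ∀ X ∈ mSpace b H, ∀ Y, metricForm E g X Y = c * b X Y := by
    intro X hX Y
    have h1 := hA.metricForm_eq hb hM ⟨X, hX⟩ Y
    rw [hc ⟨X, hX⟩ (hm hX)] at h1
    rw [h1]
    change b (c • X) Y = _
    rw [b.map_smul, LinearMap.smul_apply, smul_eq_mul]
  refine ⟨hg.1, ?_⟩
  -- Positivity of `c` is read off a non-zero vector of `𝔪`; if `𝔪 = 0` any constant serves and `1`
  -- is taken.
  by_cases h0 : ∃ X ∈ mSpace b H, X ≠ 0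
  · obtain ⟨X, hX, hX0⟩ := h0
    refine ⟨c, ?_, fun X hX Y _ => hgc X hX Y⟩
    have h1 : dproj F H X ≠ 0 := fun h =>
      hX0 (eq_zero_of_mem_orthogonal hb.pos (hX X ((mem_lieAlgebraOf_iff hM X).2 h)))
    have h2 := metricForm_pos g h1
    rw [hgc X hX] at h2
    exact pos_of_mul_pos_left h2 (hb.pos X hX0).le
  · push Not at h0
    refine ⟨1, one_pos, fun X hX Y _ => ?_⟩
    change metricForm E g X Y = _
    rw [hgc X hX, h0 X hX]
    simp

end DisjointModules

end GOSpace

end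

/-! ### The theorem -/

theorem proposition4p2
    {E : Type*} [NormedAddCommGroup E] [NormedSpace ℝ E] [FiniteDimensional ℝ E] [CompleteSpace E]
    {F : Type*} [NormedAddCommGroup F] [NormedSpace ℝ F] [FiniteDimensional ℝ F]
    {G : Type*} [TopologicalSpace G] [ChartedSpace E G] [Group G] [LieGroup 𝓘(ℝ, E) ∞ G]
    [T2Space G] [CompactSpace G]
    (H : Subgroup G) (hH : IsClosed (H : Set G))
    [ChartedSpace F (G ⧸ H)] [IsManifold 𝓘(ℝ, F) ∞ (G ⧸ H)]
    (hM : GOSpace.IsQuotientManifold E F H)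
    (b : LinearMap.BilinForm ℝ (GroupLieAlgebra 𝓘(ℝ, E) G))
    (hb : GOSpace.IsInvariantEuclidean b)
    (k k' : LieSubalgebra ℝ (GroupLieAlgebra 𝓘(ℝ, E) G))
    (hk : GOSpace.lieAlgebraOf E H ≤ k) (hk' : GOSpace.lieAlgebraOf E H ≤ k')
    (hk_proper : k ≠ ⊤) (hk'_proper : k' ≠ ⊤)
    (hgen : k ⊔ k' = ⊤)
    (horth : ∀ X ∈ GOSpace.p1Space b H k k', ∀ Y ∈ GOSpace.p2Space b H k k', b X Y = 0)
    (hcomm : GOSpace.NoCommutingSubmodules b H k k') :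
    (∀ g : GOSpace.Metric F (G ⧸ H), GOSpace.IsGOMetric E g →
      ∀ A : Module.End ℝ (GOSpace.mSpace b H), GOSpace.IsMetricEndomorphism b g A →
        GOSpace.Preserves A (GOSpace.qSpace b H k k') →
        GOSpace.Preserves A (GOSpace.p1Space b H k k') →
        GOSpace.Preserves A (GOSpace.p2Space b H k k') →
        GOSpace.Preserves A (GOSpace.nSpace b H k k') →
        ∃ c : ℝ, ∀ X : GOSpace.mSpace b H,
          (X : GroupLieAlgebra 𝓘(ℝ, E) G) ∈ GOSpace.p1Space b H k k' ⊔
            GOSpace.p2Space b H k k' ⊔ GOSpace.nSpace b H k k' →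
          A X = c • X) ∧
    (GOSpace.qSpace b H k k' = ⊥ →
      GOSpace.IsAdSubmodule H (GOSpace.p1Space b H k k') →
      GOSpace.IsAdSubmodule H (GOSpace.p2Space b H k k') →
      GOSpace.IsAdSubmodule H (GOSpace.nSpace b H k k') →
      GOSpace.AreDisjointModules H (GOSpace.p1Space b H k k') (GOSpace.p2Space b H k k') →
      GOSpace.AreDisjointModules H (GOSpace.p1Space b H k k') (GOSpace.nSpace b H k k') →
      GOSpace.AreDisjointModules H (GOSpace.p2Space b H k k') (GOSpace.nSpace b H k k') →
      ∀ g : GOSpace.Metric F (G ⧸ H), GOSpace.IsGOMetric E g ↔ GOSpace.IsNormalMetric b g) := by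
  refine ⟨fun g hg A hA hAq hA₁ hA₂ hAn => hg.exists_eq_smul hb hk hk' hM hk_proper hk'_proper hgen
    horth hcomm hA hAq hA₁ hA₂ hAn, fun hq h₁ h₂ hn h₁₂ h₁n h₂n g => ⟨fun hg => ?_, fun hg => ?_⟩⟩
  · exact hg.isNormalMetric hb hM hk hk' hk_proper hk'_proper hgen horth hcomm hq h₁ h₂ hn
      h₁₂ h₁n h₂n
  · exact hg.isGOMetric hb hM
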